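/- Let $\Gamma_{\mathrm{wr}}, \Gamma_{\mathrm{q}}, \Gamma_{\mathrm{r}}$ be finite pairwise disjoint alphabets, $\Gamma_{\mathrm q},\Gamma_{\mathrm r}\neq\varnothing$, let $\mathrm{valid}\subseteq\Gamma_{\mathrm q}\times\Gamma_{\mathrm r}$, and put $\Gamma=\Gamma_{\mathrm{wr}}\cup\Gamma_{\mathrm{q}}\cup\Gamma_{\mathrm{r}}$. A *protocol* is a word $u_1q_1r_1\cdots u_nq_nr_n$ ($n\ge 0$) with $u_i\in\Gamma_{\mathrm{wr}}^*$ and $(q_i,r_i)\in\mathrm{valid}$. A language $\mathrm{PROT}\subseteq\Gamma^*$ is a *language of correct protocols* if: (i) $\varepsilon\in\mathrm{PROT}$; (ii) every word of $\mathrm{PROT}$ is a protocol; (iii) if $p_1p_2\in\mathrm{PROT}$ and $p_1$ is a protocol, then $p_1\in\mathrm{PROT}$; (iv) for all $p\in\mathrm{PROT}$, $u\in\Gamma_{\mathrm{wr}}^*$, $q\in\Gamma_{\mathrm q}$ there is $r\in\Gamma_{\mathrm r}$ with $puqr\in\mathrm{PROT}$; (v) if $puqr\in\mathrm{PROT}$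 and $puqr's\in\mathrm{PROT}$, then $r'=r$. (Here $u\in\Gamma_{\mathrm{wr}}^*$, $q\in\Gamma_{\mathrm q}$, $r,r'\in\Gamma_{\mathrm r}$.) A *one-way automaton with data structure $B_{\mathrm{PROT}}$* has a finite state set $S=S_{\mathrm{wr}}\sqcup S_{\mathrm q}$, a finite input alphabet $\Sigma$, an initial state $s_0$, a set of final states $F\subseteq S\setminus\{s_0\}$, and a finite set $\delta$ of write transitions $(s,a,x,s')\in S_{\mathrm{wr}}\times(\Sigma\cup\{\vdash,\dashv,\varepsilon\})\times\Gamma_{\mathrm{wr}}^*\times S$ and query transitions $(s,q,r,s')\in S_{\mathrm q}\times\Gamma_{\mathrm q}\times\Gamma_{\mathrm r}\times S_{\mathrm{wr}}$. A configuration is $(s,v,u,p)$ with $s\in S$, $v$ a suffix of some $\vdash\! w\!\dashv$ with $w\in\Sigma^*$ (the unread input), $u\in\Gamma_{\mathrm{wr}}^*$ (the query tape) and $p\in(\Gamma_{\mathrm{wr}}^*\Gamma_{\mathrm q}\Gamma_{\mathrm r})^*$ (the protocol so far). The moves are $(s,av,u,p)\to(s',v,ux,p)$ for each write transition $(s,a,x,s')$,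 and $(s,v,u,p)\to(s',v,\varepsilon,puqr)$ for each query transition $(s,q,r,s')$ with $puqr\in\mathrm{PROT}$. A word $w$ is accepted, $w\in L(M)$, if some $(s_f,\varepsilon,\varepsilon,p)$ with $s_f\in F$, $p\in\mathrm{PROT}$ is reachable from $(s_0,\vdash\! w\!\dashv,\varepsilon,\varepsilon)$. The automaton is *deterministic* if every configuration has at most one successor. Let $\langle\cdot\rangle$ denote a standard explicit description of an object by a word over a finite alphabet (states and input letters numbered from $0$ and written in unary, sets listed in any order). For a fixed $\mathrm{PROT}$ let $$\mathrm{MP}=\{\langle M,w\rangle : M \text{ is a deterministic one-way automaton with data structure } B_{\mathrm{PROT}},\ w\in L(M)\},$$ $$\mathrm{RR}(\mathrm{PROT})=\{\langle\mathcal A\rangle : \mathcal A\text{ is a DFA over }\Gamma,\ L(\mathcal A)\cap\mathrm{PROT}\neq\varnothing\}.$$ **Theorem.** For every language of correct protocols $\mathrm{PROT}$ there is a deterministic log-space many-one reduction of $\mathrm{MP}$ to $\mathrm{RR}(\mathrm{PROT})$: a function $f$ on words, computable by a deterministic Turing transducer with a read-only input tape, a write-only output tape and finitely many work tapes of which it visits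 $O(\log|x|)$ cells on inputs $x$ (at least one cell being always allowed), such that $x\in\mathrm{MP}\iff f(x)\in\mathrm{RR}(\mathrm{PROT})$ for all words $x$. -/

import Mathlib

/-! ## Protocol languages -/

/-- The disjoint union of the write alphabet `W`, the query alphabet `Q` and the
response alphabet `R`. -/
inductive PLetter (W Q R : Type*) where
  | wr (a : W)
  | query (q : Q)
  | resp (r : R)

/-- The query block `u q r`. -/
def queryBlock {W Q R : Type*} (u : List W) (q : Q) (r : R) : List (PLetter W Q R) :=
  u.map PLetter.wr ++ [PLetter.query q, PLetter.resp r]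

/-- A protocol: a concatenation of finitely many query blocks `u q r` with `(q, r)` valid. -/
def IsProtocol {W Q R : Type*} (valid : Set (Q × R)) (p : List (PLetter W Q R)) : Prop :=
  ∃ bs : List (List W × Q × R), (∀ b ∈ bs, b.2 ∈ valid) ∧
    p = bs.flatMap fun b => queryBlock b.1 b.2.1 b.2.2

/-- `P` is a language of correct protocols with respect to the relation `valid`. -/
structure IsCorrectProtocolLanguage {W Q R : Type*} (valid : Set (Q × R))
    (P : Language (PLetter W Q R)) : Prop where
  nil_mem : [] ∈ P
  isProtocol : ∀ p ∈ P, IsProtocol valid p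
  prefix_mem : ∀ p₁ p₂, p₁ ++ p₂ ∈ P → IsProtocol valid p₁ → p₁ ∈ P
  exists_resp : ∀ p ∈ P, ∀ (u : List W) (q : Q), ∃ r : R, p ++ queryBlock u q r ∈ P
  resp_unique : ∀ (p : List (PLetter W Q R)) (u : List W) (q : Q) (r r' : R)
    (s : List (PLetter W Q R)),
    p ++ queryBlock u q r ∈ P → p ++ queryBlock u q r' ++ s ∈ P → r' = r

/-! ## One-way automata with an auxiliary data structure -/

/-- Letters together with a left and a right endmarker. -/
inductive Endmarked (A : Type*) where
  | left
  | right
  | letter (a : A)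

/-- The word `w` between the two endmarkers. -/
def endmark {A : Type*} (w : List A) : List (Endmarked A) :=
  Endmarked.left :: w.map Endmarked.letter ++ [Endmarked.right]

/-- A write transition `(src, read, word, tgt)`; `read = none` is an `ε`-move. -/
structure WriteRule (W S A : Type*) where
  src : S
  read : Option (Endmarked A)
  word : List W
  tgt : S

/-- A query transition `(src, q, r, tgt)`. -/
structure QueryRule (Q R S : Type*) where
  src : S
  q : Q
  r : R
  tgt : S

/-- A one-way automaton with state set `S`, input alphabet `A`, write alphabet `W`, queries `Q`
and responses `R`. The states outside `queryStates` are the write states. -/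
structure ADSAutomaton (W Q R S A : Type*) where
  queryStates : Set S
  start : S
  final : Set S
  start_notMem_final : start ∉ final
  writeRules : Set (WriteRule W S A)
  queryRules : Set (QueryRule Q R S)
  writeRules_finite : writeRules.Finite
  src_of_writeRule : ∀ t ∈ writeRules, t.src ∉ queryStates
  src_of_queryRule : ∀ t ∈ queryRules, t.src ∈ queryStates
  tgt_of_queryRule : ∀ t ∈ queryRules, t.tgt ∉ queryStates

/-- Configurations: state, unread input, content of the query tape, protocol so far. -/
structure ADSConfig (W Q R S A : Type*) where
  state : S
  rest : List (Endmarked A)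
  tape : List W
  prot : List (PLetter W Q R)

/-- The unread input is a suffix of an endmarked word, and the protocol part is a sequence of
query blocks. -/
def ADSConfig.IsWellFormed {W Q R S A : Type*} (c : ADSConfig W Q R S A) : Prop :=
  (∃ w : List A, c.rest <:+ endmark w) ∧ IsProtocol Set.univ c.prot

namespace ADSAutomaton

variable {W Q R S A : Type*}

/-- The moves of the automaton, for the data structure given by `P`. -/
inductive Step (M : ADSAutomaton W Q R S A) (P : Language (PLetter W Q R)) :
    ADSConfig W Q R S A → ADSConfig W Q R S A → Prop where
  | write (t : WriteRule W S A) (ht : t ∈ M.writeRules) (v : List (Endmarked A)) (u : List W)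
      (p : List (PLetter W Q R)) :
      Step M P ⟨t.src, t.read.toList ++ v, u, p⟩ ⟨t.tgt, v, u ++ t.word, p⟩
  | query (t : QueryRule Q R S) (ht : t ∈ M.queryRules) (v : List (Endmarked A)) (u : List W)
      (p : List (PLetter W Q R)) (hp : p ++ queryBlock u t.q t.r ∈ P) :
      Step M P ⟨t.src, v, u, p⟩ ⟨t.tgt, v, [], p ++ queryBlock u t.q t.r⟩

/-- Each configuration has at most one successor. -/
def IsDeterministic (M : ADSAutomaton W Q R S A) (P : Language (PLetter W Q R)) : Prop :=
  ∀ c c₁ c₂ : ADSConfig W Q R S A, c.IsWellFormed → M.Step P c c₁ → M.Step P c c₂ → c₁ = c₂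

/-- The language of the automaton `M` with the data structure given by `P`. -/
def language (M : ADSAutomaton W Q R S A) (P : Language (PLetter W Q R)) : Language A :=
  {w | ∃ s ∈ M.final, ∃ p ∈ P,
    Relation.ReflTransGen (M.Step P) ⟨M.start, endmark w, [], []⟩ ⟨s, [], [], p⟩}

end ADSAutomaton

/-! ## Descriptions of instances as words over a finite alphabet -/

/-- The alphabet of descriptions: a unary digit, two separators, three symbols for the endmarkers
and the empty word, and the letters of the protocol alphabet `Γ`. -/
inductive DSym (Γ : Type*) where
  | tick
  | comma
  | semicolon
  | left
  | right
  | eps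
  | letter (a : Γ)

/-- A number in unary, followed by a comma. -/
def encNum {Γ : Type*} (m : ℕ) : List (DSym Γ) :=
  List.replicate m DSym.tick ++ [DSym.comma]

/-- The codes of the elements of a list, followed by a semicolon. -/
def encList {Γ τ : Type*} (enc : τ → List (DSym Γ)) (l : List τ) : List (DSym Γ) :=
  l.flatMap enc ++ [DSym.semicolon]

/-- The code of an input letter, an endmarker or the empty word. -/
def encRead {Γ : Type*} {k : ℕ} : Option (Endmarked (Fin k)) → List (DSym Γ)
  | none => [DSym.eps]
  | some Endmarked.left => [DSym.left]
  | some Endmarked.right => [DSym.right]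
  | some (Endmarked.letter a) => encNum a

def encWriteRule {W Q R : Type*} {n k : ℕ} (t : WriteRule W (Fin n) (Fin k)) :
    List (DSym (PLetter W Q R)) :=
  encNum t.src ++ encRead t.read ++ encList (fun a => [DSym.letter (PLetter.wr a)]) t.word
    ++ encNum t.tgt

def encQueryRule {W Q R : Type*} {n : ℕ} (t : QueryRule Q R (Fin n)) :
    List (DSym (PLetter W Q R)) :=
  encNum t.src ++ [DSym.letter (PLetter.query t.q), DSym.letter (PLetter.resp t.r)]
    ++ encNum t.tgt

/-- `x` is a description `⟨M, w⟩` of the automaton `M` and the word `w`: the numbers of states and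
of input letters, the initial state, listings (in any order) of the query states, the final states,
the write transitions and the query transitions, and the word `w`. -/
def ADSAutomaton.IsDescription {W Q R : Type*} {n k : ℕ}
    (M : ADSAutomaton W Q R (Fin n) (Fin k)) (w : List (Fin k))
    (x : List (DSym (PLetter W Q R))) : Prop :=
  ∃ (lq lf : List (Fin n)) (lw : List (WriteRule W (Fin n) (Fin k)))
    (lr : List (QueryRule Q R (Fin n))),
    (∀ s, s ∈ lq ↔ s ∈ M.queryStates) ∧ (∀ s, s ∈ lf ↔ s ∈ M.final) ∧
    (∀ t, t ∈ lw ↔ t ∈ M.writeRules) ∧ (∀ t, t ∈ lr ↔ t ∈ M.queryRules) ∧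
    x = encNum n ++ encNum k ++ encNum M.start
      ++ encList (fun s : Fin n => encNum s) lq ++ encList (fun s : Fin n => encNum s) lf
      ++ encList encWriteRule lw ++ encList encQueryRule lr
      ++ encList (fun a : Fin k => encNum a) w

/-- The membership problem for one-way deterministic automata with the data structure given by
`P`. -/
def membershipProblem1D {W Q R : Type*} (P : Language (PLetter W Q R)) :
    Language (DSym (PLetter W Q R)) :=
  {x | ∃ (n k : ℕ) (M : ADSAutomaton W Q R (Fin n) (Fin k)) (w : List (Fin k)),
    M.IsDescription w x ∧ M.IsDeterministic P ∧ w ∈ M.language P}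

/-- `x` is a description of the DFA `B`: the number of states, the initial state, and listings
(in any order) of the accepting states and of the transitions. -/
def DFA.IsDescription {Γ : Type*} {n : ℕ} (B : DFA Γ (Fin n)) (x : List (DSym Γ)) : Prop :=
  ∃ (lf : List (Fin n)) (lt : List (Fin n × Γ × Fin n)),
    (∀ s, s ∈ lf ↔ s ∈ B.accept) ∧ (∀ s a s', (s, a, s') ∈ lt ↔ B.step s a = s') ∧
    x = encNum n ++ encNum B.start ++ encList (fun s : Fin n => encNum s) lf
      ++ encList (fun t : Fin n × Γ × Fin n =>
          encNum t.1 ++ [DSym.letter t.2.1] ++ encNum t.2.2) lt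

/-- The regular realizability problem for DFAs with the filter `F`. -/
def regularRealizability {Γ : Type*} (F : Language Γ) : Language (DSym Γ) :=
  {x | ∃ (n : ℕ) (B : DFA Γ (Fin n)), B.IsDescription x ∧ ∃ p ∈ B.accepts, p ∈ F}

/-! ## Log-space reductions -/

/-- Head movements. -/
inductive HeadMove where
  | left
  | stay
  | right

/-- The new position of a head on a one-way infinite tape: a left move at the left end stays. -/
def HeadMove.apply : HeadMove → ℕ → ℕ
  | HeadMove.left, i => i - 1
  | HeadMove.stay, i => i
  | HeadMove.right, i => i + 1

/-- What a transducer does in one step: new state, move of the input head, symbols written on the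
work tapes, moves of the work heads, and possibly a symbol appended to the output. -/
structure TransducerAction (β St Sy : Type*) (k : ℕ) where
  state : St
  inMove : HeadMove
  write : Fin k → Sy
  move : Fin k → HeadMove
  emit : Option β

/-- A deterministic Turing transducer with a read-only two-way input tape, `k` read-write work
tapes and a write-only output tape. It halts when `δ` is undefined. -/
structure Transducer (α β St Sy : Type*) (k : ℕ) where
  start : St
  blank : Sy
  δ : St → Endmarked α → (Fin k → Sy) → Option (TransducerAction β St Sy k)

structure TransducerConfig (β St Sy : Type*) (k : ℕ) where
  state : St
  inPos : ℕ
  work : Fin k → ℕ → Sy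
  workPos : Fin k → ℕ
  out : List β

namespace Transducer

variable {α β St Sy : Type*} {k : ℕ}

/-- The symbol in cell `i` of the input tape: cell `0` holds the left endmarker, the cells
`1, …, |x|` hold `x`, and the next one holds the right endmarker. -/
def inputSymbol (x : List α) (i : ℕ) : Endmarked α :=
  (endmark x).getD i Endmarked.right

def init (T : Transducer α β St Sy k) : TransducerConfig β St Sy k where
  state := T.start
  inPos := 0
  work := fun _ _ => T.blank
  workPos := fun _ => 0
  out := []

/-- One step on the input `x`; `none` if the transducer halts. The input head cannot leave the
part of the input tape between the endmarkers. -/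
def next (T : Transducer α β St Sy k) (x : List α) (c : TransducerConfig β St Sy k) :
    Option (TransducerConfig β St Sy k) :=
  (T.δ c.state (inputSymbol x c.inPos) fun i => c.work i (c.workPos i)).map fun a =>
    { state := a.state
      inPos := min (a.inMove.apply c.inPos) (x.length + 1)
      work := fun i => Function.update (c.work i) (c.workPos i) (a.write i)
      workPos := fun i => (a.move i).apply (c.workPos i)
      out := c.out ++ a.emit.toList }

/-- `T` halts on every input `x` with output `f x`, and visits `O(log |x|)` cells of its work
tapes. -/
def ComputesInLogSpace (T : Transducer α β St Sy k) (f : List α → List β) : Prop :=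
  (∀ x, ∃ c, StateTransition.Reaches (T.next x) T.init c ∧ T.next x c = none ∧ c.out = f x) ∧
  ∃ C : ℕ, ∀ x c, StateTransition.Reaches (T.next x) T.init c →
    ∀ i, c.workPos i < C * (Nat.log 2 x.length + 1)

end Transducer

/-- Functions on words that are computable by a log-space transducer. -/
def LogSpaceComputable {α β : Type*} (f : List α → List β) : Prop :=
  ∃ (St Sy : Type) (k : ℕ) (_ : Finite St) (_ : Finite Sy) (T : Transducer α β St Sy k),
    T.ComputesInLogSpace f

/-- Deterministic log-space many-one reducibility. -/
def LogSpaceReducible {α β : Type*} (L₁ : Language α) (L₂ : Language β) : Prop :=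
  ∃ f : List α → List β, LogSpaceComputable f ∧ ∀ x, x ∈ L₁ ↔ f x ∈ L₂

/-! ## Transducers with a finite set of relevant states -/

/-! Why the theorem holds. Split every move of a deterministic automaton into moves carrying at most
one letter of the protocol alphabet. A write transition becomes an unlabelled reading move followed
by one labelled move per letter of its word; a query transition becomes a move labelled with the
query followed by one labelled with the response. The labels along a run spell the protocol followed
by the query tape. The resulting transition system no longer checks responses against `PROT`.
However, if the label word `z` of a path lies in `PROT`, then every prefix of `z` ending with a
response lies in `PROT` as well, so every query move on the path is legal. Hence the input is
accepted iff some `z ∈ PROT` labels a path from the initial state to a final state with exhausted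
input (`Listing.mem_language_iff`).

Determinism of the automaton makes this system deterministic (`Listing.isDeterministicLTS_micro`),
so contracting the unlabelled moves gives a DFA. Its states are pairs of positions in the instance
`x`: the first points at the code of a state, into the word of a write rule, or at a query; the
second points into the input word. Several positions may represent the same state, so the
lexicographically first target is chosen; a missing target is replaced by the sink `(|x|, |x|)`. The
correctness of this `positionDFA` is `Listing.mem_language_iff_accepts`.

The reduction must also recognise whether `x` describes a deterministic automaton, since other words
have to be sent outside the target language. `PROT` may be undecidable, but determinism depends on
it only through `Compatible`, a relation on the finite set of query-response pairs, and this finite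
table is built into the program.

For the space bound, call a relation on positions definable (`CounterProg.Def`) if a program with
finitely many counters, bounded by about `|x|`, decides it. Letter tests and addition are definable,
and definable relations are closed under Boolean operations, quantification over positions, and
reachability along a functional relation on pairs (`Def.reach_last`). The last one follows the orbit
for `(|x| + 1)²` steps, counted by two nested loops. All components of a description are prefix
codes, so parsing, determinism and the DFA are expressible in this way; nested loops then print the
DFA (`CounterProg.Out`).

Counter programs run in logarithmic space: the counters are kept in binary as tracks of a single
work tape, every operation is one sweep over the columns (`CounterOp.colVal_sweepCols`), and the
control stack of a structured program takes only finitely many values (`CounterProg.conts_finite`).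
-/

namespace Transducer

variable {α β St Sy : Type*} {k : ℕ}

/-- Replace the states of a transducer along `enc : St → St'` with (partial) inverse `dec`. -/
def mapStates {St' : Type*} (T : Transducer α β St Sy k) (enc : St → St') (dec : St' → St) :
    Transducer α β St' Sy k where
  start := enc T.start
  blank := T.blank
  δ s a w := (T.δ (dec s) a w).map fun act =>
    { state := enc act.state, inMove := act.inMove, write := act.write, move := act.move,
      emit := act.emit }

/-- Replace the state of a configuration. -/
def _root_.TransducerConfig.mapState {St' : Type*} (f : St' → St)
    (c : TransducerConfig β St' Sy k) : TransducerConfig β St Sy k where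
  state := f c.state
  inPos := c.inPos
  work := c.work
  workPos := c.workPos
  out := c.out

/-- On `S` the map `dec` inverts `enc`, and `S` is never left, so decoding commutes with one step.
-/
theorem next_mapStates {St' : Type*} (T : Transducer α β St Sy k) (enc : St → St')
    (dec : St' → St) (S : Set St) (hdec : ∀ s ∈ S, dec (enc s) = s)
    (hclosed : ∀ s ∈ S, ∀ a w act, T.δ s a w = some act → act.state ∈ S)
    (x : List α) (c : TransducerConfig β St' Sy k) (hc : dec c.state ∈ S) :
    T.next x (c.mapState dec) = ((T.mapStates enc dec).next x c).map (·.mapState dec) ∧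
      ∀ c', (T.mapStates enc dec).next x c = some c' → dec c'.state ∈ S := by
  have key := hclosed (dec c.state) hc (inputSymbol x c.inPos) (fun i => c.work i (c.workPos i))
  unfold next mapStates TransducerConfig.mapState
  rcases h : T.δ (dec c.state) (inputSymbol x c.inPos) (fun i => c.work i (c.workPos i)) with
    _ | act
  · simp [h]
  · have hact := hdec _ (key act h)
    constructor
    · simp [h, hact]
    · intro c' hc'
      simp only [h, Option.map_some, Option.some.injEq] at hc'
      subst hc'
      simpa [hact] using key act h

/-- A transducer with an infinite type of states, only finitely many of which are in use,
witnesses log-space computability. -/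
theorem ComputesInLogSpace.logSpaceComputable {Sy : Type} [Finite Sy]
    {T : Transducer α β St Sy k} {f : List α → List β} (hf : T.ComputesInLogSpace f)
    (S : Set St) (hS : S.Finite) (hstart : T.start ∈ S)
    (hclosed : ∀ s ∈ S, ∀ a w act, T.δ s a w = some act → act.state ∈ S) :
    LogSpaceComputable f := by
  classical
  have : Finite S := hS
  obtain ⟨n, ⟨e⟩⟩ := Finite.exists_equiv_fin S
  -- States outside `S` receive the code of the start state as a default; `hdec` asks nothing of
  -- them. Passing to `Fin n` also moves the states to `Type`, as `LogSpaceComputable` demands.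
  let enc : St → Fin n := fun s => if h : s ∈ S then e ⟨s, h⟩ else e ⟨T.start, hstart⟩
  let dec : Fin n → St := fun i => (e.symm i).1
  have hdecS : ∀ i, dec i ∈ S := fun i => (e.symm i).2
  have hdec : ∀ s ∈ S, dec (enc s) = s := by
    intro s hs
    simp [dec, enc, hs]
  refine ⟨Fin n, Sy, k, inferInstance, inferInstance, T.mapStates enc dec, ?_, ?_⟩
  · intro x
    obtain ⟨c, hc, hend, hout⟩ := hf.1 x
    have hinit : ((T.mapStates enc dec).init).mapState dec = T.init := by
      simp [init, mapStates, TransducerConfig.mapState, hdec _ hstart]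
    have lift : ∃ c', c'.mapState dec = c ∧
        StateTransition.Reaches ((T.mapStates enc dec).next x) (T.mapStates enc dec).init c' := by
      clear hend hout
      induction hc with
      | refl => exact ⟨_, hinit, .refl⟩
      | tail _ hstep ih =>
        obtain ⟨c', rfl, hc'⟩ := ih
        have := (T.next_mapStates enc dec S hdec hclosed x c' (hdecS _)).1
        rw [Option.mem_def, this, Option.map_eq_some_iff] at hstep
        obtain ⟨c'', h1, h2⟩ := hstep
        exact ⟨c'', h2, hc'.tail h1⟩
    obtain ⟨c', rfl, hc'⟩ := lift
    refine ⟨c', hc', ?_, hout⟩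
    have := (T.next_mapStates enc dec S hdec hclosed x c' (hdecS _)).1
    rw [hend] at this
    simpa using this.symm
  · obtain ⟨C, hC⟩ := hf.2
    refine ⟨C, fun x c hc => ?_⟩
    suffices h : StateTransition.Reaches (T.next x) T.init (c.mapState dec) from hC x _ h
    induction hc with
    | refl =>
      have hinit : ((T.mapStates enc dec).init).mapState dec = T.init := by
        simp [init, mapStates, TransducerConfig.mapState, hdec _ hstart]
      rw [hinit]
      exact .refl
    | @tail b c _ hstep ih =>
      refine ih.tail ?_
      have := (T.next_mapStates enc dec S hdec hclosed x b (hdecS _)).1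
      rw [Option.mem_def] at hstep
      rw [Option.mem_def, this, hstep]
      rfl

/-- A halting computation all of whose configurations satisfy `B` bounds every reachable
configuration. -/
theorem reachable_of_bounded_run {σ : Type*} {f : σ → Option σ} {B : σ → Prop} {a z : σ}
    (ha : B a) (h : Relation.ReflTransGen (fun b c => c ∈ f b ∧ B c) a z) (hz : f z = none) {c : σ}
    (hc : StateTransition.Reaches f a c) : B c := by
  induction h using Relation.ReflTransGen.head_induction_on with
  | refl =>
    rcases Relation.ReflTransGen.cases_head hc with rfl | ⟨d, hd, _⟩
    · exact ha
    · simp [hz] at hd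
  | head hab _ ih =>
    rcases Relation.ReflTransGen.cases_head hc with rfl | ⟨d, hd, hdc⟩
    · exact ha
    · obtain rfl := Option.mem_unique hab.1 hd
      exact ih hab.2 hdc

end Transducer

/-! ## Binary counters stored as tracks of columns -/

/-- Elementary operations on counters. The last two are tests. -/
inductive CounterOp where
  | zero (v : ℕ)
  | copy (v u : ℕ)
  | inc (v : ℕ)
  | eq (u v : ℕ)
  | add (u v w : ℕ)

namespace CounterOp

/-- The counters occurring in an operation are numbered below `K`. -/
def VarsLT (K : ℕ) : CounterOp → Prop
  | zero v => v < K
  | copy v u => v < K ∧ u < K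
  | inc v => v < K
  | eq u v => u < K ∧ v < K
  | add u v w => u < K ∧ v < K ∧ w < K

/-- The effect on the values of the counters. -/
def applyEnv (e : ℕ → ℕ) : CounterOp → ℕ → ℕ
  | zero v => Function.update e v 0
  | copy v u => Function.update e v (e u)
  | inc v => Function.update e v (e v + 1)
  | eq _ _ => e
  | add _ _ _ => e

/-- The effect on the test register. -/
def applyAcc (e : ℕ → ℕ) (acc : Bool) : CounterOp → Bool
  | eq u v => decide (e u = e v)
  | add u v w => decide (e u + e v = e w)
  | _ => acc

section Sweep

variable {K : ℕ}

/-- The bit of counter `v` in a column. -/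
def getBit (c : Fin K → Bool) (v : ℕ) : Bool := if h : v < K then c ⟨v, h⟩ else false

/-- Overwrite the bit of counter `v` in a column. -/
def setBit (c : Fin K → Bool) (v : ℕ) (b : Bool) : Fin K → Bool :=
  fun i => if (i : ℕ) = v then b else c i

theorem getBit_setBit {v : ℕ} (hv : v < K) (c : Fin K → Bool) (b : Bool) (w : ℕ) :
    getBit (setBit c v b) w = if w = v then b else getBit c w := by
  unfold getBit setBit
  split_ifs <;> simp_all

/-- The state in which a sweep over the columns starts: a carry bit and an agreement bit. -/
def sweepInit : CounterOp → Bool × Bool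
  | inc _ => (true, true)
  | _ => (false, true)

/-- The action of a sweep on one column. -/
def sweepStep (s : Bool × Bool) (c : Fin K → Bool) : CounterOp → (Bool × Bool) × (Fin K → Bool)
  | zero v => (s, setBit c v false)
  | copy v u => (s, setBit c v (getBit c u))
  | inc v => ((s.1 && getBit c v, s.2), setBit c v (s.1 ^^ getBit c v))
  | eq u v => ((s.1, s.2 && (getBit c u == getBit c v)), c)
  | add u v w =>
      ((s.1 && getBit c u || s.1 && getBit c v || getBit c u && getBit c v,
        s.2 && (getBit c w == (s.1 ^^ (getBit c u ^^ getBit c v)))), c)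

/-- The column that a sweep appends at the end. -/
def sweepFlush (K : ℕ) (s : Bool × Bool) : CounterOp → Option (Fin K → Bool)
  | inc v => if s.1 then some (setBit (fun _ => false) v true) else none
  | _ => none

/-- The content of the test register after a sweep. -/
def sweepResult (s : Bool × Bool) (acc : Bool) : CounterOp → Bool
  | eq _ _ => !s.1 && s.2
  | add _ _ _ => !s.1 && s.2
  | _ => acc

/-- The columns after a sweep. -/
def sweepCols (o : CounterOp) : Bool × Bool → List (Fin K → Bool) → List (Fin K → Bool)
  | s, [] => (o.sweepFlush K s).toList
  | s, c :: l => (o.sweepStep s c).2 :: sweepCols o (o.sweepStep s c).1 l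

/-- The state after a sweep. -/
def sweepState (o : CounterOp) : Bool × Bool → List (Fin K → Bool) → Bool × Bool
  | s, [] => s
  | s, c :: l => sweepState o (o.sweepStep s c).1 l

/-- The value of counter `v`, least significant bit first. -/
def colVal (v : ℕ) : List (Fin K → Bool) → ℕ
  | [] => 0
  | c :: l => (getBit c v).toNat + 2 * colVal v l

theorem colVal_lt (v : ℕ) (l : List (Fin K → Bool)) : colVal v l < 2 ^ l.length := by
  induction l with
  | nil => simp [colVal]
  | cons c l ih =>
    have := Bool.toNat_lt (getBit c v)
    simp only [colVal, List.length_cons, pow_succ]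
    omega

theorem colVal_sweepCols_zero {v : ℕ} (hv : v < K) (s : Bool × Bool) (l : List (Fin K → Bool))
    (w : ℕ) : colVal w (sweepCols (zero v) s l) = if w = v then 0 else colVal w l := by
  induction l generalizing s with
  | nil => simp [sweepCols, sweepFlush, colVal]
  | cons c l ih =>
    simp only [sweepCols, sweepStep, colVal, getBit_setBit hv, ih]
    split_ifs <;> simp

theorem colVal_sweepCols_copy {v : ℕ} (hv : v < K) (u : ℕ) (s : Bool × Bool)
    (l : List (Fin K → Bool)) (w : ℕ) :
    colVal w (sweepCols (copy v u) s l) = if w = v then colVal u l else colVal w l := by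
  induction l generalizing s with
  | nil => simp [sweepCols, sweepFlush, colVal]
  | cons c l ih =>
    simp only [sweepCols, sweepStep, colVal, getBit_setBit hv, ih]
    split_ifs <;> simp

theorem getBit_false (w : ℕ) : getBit (fun _ : Fin K => false) w = false := by
  simp [getBit]

/-- Ripple carry: `s.1` is the amount still to be added to the remaining columns. A carry left at
the end becomes a new column, so no overflow is lost. -/
theorem colVal_sweepCols_inc {v : ℕ} (hv : v < K) (s : Bool × Bool) (l : List (Fin K → Bool))
    (w : ℕ) : colVal w (sweepCols (inc v) s l) =
      if w = v then colVal w l + s.1.toNat else colVal w l := by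
  induction l generalizing s with
  | nil =>
    rcases s with ⟨_ | _, b⟩
    · simp [sweepCols, sweepFlush, colVal]
    · simp [sweepCols, sweepFlush, colVal, getBit_setBit hv, getBit_false]
      split_ifs <;> simp_all
  | cons c l ih =>
    simp only [sweepCols, sweepStep, colVal, getBit_setBit hv, ih]
    split_ifs with h
    · subst h
      cases s.1 <;> cases getBit c w <;> simp <;> omega
    · rfl

theorem colVal_cons_eq_iff (u v : ℕ) (c : Fin K → Bool) (l : List (Fin K → Bool)) :
    colVal u (c :: l) = colVal v (c :: l) ↔
      getBit c u = getBit c v ∧ colVal u l = colVal v l := by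
  simp only [colVal]
  cases getBit c u <;> cases getBit c v <;> simp <;> omega

/-- One stage of a full adder: the parity of the carry and the two bits has to be the bit of `w`,
and their majority is the next carry. -/
theorem colVal_cons_add_iff (u v w : ℕ) (b : Bool) (c : Fin K → Bool) (l : List (Fin K → Bool)) :
    colVal u (c :: l) + colVal v (c :: l) + b.toNat = colVal w (c :: l) ↔
      getBit c w = (b ^^ (getBit c u ^^ getBit c v)) ∧
        colVal u l + colVal v l +
          (b && getBit c u || b && getBit c v || getBit c u && getBit c v).toNat =
            colVal w l := by
  simp only [colVal]
  cases b <;> cases getBit c u <;> cases getBit c v <;> cases getBit c w <;> simp <;> omega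

theorem sweepState_eq (u v : ℕ) (s : Bool × Bool) (l : List (Fin K → Bool)) :
    sweepState (eq u v) s l = (s.1, s.2 && decide (colVal u l = colVal v l)) := by
  induction l generalizing s with
  | nil => simp [sweepState, colVal]
  | cons c l ih =>
    simp only [sweepState, sweepStep, ih, Prod.mk.injEq, true_and, colVal_cons_eq_iff,
      Bool.decide_and, Bool.and_assoc]
    rfl

/-- The sum is only checked, never stored. A carry outstanding at the end would be a bit beyond the
last column, where `w` has none; hence the test requires it to be `false`. -/
theorem sweepState_add (u v w : ℕ) (s : Bool × Bool) (l : List (Fin K → Bool)) :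
    (!(sweepState (add u v w) s l).1 && (sweepState (add u v w) s l).2) =
      (s.2 && decide (colVal u l + colVal v l + s.1.toNat = colVal w l)) := by
  induction l generalizing s with
  | nil => cases h : s.1 <;> simp [sweepState, colVal, h]
  | cons c l ih =>
    simp only [sweepState, sweepStep, ih, colVal_cons_add_iff, Bool.decide_and, Bool.and_assoc]
    rfl

theorem sweepCols_eq (u v : ℕ) (s : Bool × Bool) (l : List (Fin K → Bool)) :
    sweepCols (eq u v) s l = l := by
  induction l generalizing s with
  | nil => rfl
  | cons c l ih => simp [sweepCols, sweepStep, ih]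

theorem sweepCols_add (u v w : ℕ) (s : Bool × Bool) (l : List (Fin K → Bool)) :
    sweepCols (add u v w) s l = l := by
  induction l generalizing s with
  | nil => rfl
  | cons c l ih => simp [sweepCols, sweepStep, ih]

theorem colVal_sweepCols (o : CounterOp) (ho : o.VarsLT K) (l : List (Fin K → Bool))
    (e : ℕ → ℕ) (he : ∀ v < K, colVal v l = e v) (w : ℕ) (hw : w < K) :
    colVal w (sweepCols o o.sweepInit l) = o.applyEnv e w := by
  cases o with
  | zero v => simp [colVal_sweepCols_zero ho, applyEnv, Function.update_apply, he w hw]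
  | copy v u =>
    simp [colVal_sweepCols_copy ho.1, applyEnv, Function.update_apply, he w hw, he u ho.2]
  | inc v =>
    simp only [colVal_sweepCols_inc ho, applyEnv, Function.update_apply, he w hw, sweepInit,
      Bool.toNat_true]
    split_ifs with h
    · rw [h]
    · rfl
  | eq u v => simp [sweepCols_eq, applyEnv, he w hw]
  | add u v w' => simp [sweepCols_add, applyEnv, he w hw]

theorem sweepResult_eq_applyAcc (o : CounterOp) (ho : o.VarsLT K) (l : List (Fin K → Bool))
    (e : ℕ → ℕ) (he : ∀ v < K, colVal v l = e v) (acc : Bool) :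
    o.sweepResult (sweepState o o.sweepInit l) acc = o.applyAcc e acc := by
  cases o with
  | eq u v => simp [sweepResult, sweepState_eq, applyAcc, sweepInit, he u ho.1, he v ho.2]
  | add u v w =>
    simp only [sweepResult, sweepState_add, applyAcc, sweepInit, he u ho.1, he v ho.2.1,
      he w ho.2.2]
    simp
  | _ => rfl

/-- Only an increment lengthens the tape, and only if its carry runs off the end, that is, if the
new value no longer fits into `l.length` bits. -/
theorem length_sweepCols_le (o : CounterOp) (s : Bool × Bool) (l : List (Fin K → Bool)) :
    (sweepCols o s l).length = l.length ∨
      ∃ v, o = inc v ∧ (sweepCols o s l).length = l.length + 1 ∧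
        (v < K → 2 ^ l.length ≤ colVal v l + s.1.toNat) := by
  induction l generalizing s with
  | nil =>
    cases o with
    | inc v =>
      cases h : s.1
      · left; simp [sweepCols, sweepFlush, h]
      · right; refine ⟨v, rfl, ?_⟩; simp [sweepCols, sweepFlush, h]
    | _ => left; simp [sweepCols, sweepFlush]
  | cons c l ih =>
    rcases ih (o.sweepStep s c).1 with h | ⟨v, rfl, h1, h2⟩
    · left; simp [sweepCols, h]
    · right
      refine ⟨v, rfl, by simp [sweepCols, h1], fun hv => ?_⟩
      have := h2 hv
      have h3 := colVal_lt v l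
      simp only [sweepStep] at this
      simp only [List.length_cons, colVal, pow_succ]
      revert this
      cases s.1 <;> cases getBit c v <;> simp <;> omega

/-- A new column appears only if `2 ^ l.length` is at most the old value plus one, hence at most
`N`. The factor `2` in the invariant pays for that column. -/
theorem length_sweepCols (o : CounterOp) (ho : o.VarsLT K) (l : List (Fin K → Bool)) (N : ℕ)
    (hl : 2 ^ l.length ≤ 2 * N) (hN : ∀ v, o = inc v → colVal v l < N) :
    2 ^ (sweepCols o o.sweepInit l).length ≤ 2 * N := by
  rcases length_sweepCols_le o o.sweepInit l with h | ⟨v, rfl, h1, h2⟩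
  · rwa [h]
  · have := h2 ho
    have h3 := hN v rfl
    simp only [sweepInit, Bool.toNat_true] at this
    rw [h1, pow_succ]
    omega

end Sweep

end CounterOp

/-! ## Counter programs and their execution by transducers -/

/-- Structured programs over counters, a test register, a two-way input head and an output tape.
`loop p` repeats `p` until the test register holds `true`. -/
inductive CounterProg (α β : Type*) where
  | pure (f : Bool → Endmarked α → Bool × HeadMove × Option β)
  | op (o : CounterOp)
  | seq (p q : CounterProg α β)
  | ite (p q : CounterProg α β)
  | loop (p : CounterProg α β)

/-- The state of a counter program. -/
structure CounterStore (β : Type*) where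
  acc : Bool
  pos : ℕ
  env : ℕ → ℕ
  out : List β

namespace CounterProg

variable {α β : Type*}

/-- The program that does nothing. -/
def skip : CounterProg α β := pure fun acc _ => (acc, HeadMove.stay, none)

/-- The counters occurring in a program are numbered below `K`. -/
def VarsLT (K : ℕ) : CounterProg α β → Prop
  | pure _ => True
  | op o => o.VarsLT K
  | seq p q => p.VarsLT K ∧ q.VarsLT K
  | ite p q => p.VarsLT K ∧ q.VarsLT K
  | loop p => p.VarsLT K

theorem _root_.CounterOp.VarsLT.mono {K L : ℕ} (h : K ≤ L) {o : CounterOp} (ho : o.VarsLT K) :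
    o.VarsLT L := by
  cases o <;> simp only [CounterOp.VarsLT] at ho ⊢ <;> omega

theorem VarsLT.mono {K L : ℕ} (h : K ≤ L) {p : CounterProg α β} (hp : p.VarsLT K) :
    p.VarsLT L := by
  induction p with
  | pure f => trivial
  | op o => exact CounterOp.VarsLT.mono h hp
  | seq p q ihp ihq => exact ⟨ihp hp.1, ihq hp.2⟩
  | ite p q ihp ihq => exact ⟨ihp hp.1, ihq hp.2⟩
  | loop p ih => exact ih hp

theorem exists_varsLT (p : CounterProg α β) : ∃ K, p.VarsLT K := by
  induction p with
  | pure f => exact ⟨0, trivial⟩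
  | op o =>
    cases o with
    | zero v => exact ⟨v + 1, by simp [VarsLT, CounterOp.VarsLT]⟩
    | copy v u => exact ⟨v + u + 1, by simp only [VarsLT, CounterOp.VarsLT]; omega⟩
    | inc v => exact ⟨v + 1, by simp [VarsLT, CounterOp.VarsLT]⟩
    | eq v u => exact ⟨v + u + 1, by simp only [VarsLT, CounterOp.VarsLT]; omega⟩
    | add u v w => exact ⟨u + v + w + 1, by simp only [VarsLT, CounterOp.VarsLT]; omega⟩
  | seq p q ihp ihq =>
    obtain ⟨K, hK⟩ := ihp
    obtain ⟨L, hL⟩ := ihq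
    exact ⟨max K L, hK.mono (le_max_left _ _), hL.mono (le_max_right _ _)⟩
  | ite p q ihp ihq =>
    obtain ⟨K, hK⟩ := ihp
    obtain ⟨L, hL⟩ := ihq
    exact ⟨max K L, hK.mono (le_max_left _ _), hL.mono (le_max_right _ _)⟩
  | loop p ih => exact ih

/-- Terminating executions on the input `x`; counters may not be increased beyond `|x| + 1`. -/
inductive Exec (x : List α) : CounterProg α β → CounterStore β → CounterStore β → Prop where
  | pure (f) (s : CounterStore β) (b : Bool) (m : HeadMove) (e : Option β)
      (h : f s.acc (Transducer.inputSymbol x s.pos) = (b, m, e)) :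
      Exec x (pure f) s ⟨b, min (m.apply s.pos) (x.length + 1), s.env, s.out ++ e.toList⟩
  | op (o : CounterOp) (s : CounterStore β) (h : ∀ v, o = .inc v → s.env v ≤ x.length) :
      Exec x (op o) s ⟨o.applyAcc s.env s.acc, s.pos, o.applyEnv s.env, s.out⟩
  | seq {p q s₁ s₂ s₃} : Exec x p s₁ s₂ → Exec x q s₂ s₃ → Exec x (seq p q) s₁ s₃
  | ite_true {p q s s'} : s.acc = true → Exec x p s s' → Exec x (ite p q) s s'
  | ite_false {p q s s'} : s.acc = false → Exec x q s s' → Exec x (ite p q) s s'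
  | loop_done {p s s'} : Exec x p s s' → s'.acc = true → Exec x (loop p) s s'
  | loop_next {p s₁ s₂ s₃} : Exec x p s₁ s₂ → s₂.acc = false → Exec x (loop p) s₂ s₃ →
      Exec x (loop p) s₁ s₃

/-! ### The compiled transducer -/

/-- Control states of the compiled transducer. -/
inductive Control (α β : Type*) where
  | start
  | run (k : List (CounterProg α β)) (acc : Bool)
  | forth (o : CounterOp) (s : Bool × Bool) (k : List (CounterProg α β)) (acc : Bool)
  | back (k : List (CounterProg α β)) (acc : Bool)

/-- Work tape symbols: a blank, a mark for the leftmost cell, and columns of bits. -/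
abbrev TapeSym (K : ℕ) := Option (Option (Fin K → Bool))

/-- A step that only changes the control state and possibly uses the input head and the output. -/
def controlStep {K : ℕ} (c : Control α β) (w : Fin 1 → TapeSym K) (m : HeadMove)
    (e : Option β) : Option (TransducerAction β (Control α β) (TapeSym K) 1) :=
  some { state := c, inMove := m, write := w, move := fun _ => .stay, emit := e }

/-- A step that only changes the control state and uses the work tape. -/
def tapeStep {K : ℕ} (c : Control α β) (w : TapeSym K) (m : HeadMove) :
    Option (TransducerAction β (Control α β) (TapeSym K) 1) :=
  some { state := c, inMove := .stay, write := fun _ => w, move := fun _ => m, emit := none }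

/-- The transition function of the compiled transducer. -/
def delta (P : CounterProg α β) (K : ℕ) : Control α β → Endmarked α → (Fin 1 → TapeSym K) →
    Option (TransducerAction β (Control α β) (TapeSym K) 1)
  | .start, _, _ => tapeStep (.run [P] false) (some none) .stay
  | .run [] _, _, _ => none
  | .run (pure f :: k) acc, a, w =>
      controlStep (.run k (f acc a).1) w (f acc a).2.1 (f acc a).2.2
  | .run (op o :: k) acc, _, w => tapeStep (.forth o o.sweepInit k acc) (w 0) .right
  | .run (seq p q :: k) acc, _, w => controlStep (.run (p :: q :: k) acc) w .stay none
  | .run (ite p q :: k) acc, _, w =>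
      controlStep (.run ((if acc then p else q) :: k) acc) w .stay none
  | .run (loop p :: k) acc, _, w =>
      controlStep (.run (p :: ite skip (loop p) :: k) acc) w .stay none
  | .forth o s k acc, _, w =>
      match w 0 with
      | some (some c) =>
          tapeStep (.forth o (o.sweepStep s c).1 k acc) (some (some (o.sweepStep s c).2)) .right
      | _ => tapeStep (.back k (o.sweepResult s acc)) ((o.sweepFlush K s).map some) .left
  | .back k acc, _, w =>
      match w 0 with
      | some none => tapeStep (.run k acc) (some none) .stay
      | c => tapeStep (.back k acc) c .left

/-- The compiled transducer. -/
def toTransducer (P : CounterProg α β) (K : ℕ) :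
    Transducer α β (Control α β) (TapeSym K) 1 where
  start := .start
  blank := none
  δ := P.delta K

/-! ### Finitely many control states are in use -/

/-- The continuations occurring during the execution of a program with continuation `k`. -/
def conts : CounterProg α β → List (CounterProg α β) → Set (List (CounterProg α β))
  | pure f, k => {pure f :: k, k}
  | op o, k => {op o :: k, k}
  | seq p q, k => {seq p q :: k} ∪ (conts p (q :: k) ∪ conts q k)
  | ite p q, k => {ite p q :: k} ∪ (conts p k ∪ conts q k)
  | loop p, k => {loop p :: k, ite skip (loop p) :: k, skip :: k, k} ∪
      conts p (ite skip (loop p) :: k)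

theorem conts_finite (p : CounterProg α β) (k : List (CounterProg α β)) : (conts p k).Finite := by
  induction p generalizing k with
  | pure f => simp [conts]
  | op o => simp [conts]
  | seq p q ihp ihq => exact (Set.finite_singleton _).union ((ihp _).union (ihq _))
  | ite p q ihp ihq => exact (Set.finite_singleton _).union ((ihp _).union (ihq _))
  | loop p ih => exact Set.Finite.union (by simp) (ih _)

theorem cons_mem_conts (p : CounterProg α β) (k : List (CounterProg α β)) :
    p :: k ∈ conts p k := by
  cases p <;> simp [conts]

theorem self_mem_conts (p : CounterProg α β) (k : List (CounterProg α β)) : k ∈ conts p k := by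
  induction p generalizing k with
  | pure f => simp [conts]
  | op o => simp [conts]
  | seq p q ihp ihq => exact .inr (.inr (ihq _))
  | ite p q ihp ihq => exact .inr (.inr (ihq _))
  | loop p ih => simp [conts]

/-- One step of the control on continuations. -/
inductive ContStep : List (CounterProg α β) → List (CounterProg α β) → Prop where
  | pure (f k) : ContStep (pure f :: k) k
  | op (o k) : ContStep (op o :: k) k
  | seq (p q k) : ContStep (seq p q :: k) (p :: q :: k)
  | ite_true (p q k) : ContStep (ite p q :: k) (p :: k)
  | ite_false (p q k) : ContStep (ite p q :: k) (q :: k)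
  | loop (p k) : ContStep (loop p :: k) (p :: CounterProg.ite skip (loop p) :: k)

/-- The set records what may happen until `k` is exposed; a step taken by `k` itself may leave it,
hence `l ≠ k`. In a loop the body has the continuation `ite skip (loop p) :: k`, which leads back to
`loop p :: k`, so unrolling produces nothing new. -/
theorem conts_closed (p : CounterProg α β) {k l l' : List (CounterProg α β)} (hl : l ∈ conts p k)
    (hne : l ≠ k) (h : ContStep l l') : l' ∈ conts p k := by
  induction p generalizing k with
  | pure f =>
    rcases hl with rfl | rfl
    · cases h; exact self_mem_conts _ _
    · exact absurd rfl hne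
  | op o =>
    rcases hl with rfl | rfl
    · cases h; exact self_mem_conts _ _
    · exact absurd rfl hne
  | seq p q ihp ihq =>
    rcases hl with rfl | hl | hl
    · cases h; exact .inr (.inl (cons_mem_conts _ _))
    · by_cases hk : l = q :: k
      · subst hk
        exact .inr (.inr (ihq (cons_mem_conts _ _) hne))
      · exact .inr (.inl (ihp hl hk))
    · exact .inr (.inr (ihq hl hne))
  | ite p q ihp ihq =>
    rcases hl with rfl | hl | hl
    · cases h
      · exact .inr (.inl (cons_mem_conts _ _))
      · exact .inr (.inr (cons_mem_conts _ _))
    · exact .inr (.inl (ihp hl hne))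
    · exact .inr (.inr (ihq hl hne))
  | loop p ih =>
    have hite : ContStep (CounterProg.ite skip (loop p) :: k) l' → l' ∈ conts (loop p) k := by
      intro h
      cases h <;> simp [conts]
    rcases hl with (rfl | rfl | rfl | rfl) | hl
    · cases h; exact .inr (cons_mem_conts _ _)
    · exact hite h
    · cases h; simp [conts]
    · exact absurd rfl hne
    · by_cases hk : l = CounterProg.ite skip (loop p) :: k
      · subst hk; exact hite h
      · exact .inr (ih hl hk)

theorem conts_closed_nil (p : CounterProg α β) {l l' : List (CounterProg α β)}
    (hl : l ∈ conts p []) (h : ContStep l l') : l' ∈ conts p [] := by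
  refine conts_closed p hl ?_ h
  rintro rfl
  cases h

/-- The operations that a continuation may execute first. -/
def headOps : List (CounterProg α β) → Set CounterOp
  | op o :: _ => {o}
  | _ => ∅

theorem headOps_finite (k : List (CounterProg α β)) : (headOps k).Finite := by
  unfold headOps
  split <;> simp

/-- The control states in use when `P` is executed. -/
def usedControls (P : CounterProg α β) : Set (Control α β) :=
  {.start} ∪ ((fun q : _ × Bool => Control.run q.1 q.2) '' (conts P [] ×ˢ Set.univ) ∪
    ((fun q : _ × Bool => Control.back q.1 q.2) '' (conts P [] ×ˢ Set.univ) ∪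
      (fun q : CounterOp × (Bool × Bool) × _ × Bool => Control.forth q.1 q.2.1 q.2.2.1 q.2.2.2) ''
        ((⋃ k ∈ conts P [], headOps k) ×ˢ (Set.univ ×ˢ (conts P [] ×ˢ Set.univ)))))

theorem usedControls_finite (P : CounterProg α β) : P.usedControls.Finite := by
  have h := conts_finite P []
  refine (Set.finite_singleton _).union ((Set.Finite.image _ (h.prod Set.finite_univ)).union
    ((Set.Finite.image _ (h.prod Set.finite_univ)).union (Set.Finite.image _ (Set.Finite.prod
      (h.biUnion fun k _ => headOps_finite k)
      (Set.finite_univ.prod (h.prod Set.finite_univ))))))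

theorem start_mem_usedControls (P : CounterProg α β) : Control.start ∈ P.usedControls := .inl rfl

theorem run_mem_usedControls {P : CounterProg α β} {k : List (CounterProg α β)} {acc : Bool} :
    Control.run k acc ∈ P.usedControls ↔ k ∈ conts P [] := by
  cases acc <;> simp [usedControls]

theorem back_mem_usedControls {P : CounterProg α β} {k : List (CounterProg α β)} {acc : Bool} :
    Control.back k acc ∈ P.usedControls ↔ k ∈ conts P [] := by
  cases acc <;> simp [usedControls]

theorem forth_mem_usedControls {P : CounterProg α β} {o : CounterOp} {s : Bool × Bool}
    {k : List (CounterProg α β)} {acc : Bool} :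
    Control.forth o s k acc ∈ P.usedControls ↔
      (∃ l ∈ conts P [], o ∈ headOps l) ∧ k ∈ conts P [] := by
  obtain ⟨a, b⟩ := s
  simp only [usedControls, Set.singleton_union, Set.mem_insert_iff, reduceCtorEq, Set.mem_union,
    Set.mem_image, Set.mem_prod, Set.mem_univ, and_true, Prod.exists, and_false, exists_false,
    Set.mem_iUnion, exists_prop, true_and, false_or, Control.forth.injEq, Prod.mk.injEq]
  constructor
  · rintro ⟨o', a', b', k', acc', h, rfl, ⟨rfl, rfl⟩, rfl, rfl⟩
    exact h
  · intro h
    exact ⟨o, a, b, k, acc, h, rfl, ⟨rfl, rfl⟩, rfl, rfl⟩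

theorem usedControls_closed (P : CounterProg α β) (K : ℕ) (c : Control α β)
    (hc : c ∈ P.usedControls) (a : Endmarked α) (w : Fin 1 → TapeSym K)
    (act : TransducerAction β (Control α β) (TapeSym K) 1) (h : P.delta K c a w = some act) :
    act.state ∈ P.usedControls := by
  cases c with
  | start =>
    cases h
    exact run_mem_usedControls.2 (cons_mem_conts _ _)
  | run k acc =>
    rw [run_mem_usedControls] at hc
    rcases k with _ | ⟨p, k⟩
    · cases h
    · cases p with
      | pure f =>
        cases h
        exact run_mem_usedControls.2 (conts_closed_nil P hc (.pure _ _))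
      | op o =>
        cases h
        exact forth_mem_usedControls.2 ⟨⟨_, hc, rfl⟩, conts_closed_nil P hc (.op _ _)⟩
      | seq p q =>
        cases h
        exact run_mem_usedControls.2 (conts_closed_nil P hc (.seq _ _ _))
      | ite p q =>
        cases h
        cases acc
        · exact run_mem_usedControls.2 (conts_closed_nil P hc (.ite_false _ _ _))
        · exact run_mem_usedControls.2 (conts_closed_nil P hc (.ite_true _ _ _))
      | loop p =>
        cases h
        exact run_mem_usedControls.2 (conts_closed_nil P hc (.loop _ _))
  | forth o s k acc =>
    have hc' := forth_mem_usedControls.1 hc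
    simp only [delta] at h
    split at h <;> cases h
    · exact forth_mem_usedControls.2 hc'
    · exact back_mem_usedControls.2 hc'.2
  | back k acc =>
    rw [back_mem_usedControls] at hc
    simp only [delta] at h
    split at h <;> cases h
    · exact run_mem_usedControls.2 hc
    · exact back_mem_usedControls.2 hc

end CounterProg

/-! ### Simulation of counter programs by the compiled transducer -/

namespace CounterProg

variable {α β : Type*} {K : ℕ}

/-- The content of the work tape that stores a list of columns. -/
def tapeOf (l : List (Fin K → Bool)) : ℕ → TapeSym K
  | 0 => some none
  | i + 1 => (l[i]?).map some

/-- Column `i` lies in cell `i + 1`, because cell `0` carries the mark. -/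
theorem update_tapeOf (l₁ l₂ : List (Fin K → Bool)) (c c' : Fin K → Bool) :
    Function.update (tapeOf (l₁ ++ c :: l₂)) (l₁.length + 1) (some (some c')) =
      tapeOf (l₁ ++ c' :: l₂) := by
  funext i
  rcases i with _ | i
  · simp [tapeOf]
  · rw [Function.update_apply]
    split_ifs with h
    · obtain rfl : i = l₁.length := by omega
      simp [tapeOf]
    · have h : i ≠ l₁.length := by omega
      simp only [tapeOf]
      rcases lt_or_gt_of_ne h with h | h
      · simp [List.getElem?_append_left h]
      · obtain ⟨j, rfl⟩ : ∃ j, i = l₁.length + (j + 1) := ⟨i - l₁.length - 1, by omega⟩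
        simp [List.getElem?_append_right]

theorem update_tapeOf_end (l : List (Fin K → Bool)) (c : Option (Fin K → Bool)) :
    Function.update (tapeOf l) (l.length + 1) (c.map some) = tapeOf (l ++ c.toList) := by
  funext i
  rcases i with _ | i
  · simp [tapeOf]
  · rw [Function.update_apply]
    simp only [tapeOf]
    split_ifs with h
    · obtain rfl : i = l.length := by omega
      cases c <;> simp
    · have h : i ≠ l.length := by omega
      rcases lt_or_gt_of_ne h with h | h
      · simp [List.getElem?_append_left h]
      · rw [List.getElem?_eq_none (by omega), List.getElem?_eq_none]
        cases c <;> simp <;> omega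

/-- A configuration of the compiled transducer. -/
def config (c : Control α β) (pos : ℕ) (l : List (Fin K → Bool)) (wpos : ℕ) (out : List β) :
    TransducerConfig β (Control α β) (TapeSym K) 1 where
  state := c
  inPos := pos
  work _ := tapeOf l
  workPos _ := wpos
  out := out

/-- Computations of the compiled transducer that stay within the space bound. -/
def BoundedReach (P : CounterProg α β) (K : ℕ) (x : List α) :
    TransducerConfig β (Control α β) (TapeSym K) 1 →
      TransducerConfig β (Control α β) (TapeSym K) 1 → Prop :=
  Relation.ReflTransGen fun b c => c ∈ (P.toTransducer K).next x b ∧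
    ∀ i, c.workPos i < 4 * (Nat.log 2 x.length + 1)

theorem next_of_controlStep {P : CounterProg α β} {x : List α} {c c' : Control α β} {pos : ℕ}
    {l : List (Fin K → Bool)} {wpos : ℕ} {out : List β} {m : HeadMove} {e : Option β}
    (h : P.delta K c (Transducer.inputSymbol x pos) (fun _ => tapeOf l wpos) =
      controlStep c' (fun _ => tapeOf l wpos) m e) :
    (P.toTransducer K).next x (config c pos l wpos out) =
      some (config c' (min (m.apply pos) (x.length + 1)) l wpos (out ++ e.toList)) := by
  simp [Transducer.next, toTransducer, config, h, controlStep, HeadMove.apply]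

theorem next_of_tapeStep {P : CounterProg α β} {x : List α} {c c' : Control α β} {pos : ℕ}
    (hpos : pos ≤ x.length + 1) {l l' : List (Fin K → Bool)} {wpos : ℕ} {out : List β}
    {m : HeadMove} {w : TapeSym K}
    (h : P.delta K c (Transducer.inputSymbol x pos) (fun _ => tapeOf l wpos) = tapeStep c' w m)
    (hw : Function.update (tapeOf l) wpos w = tapeOf l') :
    (P.toTransducer K).next x (config c pos l wpos out) =
      some (config c' pos l' (m.apply wpos) out) := by
  simp [Transducer.next, toTransducer, config, h, tapeStep, hw, HeadMove.apply, hpos]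

/-- The mark tells the head where the left end is; on every other symbol, the blank included, it
keeps moving left. -/
theorem boundedReach_back (P : CounterProg α β) (x : List α) (pos : ℕ)
    (hpos : pos ≤ x.length + 1) (l : List (Fin K → Bool)) (k : List (CounterProg α β))
    (acc : Bool) (out : List β) (wpos : ℕ) (hw : wpos < 4 * (Nat.log 2 x.length + 1)) :
    BoundedReach P K x (config (.back k acc) pos l wpos out)
      (config (.run k acc) pos l 0 out) := by
  induction wpos with
  | zero =>
    refine .single ⟨next_of_tapeStep hpos (m := .stay) (w := some none) rfl ?_, fun _ => hw⟩
    exact Function.update_eq_self (0 : ℕ) (tapeOf l)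
  | succ n ih =>
    refine .head ⟨next_of_tapeStep hpos (m := .left) (w := tapeOf l (n + 1)) ?_
      (Function.update_eq_self _ _), fun _ => ?_⟩ (ih (by omega))
    · simp only [delta, tapeOf]
      cases l[n]? <;> rfl
    · simp only [config, HeadMove.apply]
      omega

/-- Here `l₁` are the columns already treated and the head stands on the first cell after them. At
the blank behind the last column the sweep appends its overflow column, if any, and turns round;
cell `l₁.length + l₂.length + 1` in `hw` is that blank. -/
theorem boundedReach_forth (P : CounterProg α β) (x : List α) (pos : ℕ)
    (hpos : pos ≤ x.length + 1) (o : CounterOp) (k : List (CounterProg α β))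
    (acc : Bool) (out : List β) (l₂ l₁ : List (Fin K → Bool)) (s : Bool × Bool)
    (hw : l₁.length + l₂.length + 1 < 4 * (Nat.log 2 x.length + 1)) :
    BoundedReach P K x (config (.forth o s k acc) pos (l₁ ++ l₂) (l₁.length + 1) out)
      (config (.back k (o.sweepResult (o.sweepState s l₂) acc)) pos (l₁ ++ o.sweepCols s l₂)
        (l₁.length + l₂.length) out) := by
  induction l₂ generalizing l₁ s with
  | nil =>
    refine .single ⟨next_of_tapeStep hpos (m := .left) (w := (o.sweepFlush K s).map some) ?_ ?_,
      fun _ => ?_⟩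
    · simp [delta, tapeOf, CounterOp.sweepState]
    · rw [List.append_nil]
      exact update_tapeOf_end l₁ (o.sweepFlush K s)
    · simp only [config]
      omega
  | cons c l ih =>
    have := ih (l₁ ++ [(o.sweepStep s c).2]) (o.sweepStep s c).1 (by simp at hw ⊢; omega)
    simp only [List.append_assoc, List.singleton_append, List.length_append, List.length_cons,
      List.length_nil] at this
    rw [List.length_cons, show l₁.length + (l.length + 1) = l₁.length + (0 + 1) + l.length by omega]
    refine .head ⟨next_of_tapeStep hpos (m := .right) (w := some (some (o.sweepStep s c).2)) ?_
      (update_tapeOf l₁ l c _), fun _ => ?_⟩ this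
    · simp [delta, tapeOf]
    · simp only [config, HeadMove.apply, List.length_cons] at hw ⊢
      omega

/-- The hypothesis gives `n ≤ log₂ N + 2`, and a sweep over `n` columns visits cell `n + 1`. The
constant `4` is what `log₂ N + 3 < 4 (log₂ N + 1)` needs when the logarithm is `0`. -/
theorem length_lt_of_pow_le {N n : ℕ} (h : 2 ^ n ≤ 2 * (N + 1)) :
    n + 1 < 4 * (Nat.log 2 N + 1) := by
  have h1 : N < 2 ^ (Nat.log 2 N + 1) := Nat.lt_pow_succ_log_self (by norm_num) N
  have h2 : 2 ^ n ≤ 2 ^ (Nat.log 2 N + 2) := by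
    rw [pow_succ]
    omega
  have := (Nat.pow_le_pow_iff_right (by norm_num)).1 h2
  omega

/-- Executions of programs are simulated by the compiled transducer. -/
theorem Exec.boundedReach {P p : CounterProg α β} {x : List α} {s s' : CounterStore β}
    (h : Exec x p s s') (hp : p.VarsLT K) (k : List (CounterProg α β)) (l : List (Fin K → Bool))
    (hl : ∀ v < K, CounterOp.colVal v l = s.env v) (hlen : 2 ^ l.length ≤ 2 * (x.length + 1))
    (hpos : s.pos ≤ x.length + 1) :
    s'.pos ≤ x.length + 1 ∧ ∃ l' : List (Fin K → Bool),
      (∀ v < K, CounterOp.colVal v l' = s'.env v) ∧ 2 ^ l'.length ≤ 2 * (x.length + 1) ∧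
        BoundedReach P K x (config (.run (p :: k) s.acc) s.pos l 0 s.out)
          (config (.run k s'.acc) s'.pos l' 0 s'.out) := by
  have hctl : ∀ (c c' : Control α β) (pos : ℕ) (hp : pos ≤ x.length + 1)
      (l : List (Fin K → Bool)) (out : List β),
      (P.delta K c (Transducer.inputSymbol x pos) (fun _ => tapeOf l 0) =
        controlStep c' (fun _ => tapeOf l 0) .stay none) →
      BoundedReach P K x (config c pos l 0 out) (config c' pos l 0 out) := by
    intro c c' pos hp l out h
    refine .single ⟨?_, fun _ => by simp [config]⟩
    have := next_of_controlStep (out := out) h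
    simpa [HeadMove.apply, hp] using this
  induction h generalizing k l with
  | pure f s b m e h =>
    refine ⟨min_le_right _ _, l, hl, hlen, .single ⟨?_, fun _ => by simp [config]⟩⟩
    refine next_of_controlStep ?_
    simp [delta, h]
  | op o s h =>
    refine ⟨hpos, o.sweepCols o.sweepInit l, CounterOp.colVal_sweepCols o hp l s.env hl,
      CounterOp.length_sweepCols o hp l _ hlen ?_, ?_⟩
    · rintro v rfl
      rw [hl v hp]
      exact Nat.lt_succ_of_le (h v rfl)
    · have hb := length_lt_of_pow_le hlen
      rw [← CounterOp.sweepResult_eq_applyAcc o hp l s.env hl]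
      refine .head ⟨next_of_tapeStep hpos (l' := l) (m := .right) (w := tapeOf l 0) rfl
        (Function.update_eq_self _ _), fun _ => ?_⟩
        (.trans (boundedReach_forth P x s.pos hpos o k s.acc s.out l [] o.sweepInit ?_)
          (boundedReach_back P x s.pos hpos _ k _ _ _ ?_))
      · simp only [config, HeadMove.apply]
        omega
      · simpa using hb
      · simp only [List.length_nil]
        omega
  | seq h₁ h₂ ih₁ ih₂ =>
    rename_i p q s₁ s₂ s₃
    obtain ⟨hpos₂, l₂, hl₂, hlen₂, hr₂⟩ := ih₁ hp.1 (q :: k) l hl hlen hpos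
    obtain ⟨hpos₃, l₃, hl₃, hlen₃, hr₃⟩ := ih₂ hp.2 k l₂ hl₂ hlen₂ hpos₂
    exact ⟨hpos₃, l₃, hl₃, hlen₃, .trans (hctl _ _ _ hpos _ _ rfl) (hr₂.trans hr₃)⟩
  | ite_true hacc h ih =>
    obtain ⟨hpos₂, l₂, hl₂, hlen₂, hr₂⟩ := ih hp.1 k l hl hlen hpos
    refine ⟨hpos₂, l₂, hl₂, hlen₂, .trans (hctl _ _ _ hpos _ _ ?_) hr₂⟩
    simp [delta, hacc]
  | ite_false hacc h ih =>
    obtain ⟨hpos₂, l₂, hl₂, hlen₂, hr₂⟩ := ih hp.2 k l hl hlen hpos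
    refine ⟨hpos₂, l₂, hl₂, hlen₂, .trans (hctl _ _ _ hpos _ _ ?_) hr₂⟩
    simp [delta, hacc]
  | loop_done h hacc ih =>
    rename_i p s s'
    obtain ⟨hpos₂, l₂, hl₂, hlen₂, hr₂⟩ := ih hp (CounterProg.ite skip (loop p) :: k) l hl hlen hpos
    refine ⟨hpos₂, l₂, hl₂, hlen₂, .trans (hctl _ _ _ hpos _ _ rfl) (hr₂.trans
      (.trans (hctl _ (.run (skip :: k) s'.acc) _ hpos₂ _ _ ?_) (hctl _ _ _ hpos₂ _ _ rfl)))⟩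
    simp [delta, hacc]
  | loop_next h₁ hacc h₂ ih₁ ih₂ =>
    rename_i p s₁ s₂ s₃
    obtain ⟨hpos₂, l₂, hl₂, hlen₂, hr₂⟩ :=
      ih₁ hp (CounterProg.ite skip (loop p) :: k) l hl hlen hpos
    obtain ⟨hpos₃, l₃, hl₃, hlen₃, hr₃⟩ := ih₂ hp k l₂ hl₂ hlen₂ hpos₂
    refine ⟨hpos₃, l₃, hl₃, hlen₃, .trans (hctl _ _ _ hpos _ _ rfl) (hr₂.trans
      (.trans (hctl _ (.run (loop p :: k) s₂.acc) _ hpos₂ _ _ ?_) hr₃))⟩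
    simp [delta, hacc]

/-- The initial state of counter programs. -/
def initStore (β : Type*) : CounterStore β := ⟨false, 0, fun _ => 0, []⟩

/-- Functions computed by counter programs are computable in logarithmic space. -/
theorem logSpaceComputable (P : CounterProg α β) (f : List α → List β)
    (h : ∀ x, ∃ s, Exec x P (initStore β) s ∧ s.out = f x) : LogSpaceComputable f := by
  obtain ⟨K, hK⟩ := P.exists_varsLT
  have key : ∀ x, ∃ c, BoundedReach P K x (P.toTransducer K).init c ∧
      (P.toTransducer K).next x c = none ∧ c.out = f x := by
    intro x
    obtain ⟨s, hs, hout⟩ := h x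
    obtain ⟨hpos, l, -, -, hr⟩ := hs.boundedReach (P := P) (K := K) hK [] []
      (fun v _ => rfl) (by simp; omega) (Nat.zero_le _)
    refine ⟨_, .head ⟨?_, fun _ => ?_⟩ hr, ?_, hout⟩
    · simp only [Transducer.next, Transducer.init, toTransducer, delta, tapeStep, Option.map_some,
        Option.mem_def, Option.some.injEq, config, initStore, HeadMove.apply,
        TransducerConfig.mk.injEq, true_and]
      refine ⟨by simp, ?_, by simp⟩
      funext _ i
      rcases i with _ | i <;> simp [tapeOf]
    · simp [config]
    · simp [Transducer.next, toTransducer, config, delta]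
  refine Transducer.ComputesInLogSpace.logSpaceComputable (T := P.toTransducer K)
    ⟨fun x => ?_, 4, fun x c hc => ?_⟩ P.usedControls P.usedControls_finite
    P.start_mem_usedControls (P.usedControls_closed K)
  · obtain ⟨c, hc, hend, hout⟩ := key x
    exact ⟨c, Relation.ReflTransGen.mono (fun _ _ h => h.1) _ _ hc, hend, hout⟩
  · obtain ⟨z, hz, hend, -⟩ := key x
    exact Transducer.reachable_of_bounded_run
      (B := fun c : TransducerConfig β (Control α β) (TapeSym K) 1 =>
        ∀ i, c.workPos i < 4 * (Nat.log 2 x.length + 1))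
      (by simp [Transducer.init]) hz hend hc

end CounterProg

namespace CounterProg

/-! ## Derived programs -/

section Derived

variable {α β : Type*}

/-- Move the input head to the left endmarker. -/
def home : CounterProg α β :=
  loop (pure fun _ a => match a with
    | .left => (true, .stay, none)
    | _ => (false, .left, none))

/-- Set the test register and move the input head. -/
def setAcc (b : Bool) (m : HeadMove) : CounterProg α β := pure fun _ _ => (b, m, none)

/-- Test whether the input head is at the left endmarker. -/
def testLeft : CounterProg α β :=
  pure fun _ a => match a with
    | .left => (true, .stay, none)
    | _ => (false, .stay, none)

/-- Run `p` for the values `0, 1, …, |x|` of the counter `v`, until it leaves `true` in the test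
register. Counter `0` has to contain `|x|`. -/
def search (v : ℕ) (p : CounterProg α β) : CounterProg α β :=
  seq (op (.zero v)) (seq
    (loop (seq p (ite home (seq (op (.eq v 0))
      (ite (seq home (setAcc true .right)) (op (.inc v)))))))
    testLeft)

theorem inputSymbol_succ (x : List α) (i : ℕ) :
    Transducer.inputSymbol x (i + 1) = (x[i]?).elim .right .letter := by
  simp only [Transducer.inputSymbol, endmark, List.cons_append, List.getD_cons_succ]
  rw [List.getD_eq_getElem?_getD, List.getElem?_append]
  split_ifs with h
  · simp only [List.length_map] at h
    simp [h]
  · simp only [List.length_map, not_lt] at h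
    rw [List.getElem?_eq_none h, List.length_map]
    rcases i - x.length with _ | n <;> simp

theorem inputSymbol_succ_ne_left (x : List α) (i : ℕ) :
    Transducer.inputSymbol x (i + 1) ≠ .left := by
  rw [inputSymbol_succ]
  cases x[i]? <;> simp

theorem exec_home (x : List α) (s : CounterStore β) :
    Exec x home s ⟨true, 0, s.env, s.out⟩ := by
  obtain ⟨acc, pos, env, out⟩ := s
  induction pos using Nat.strong_induction_on generalizing acc with
  | _ pos ih =>
    rcases pos with _ | n
    · have := Exec.pure (β := β) (x := x) (s := ⟨acc, 0, env, out⟩) (b := true) (m := .stay) (e := none)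
        (f := fun _ a => match a with
          | .left => (true, .stay, none)
          | _ => (false, .left, none)) (h := rfl)
      simp only [HeadMove.apply, Nat.zero_le, inf_of_le_left, Option.toList_none,
        List.append_nil] at this
      exact .loop_done this rfl
    · have := Exec.pure (β := β) (x := x) (s := ⟨acc, n + 1, env, out⟩) (b := false) (m := .left) (e := none)
        (f := fun _ a => match a with
          | .left => (true, .stay, none)
          | _ => (false, .left, none)) (h := by
            have := inputSymbol_succ_ne_left x n
            revert this
            cases Transducer.inputSymbol x (n + 1) <;> simp)
      simp only [HeadMove.apply, Option.toList_none, List.append_nil] at this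
      exact .loop_next this rfl (ih _ (by omega) false)

theorem exec_setAcc (x : List α) (b : Bool) (m : HeadMove) (s : CounterStore β) :
    Exec x (setAcc b m) s ⟨b, min (m.apply s.pos) (x.length + 1), s.env, s.out⟩ := by
  simpa [setAcc] using Exec.pure (x := x) (fun _ _ => (b, m, none)) s b m none rfl

theorem exec_skip (x : List α) (s : CounterStore β) :
    Exec x skip s ⟨s.acc, min s.pos (x.length + 1), s.env, s.out⟩ := by
  simpa [skip, HeadMove.apply] using Exec.pure (x := x) (fun acc _ => (acc, .stay, none)) s s.acc .stay none rfl

theorem exec_testLeft_zero (x : List α) (b : Bool) (env : ℕ → ℕ) (out : List β) :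
    Exec x testLeft ⟨b, 0, env, out⟩ ⟨true, 0, env, out⟩ := by
  simpa [testLeft, HeadMove.apply] using Exec.pure (x := x) (fun _ a => match a with
    | .left => (true, .stay, none)
    | _ => (false, .stay, none)) ⟨b, 0, env, out⟩ true .stay none rfl

theorem exec_testLeft_one (x : List α) (b : Bool) (env : ℕ → ℕ) (out : List β) :
    Exec x testLeft ⟨b, 1, env, out⟩ ⟨false, 1, env, out⟩ := by
  have := Exec.pure (x := x) (fun _ a => match a with
    | .left => (true, .stay, none)
    | _ => (false, .stay, none)) ⟨b, 1, env, out⟩ false .stay none (by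
      have := inputSymbol_succ_ne_left x 0
      revert this
      cases Transducer.inputSymbol x (0 + 1) <;> simp)
  simpa [testLeft, HeadMove.apply] using this

/-- Total correctness of `search`. -/
theorem exec_search (x : List α) (v : ℕ) (p : CounterProg α β)
    (Inv : ℕ → (ℕ → ℕ) → List β → Prop) (Post : Bool → (ℕ → ℕ) → List β → Prop)
    (body : ∀ i ≤ x.length, ∀ s : CounterStore β, Inv i s.env s.out → ∃ s', Exec x p s s' ∧
      s'.env v = i ∧ s'.env 0 = x.length ∧ (s'.acc = true → Post true s'.env s'.out) ∧
      (s'.acc = false → i < x.length → Inv (i + 1) (Function.update s'.env v (i + 1)) s'.out) ∧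
      (s'.acc = false → i = x.length → Post false s'.env s'.out))
    (s : CounterStore β) (hs : Inv 0 (Function.update s.env v 0) s.out) :
    ∃ s', Exec x (search v p) s s' ∧ Post s'.acc s'.env s'.out := by
  -- The test register must become `true` to end the loop in either case, so the outcome is kept in
  -- the head position: cell `0` if `p` has succeeded, cell `1` if the values are exhausted.
  -- `testLeft` turns it back into a truth value.
  suffices H : ∀ n i, i + n = x.length → ∀ s : CounterStore β, Inv i s.env s.out →
      ∃ b env out, Exec x (loop (seq p (ite home (seq (op (.eq v 0))
        (ite (seq home (setAcc true .right)) (op (.inc v))))))) s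
          ⟨true, if b then 0 else 1, env, out⟩ ∧ Post b env out by
    obtain ⟨b, env, out, h, hp⟩ := H x.length 0 (by simp) ⟨s.acc, s.pos, _, s.out⟩ hs
    have h0 : Exec x (op (.zero v)) s ⟨s.acc, s.pos, Function.update s.env v 0, s.out⟩ :=
      Exec.op (.zero v) s (by simp)
    cases b
    · exact ⟨_, .seq h0 (.seq h (exec_testLeft_one x _ env out)), hp⟩
    · exact ⟨_, .seq h0 (.seq h (exec_testLeft_zero x _ env out)), hp⟩
  intro n
  induction n with
  | zero =>
    intro i hi s hs
    obtain ⟨s', h, hv, h0, ht, -, hf⟩ := body i (by omega) s hs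
    cases hacc : s'.acc
    · have h1 : Exec x (op (.eq v 0)) s' ⟨true, s'.pos, s'.env, s'.out⟩ := by
        have := Exec.op (x := x) (.eq v 0) s' (by simp)
        simpa [CounterOp.applyAcc, CounterOp.applyEnv, hv, h0, show i = x.length by omega] using this
      have h2 := exec_setAcc x true .right ⟨true, 0, s'.env, s'.out⟩
      refine ⟨false, s'.env, s'.out, .loop_done (.seq h (.ite_false hacc (.seq h1
        (.ite_true rfl (.seq (exec_home x _) ?_))))) rfl, hf hacc (by omega)⟩
      simpa [HeadMove.apply] using h2
    · exact ⟨true, s'.env, s'.out, .loop_done (.seq h (.ite_true hacc (exec_home x _))) rfl,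
        ht hacc⟩
  | succ n ih =>
    intro i hi s hs
    obtain ⟨s', h, hv, h0, ht, hn, -⟩ := body i (by omega) s hs
    cases hacc : s'.acc
    · have h1 : Exec x (op (.eq v 0)) s' ⟨false, s'.pos, s'.env, s'.out⟩ := by
        have := Exec.op (x := x) (.eq v 0) s' (by simp)
        simpa [CounterOp.applyAcc, CounterOp.applyEnv, hv, h0, show i ≠ x.length by omega] using this
      have h2 := Exec.op (x := x) (.inc v) ⟨false, s'.pos, s'.env, s'.out⟩ (by
        rintro w hw
        cases hw
        simp only [hv]
        omega)
      simp only [CounterOp.applyAcc, CounterOp.applyEnv, hv] at h2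
      obtain ⟨b, env, out, h3, hp⟩ := ih (i + 1) (by omega) ⟨false, s'.pos, _, s'.out⟩
        (hn hacc (by omega))
      exact ⟨b, env, out, .loop_next (.seq h (.ite_false hacc (.seq h1 (.ite_false rfl h2))))
        rfl h3, hp⟩
    · exact ⟨true, s'.env, s'.out, .loop_done (.seq h (.ite_true hacc (exec_home x _))) rfl,
        ht hacc⟩

/-- Read the input symbol at the position given by the counter `v`, using counter `1`. -/
def readAt (v : ℕ) (g : Endmarked α → Bool) : CounterProg α β :=
  seq home (seq (setAcc false .right) (seq (op (.zero 1))
    (seq (loop (seq (op (.eq 1 v)) (ite skip (seq (op (.inc 1)) (setAcc false .right)))))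
      (pure fun _ a => (g a, .stay, none)))))

/-- The head is on cell `i + 1` whenever counter `1` holds `i`; the shift is due to the left
endmarker in cell `0`. -/
theorem exec_readAt (x : List α) (v : ℕ) (hv : v ≠ 1) (g : Endmarked α → Bool)
    (s : CounterStore β) (hs : s.env v ≤ x.length) :
    ∃ pos, Exec x (readAt v g) s ⟨g (Transducer.inputSymbol x (s.env v + 1)), pos,
      Function.update s.env 1 (s.env v), s.out⟩ := by
  have hloop : ∀ n i b, i + n = s.env v →
      Exec x (loop (seq (op (.eq 1 v)) (ite skip (seq (op (.inc 1)) (setAcc false .right)))))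
        ⟨b, i + 1, Function.update s.env 1 i, s.out⟩
        ⟨true, s.env v + 1, Function.update s.env 1 (s.env v), s.out⟩ := by
    intro n
    induction n with
    | zero =>
      intro i b hi
      have h1 := Exec.op (x := x) (.eq 1 v)
        ⟨b, i + 1, Function.update s.env 1 i, s.out⟩ (by simp)
      simp only [CounterOp.applyAcc, CounterOp.applyEnv, Function.update_self,
        Function.update_of_ne hv] at h1
      obtain rfl : i = s.env v := by omega
      have h2 := exec_skip x ⟨true, s.env v + 1, Function.update s.env 1 (s.env v), s.out⟩
      simp only [min_eq_left (show s.env v + 1 ≤ x.length + 1 by omega)] at h2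
      exact .loop_done (.seq h1 (.ite_true (by simp) (by simpa using h2))) rfl
    | succ n ih =>
      intro i b hi
      have h1 := Exec.op (x := x) (.eq 1 v)
        ⟨b, i + 1, Function.update s.env 1 i, s.out⟩ (by simp)
      simp only [CounterOp.applyAcc, CounterOp.applyEnv, Function.update_self,
        Function.update_of_ne hv] at h1
      have h2 := Exec.op (x := x) (.inc 1)
        ⟨decide (i = s.env v), i + 1, Function.update s.env 1 i, s.out⟩ (by
          rintro w hw
          cases hw
          simp only [Function.update_self]
          omega)
      simp only [CounterOp.applyAcc, CounterOp.applyEnv, Function.update_self,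
        Function.update_idem] at h2
      have h3 := exec_setAcc x false .right
        ⟨decide (i = s.env v), i + 1, Function.update s.env 1 (i + 1), s.out⟩
      simp only [HeadMove.apply, min_eq_left (show i + 1 + 1 ≤ x.length + 1 by omega)] at h3
      exact .loop_next (.seq h1 (.ite_false (by simp; omega) (.seq h2 h3))) rfl
        (ih (i + 1) false (by omega))
  have h1 := exec_setAcc x false .right ⟨true, 0, s.env, s.out⟩
  simp only [HeadMove.apply, zero_add, min_eq_left (show 1 ≤ x.length + 1 by omega)] at h1
  have h2 := Exec.op (x := x) (.zero 1) ⟨false, 1, s.env, s.out⟩ (by simp)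
  simp only [CounterOp.applyAcc, CounterOp.applyEnv] at h2
  have h3 := Exec.pure (x := x) (fun _ a => (g a, HeadMove.stay, none))
    ⟨true, s.env v + 1, Function.update s.env 1 (s.env v), s.out⟩ _ .stay none rfl
  simp only [Option.toList_none, List.append_nil] at h3
  exact ⟨_, .seq (exec_home x s) (.seq h1 (.seq h2 (.seq (hloop (s.env v) 0 false (by simp))
    h3)))⟩

end Derived

end CounterProg

namespace CounterProg

/-! ## Relations decided by counter programs -/

variable {α : Type*}

/-- Counter `0` contains `|x|`, and no counter exceeds it. -/
def GoodEnv (x : List α) (env : ℕ → ℕ) : Prop := env 0 = x.length ∧ ∀ v, env v ≤ x.length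

theorem GoodEnv.update {x : List α} {env : ℕ → ℕ} (h : GoodEnv x env) {v n : ℕ} (hv : v ≠ 0)
    (hn : n ≤ x.length) : GoodEnv x (Function.update env v n) := by
  refine ⟨by rw [Function.update_of_ne hv.symm, h.1], fun w => ?_⟩
  rw [Function.update_apply]
  split_ifs
  · exact hn
  · exact h.2 w

/-- The values of the first `L` variables, which are stored in the counters `2, …, L + 1`. -/
def ctx (L : ℕ) (env : ℕ → ℕ) : Fin L → ℕ := fun i => env (i + 2)

theorem ctx_succ (L : ℕ) (env : ℕ → ℕ) :
    ctx (L + 1) env = Fin.snoc (ctx L env) (env (L + 2)) := by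
  funext i
  refine Fin.lastCases ?_ (fun i => ?_) i <;> simp [ctx]

theorem ctx_congr {L : ℕ} {env env' : ℕ → ℕ} (h : ∀ i < L, env' (i + 2) = env (i + 2)) :
    ctx L env' = ctx L env := funext fun i => h i i.2

/-- `p` terminates, preserves the first `L` variables and the output, and establishes `R`. -/
def Computes (L : ℕ) (p : CounterProg α α)
    (R : List α → (Fin L → ℕ) → Bool → (ℕ → ℕ) → Prop) : Prop :=
  ∀ (x : List α) (s : CounterStore α), GoodEnv x s.env → ∃ s', Exec x p s s' ∧ GoodEnv x s'.env ∧
    s'.out = s.out ∧ (∀ i < L, s'.env (i + 2) = s.env (i + 2)) ∧ R x (ctx L s.env) s'.acc s'.env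

/-- The relation `φ` on `L` variables is decided by a program. -/
def DecidableAt (L : ℕ) (φ : List α → (Fin L → ℕ) → Prop) : Prop :=
  ∃ p : CounterProg α α, Computes L p fun x e b _ => (b = true ↔ φ x e)

/-- The relation `φ` on `m` variables is decided by a program, for every allocation of the
variables. -/
def Def (m : ℕ) (φ : List α → (Fin m → ℕ) → Prop) : Prop :=
  ∀ (L : ℕ) (ρ : Fin m → Fin L), DecidableAt L fun x e => φ x (e ∘ ρ)

variable {m : ℕ} {φ ψ : List α → (Fin m → ℕ) → Prop}

theorem Computes.congr {L : ℕ} {p : CounterProg α α}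
    {R R' : List α → (Fin L → ℕ) → Bool → (ℕ → ℕ) → Prop} (h : Computes L p R)
    (hR : ∀ x e b env, (∀ i, e i ≤ x.length) → R x e b env → R' x e b env) :
    Computes L p R' := by
  intro x s hs
  obtain ⟨s', h1, h2, h3, h4, h5⟩ := h x s hs
  exact ⟨s', h1, h2, h3, h4, hR _ _ _ _ (fun i => hs.2 _) h5⟩

/-- All variables hold numbers up to `|x|`, so the equivalence is needed for such values only. This
is what later allows unbounded quantifiers over positions to be replaced by bounded ones. -/
theorem Def.congr (h : Def m φ)
    (hφ : ∀ x e, (∀ i, e i ≤ x.length) → (ψ x e ↔ φ x e)) : Def m ψ := by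
  intro L ρ
  obtain ⟨p, hp⟩ := h L ρ
  refine ⟨p, hp.congr fun x e b env he hb => hb.trans (hφ x _ fun i => he _).symm⟩

/-- `Def` asks for a program under every allocation of the variables, so that substitution is just
composition of allocations. -/
theorem Def.subst (h : Def m φ) {k : ℕ} (ρ : Fin m → Fin k) :
    Def k fun x e => φ x (e ∘ ρ) := fun L σ => h L (σ ∘ ρ)

/-- The truth value of `c` is built into the program, whether or not it can be computed. Through
this lemma finitely many facts about an arbitrary language enter the reduction. -/
theorem Def.const (c : Prop) : Def m fun (_ : List α) _ => c := by
  classical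
  intro L ρ
  refine ⟨setAcc (decide c) .stay, fun x s hs => ⟨_, exec_setAcc x _ _ s, hs, rfl,
    fun _ _ => rfl, by simp⟩⟩

theorem Def.not (h : Def m φ) : Def m fun x e => ¬ φ x e := by
  intro L ρ
  obtain ⟨p, hp⟩ := h L ρ
  refine ⟨seq p (ite (setAcc false .stay) (setAcc true .stay)), fun x s hs => ?_⟩
  obtain ⟨s', h1, h2, h3, h4, h5⟩ := hp x s hs
  cases hacc : s'.acc
  · exact ⟨_, .seq h1 (.ite_false hacc (exec_setAcc x _ _ _)), h2, h3, h4, by simpa [hacc] using h5⟩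
  · exact ⟨_, .seq h1 (.ite_true hacc (exec_setAcc x _ _ _)), h2, h3, h4, by simpa [hacc] using h5⟩

theorem Def.and (h : Def m φ) (h' : Def m ψ) : Def m fun x e => φ x e ∧ ψ x e := by
  intro L ρ
  obtain ⟨p, hp⟩ := h L ρ
  obtain ⟨q, hq⟩ := h' L ρ
  refine ⟨seq p (ite q skip), fun x s hs => ?_⟩
  obtain ⟨s', h1, h2, h3, h4, h5⟩ := hp x s hs
  cases hacc : s'.acc
  · refine ⟨_, .seq h1 (.ite_false hacc (exec_skip x _)), h2, h3, h4, ?_⟩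
    simp only [hacc] at h5 ⊢
    exact ⟨fun h => absurd h (by simp), fun h => h5.2 h.1⟩
  · obtain ⟨s'', g1, g2, g3, g4, g5⟩ := hq x s' h2
    refine ⟨_, .seq h1 (.ite_true hacc g1), g2, g3.trans h3,
      fun i hi => (g4 i hi).trans (h4 i hi), ?_⟩
    rw [ctx_congr h4] at g5
    exact g5.trans ⟨fun h => ⟨h5.1 hacc, h⟩, fun h => h.2⟩

theorem Def.or (h : Def m φ) (h' : Def m ψ) : Def m fun x e => φ x e ∨ ψ x e :=
  (h.not.and h'.not).not.congr fun _ _ _ => by tauto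

theorem Def.imp (h : Def m φ) (h' : Def m ψ) : Def m fun x e => φ x e → ψ x e :=
  (h.not.or h').congr fun _ _ _ => by tauto

theorem Def.forallFinite {ι : Type*} [Finite ι] {φ : ι → List α → (Fin m → ℕ) → Prop}
    (h : ∀ i, Def m (φ i)) : Def m fun x e => ∀ i, φ i x e := by
  classical
  have := Fintype.ofFinite ι
  suffices H : ∀ s : Finset ι, Def m fun x e => ∀ i ∈ s, φ i x e from
    (H Finset.univ).congr fun _ _ _ => by simp
  intro s
  induction s using Finset.induction_on with
  | empty => exact (Def.const True).congr fun _ _ _ => by simp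
  | insert a s _ ih => exact ((h a).and ih).congr fun _ _ _ => by simp

theorem Def.existsFinite {ι : Type*} [Finite ι] {φ : ι → List α → (Fin m → ℕ) → Prop}
    (h : ∀ i, Def m (φ i)) : Def m fun x e => ∃ i, φ i x e :=
  (Def.forallFinite fun i => (h i).not).not.congr fun _ _ _ => by simp

theorem Def.add_index (i j k : Fin m) : Def m fun (_ : List α) e => e i + e j = e k := by
  intro L ρ
  refine ⟨op (.add (ρ i + 2) (ρ j + 2) (ρ k + 2)), fun x s hs => ⟨_, Exec.op _ s (by simp), hs, rfl,
    fun _ _ => rfl, by simp [CounterOp.applyAcc, ctx]⟩⟩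

theorem Def.eq_index (i j : Fin m) : Def m fun (_ : List α) e => e i = e j := by
  intro L ρ
  refine ⟨op (.eq (ρ i + 2) (ρ j + 2)), fun x s hs => ⟨_, Exec.op _ s (by simp), hs, rfl,
    fun _ _ => rfl, by simp [CounterOp.applyAcc, ctx]⟩⟩

theorem Def.get_index (g : Option α → Prop) (i : Fin m) :
    Def m fun (x : List α) e => g (x[e i]?) := by
  classical
  intro L ρ
  refine ⟨readAt (ρ i + 2) (fun a => match a with
    | .letter c => decide (g (some c))
    | _ => decide (g none)), fun x s hs => ?_⟩
  obtain ⟨pos, h⟩ := exec_readAt x (ρ i + 2) (by omega) (fun a => match a with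
    | .letter c => decide (g (some c))
    | _ => decide (g none)) s (hs.2 _)
  refine ⟨_, h, hs.update (by omega) (hs.2 _), rfl, fun j hj => ?_, ?_⟩
  · exact Function.update_of_ne (show j + 2 ≠ 1 by omega) (s.env (ρ i + 2)) s.env
  · simp only [inputSymbol_succ, Function.comp_apply, ctx]
    cases x[s.env (ρ i + 2)]? <;> simp

/-- `R` may mention the final counters: after a success the value found stays in counter `L + 2`. A
search is therefore usable both as a quantifier and for finding the successor of a pair. In the
negative case the counters left by each failing trial are overwritten, hence `∃ env'`. -/
theorem computes_search {L : ℕ} {p : CounterProg α α}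
    {R : List α → (Fin (L + 1) → ℕ) → Bool → (ℕ → ℕ) → Prop} (h : Computes (L + 1) p R) :
    Computes L (search (L + 2) p) fun x e b env =>
      if b then ∃ i ≤ x.length, env (L + 2) = i ∧ R x (Fin.snoc e i) true env
      else ∀ i ≤ x.length, ∃ env', R x (Fin.snoc e i) false env' := by
  intro x s hs
  refine (exec_search x (L + 2) p
    (fun i env out => GoodEnv x env ∧ out = s.out ∧ (∀ j < L, env (j + 2) = s.env (j + 2)) ∧
      env (L + 2) = i ∧ ∀ j < i, ∃ env', R x (Fin.snoc (ctx L s.env) j) false env')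
    (fun b env out => GoodEnv x env ∧ out = s.out ∧ (∀ j < L, env (j + 2) = s.env (j + 2)) ∧
      if b then ∃ i ≤ x.length, env (L + 2) = i ∧ R x (Fin.snoc (ctx L s.env) i) true env
      else ∀ i ≤ x.length, ∃ env', R x (Fin.snoc (ctx L s.env) i) false env') ?_ s ?_).imp
    fun s' h => ⟨h.1, h.2.1, h.2.2.1, h.2.2.2.1, h.2.2.2.2⟩
  · rintro i hi t ⟨hg, hout, hctx, hv, hprev⟩
    obtain ⟨t', g1, g2, g3, g4, g5⟩ := h x t hg
    have hv' : t'.env (L + 2) = i := (g4 L (by omega)).trans hv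
    have hctx' : ∀ j < L, t'.env (j + 2) = s.env (j + 2) := fun j hj =>
      (g4 j (by omega)).trans (hctx j hj)
    rw [ctx_succ, hv, ctx_congr hctx] at g5
    have hfalse : t'.acc = false → ∀ j < i + 1,
        ∃ env', R x (Fin.snoc (ctx L s.env) j) false env' := by
      intro hacc j hj
      rcases Nat.lt_succ_iff_lt_or_eq.1 hj with hj | rfl
      · exact hprev j hj
      · exact ⟨_, hacc ▸ g5⟩
    refine ⟨t', g1, hv', g2.1, fun hacc => ⟨g2, g3.trans hout, hctx', ?_⟩, fun hacc hlt =>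
      ⟨g2.update (by omega) hlt, g3.trans hout, fun j hj => ?_, by simp, hfalse hacc⟩,
      fun hacc heq => ⟨g2, g3.trans hout, hctx', ?_⟩⟩
    · rw [if_pos rfl]
      exact ⟨i, hi, hv', hacc ▸ g5⟩
    · rw [Function.update_of_ne (by omega), hctx' j hj]
    · rw [if_neg (by simp)]
      exact fun j hj => hfalse hacc j (by omega)
  · refine ⟨hs.update (by omega) (Nat.zero_le _), rfl, fun j hj => ?_, by simp, by simp⟩
    rw [Function.update_of_ne (by omega)]

theorem snoc_comp_snoc {L : ℕ} (ρ : Fin m → Fin L) (e : Fin L → ℕ) (i : ℕ) :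
    (Fin.snoc e i : Fin (L + 1) → ℕ) ∘
      (Fin.snoc (fun j => (ρ j).castSucc) (Fin.last L) : Fin (m + 1) → Fin (L + 1)) =
      Fin.snoc (e ∘ ρ) i := by
  funext j
  refine Fin.lastCases ?_ (fun j => ?_) j <;> simp

theorem Def.ex {φ : List α → (Fin m → ℕ) → ℕ → Prop}
    (h : Def (m + 1) fun x e => φ x (Fin.init e) (e (Fin.last m))) :
    Def m fun x e => ∃ i ≤ x.length, φ x e i := by
  intro L ρ
  obtain ⟨p, hp⟩ := h (L + 1) (Fin.snoc (fun j => (ρ j).castSucc) (Fin.last L))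
  refine ⟨search (L + 2) p, (computes_search hp).congr fun x e b env he h => ?_⟩
  simp only [snoc_comp_snoc, Fin.init_snoc, Fin.snoc_last] at h
  cases b
  · simpa using h
  · simp only [if_true, true_iff] at h ⊢
    obtain ⟨i, hi, -, h⟩ := h
    exact ⟨i, hi, h⟩

theorem Def.all {φ : List α → (Fin m → ℕ) → ℕ → Prop}
    (h : Def (m + 1) fun x e => φ x (Fin.init e) (e (Fin.last m))) :
    Def m fun x e => ∀ i ≤ x.length, φ x e i :=
  (Def.ex (φ := fun x e i => ¬ φ x e i) h.not).not.congr fun _ _ _ => by push Not; rfl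

/-! ### Reachability -/

/-- The body of a search advances the pair of variables `L`, `L + 1` along `nx` until `hit`. -/
def Iterates (L l : ℕ) (p : CounterProg α α) (x : List α) (e : Fin L → ℕ) (nx : ℕ × ℕ → ℕ × ℕ)
    (hit : ℕ × ℕ → Prop) : Prop :=
  ∀ s : CounterStore α, GoodEnv x s.env → ctx L s.env = e → ∃ s', Exec x p s s' ∧
    GoodEnv x s'.env ∧ s'.out = s.out ∧ (∀ i < L, s'.env (i + 2) = s.env (i + 2)) ∧
    (∀ i, L + 2 ≤ i → i < l → s'.env (i + 2) = s.env (i + 2)) ∧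
    ((s'.acc = true ∧ hit (s.env (L + 2), s.env (L + 3))) ∨
      (s'.acc = false ∧ ¬ hit (s.env (L + 2), s.env (L + 3)) ∧
        (s'.env (L + 2), s'.env (L + 3)) = nx (s.env (L + 2), s.env (L + 3))))

/-- A body that advances the pair once is run for `|x| + 1` values of a loop counter, so the whole
search advances it `|x| + 1` times unless `hit` occurs on the way. Applying this twice gives `(|x| +
1)²` steps, the number of pairs of positions. -/
theorem Iterates.search {L l : ℕ} {p : CounterProg α α} {x : List α} {e : Fin L → ℕ}
    {nx : ℕ × ℕ → ℕ × ℕ} {hit : ℕ × ℕ → Prop} (hl : L + 2 ≤ l)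
    (h : Iterates L (l + 1) p x e nx hit) :
    Iterates L l (CounterProg.search (l + 2) p) x e (nx^[x.length + 1])
      (fun c => ∃ t < x.length + 1, hit (nx^[t] c)) := by
  intro s hs he
  set c := (s.env (L + 2), s.env (L + 3)) with hc
  refine (exec_search x (l + 2) p
    (fun i env out => GoodEnv x env ∧ out = s.out ∧ (∀ j < L, env (j + 2) = s.env (j + 2)) ∧
      (∀ j, L + 2 ≤ j → j < l → env (j + 2) = s.env (j + 2)) ∧
      env (l + 2) = i ∧ (env (L + 2), env (L + 3)) = nx^[i] c ∧ ∀ j < i, ¬ hit (nx^[j] c))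
    (fun b env out => GoodEnv x env ∧ out = s.out ∧ (∀ j < L, env (j + 2) = s.env (j + 2)) ∧
      (∀ j, L + 2 ≤ j → j < l → env (j + 2) = s.env (j + 2)) ∧
      ((b = true ∧ ∃ t < x.length + 1, hit (nx^[t] c)) ∨
        (b = false ∧ (¬ ∃ t < x.length + 1, hit (nx^[t] c)) ∧
          (env (L + 2), env (L + 3)) = nx^[x.length + 1] c))) ?_ s ?_).imp fun s' h => h
  · rintro i hi t ⟨hg, hout, hctx, hvars, hv, hcur, hprev⟩
    obtain ⟨t', g1, g2, g3, g4, g5, g6⟩ := h t hg ((ctx_congr hctx).trans he)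
    have hv' : t'.env (l + 2) = i := (g5 l (by omega) (by omega)).trans hv
    have hctx' : ∀ j < L, t'.env (j + 2) = s.env (j + 2) := fun j hj =>
      (g4 j (by omega)).trans (hctx j hj)
    have hvars' : ∀ j, L + 2 ≤ j → j < l → t'.env (j + 2) = s.env (j + 2) := fun j hj hj' =>
      (g5 j hj (by omega)).trans (hvars j hj hj')
    rw [hcur, ← Function.iterate_succ_apply' nx] at g6
    refine ⟨t', g1, hv', g2.1, fun hacc => ?_, fun hacc hlt => ?_, fun hacc heq => ?_⟩
    · simp only [hacc, true_and, reduceCtorEq, false_and, or_false] at g6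
      exact ⟨g2, g3.trans hout, hctx', hvars', .inl ⟨rfl, i, by omega, g6⟩⟩
    · simp only [hacc, true_and, reduceCtorEq, false_and, false_or] at g6
      refine ⟨g2.update (by omega) hlt, g3.trans hout, fun j hj => ?_, fun j hj hj' => ?_,
        by simp, ?_, fun j hj => ?_⟩
      · rw [Function.update_of_ne (by omega), hctx' j hj]
      · rw [Function.update_of_ne (by omega), hvars' j hj hj']
      · rw [Function.update_of_ne (by omega), Function.update_of_ne (by omega), g6.2]
      · rcases Nat.lt_succ_iff_lt_or_eq.1 hj with hj | rfl
        · exact hprev j hj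
        · exact g6.1
    · simp only [hacc, true_and, reduceCtorEq, false_and, false_or] at g6
      refine ⟨g2, g3.trans hout, hctx', hvars', .inr ⟨rfl, ?_, heq ▸ g6.2⟩⟩
      rintro ⟨j, hj, hhit⟩
      rcases Nat.lt_succ_iff_lt_or_eq.1 hj with hj | rfl
      · exact hprev j (by omega) hhit
      · exact g6.1 (heq ▸ hhit)
  · refine ⟨hs.update (by omega) (Nat.zero_le _), rfl, fun j hj => ?_, fun j hj hj' => ?_, by simp,
      ?_, by simp⟩
    · rw [Function.update_of_ne (by omega)]
    · rw [Function.update_of_ne (by omega)]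
    · rw [Function.update_of_ne (by omega), Function.update_of_ne (by omega)]
      rfl

end CounterProg

/-- A point reachable under iteration within a finite set is reached in few steps. -/
theorem Function.exists_iterate_lt_card {σ : Type*} {f : σ → σ} {a b : σ} (S : Finset σ)
    (ha : a ∈ S) (hf : ∀ c ∈ S, f c ∈ S) (h : ∃ t, f^[t] a = b) :
    ∃ t < S.card, f^[t] a = b := by
  classical
  have hS : ∀ t, f^[t] a ∈ S := by
    intro t
    induction t with
    | zero => exact ha
    | succ t ih =>
      rw [Function.iterate_succ_apply']
      exact hf _ ih
  refine ⟨Nat.find h, ?_, Nat.find_spec h⟩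
  by_contra! hlt
  obtain ⟨i, hi, j, hj, hne, hij⟩ := Finset.exists_ne_map_eq_of_card_lt_of_maps_to
    (s := Finset.range (S.card + 1)) (t := S) (by simp) (f := fun t => f^[t] a)
    (fun t _ => hS t)
  -- If the orbit repeats itself no later than the first visit to `b`, cutting out the cycle gives
  -- an earlier visit.
  have key : ∀ i j, i < j → j ≤ Nat.find h → f^[i] a = f^[j] a → False := by
    intro i j hlt hj heq
    have h1 := Nat.find_spec h
    rw [show Nat.find h = (Nat.find h - j) + j by omega, Function.iterate_add_apply, ← heq,
      ← Function.iterate_add_apply] at h1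
    exact Nat.find_min h (m := Nat.find h - j + i) (by omega) h1
  simp only [Finset.mem_range] at hi hj
  rcases lt_or_gt_of_ne hne with hlt' | hlt'
  · exact key i j hlt' (by omega) hij
  · exact key j i hlt' (by omega) hij.symm

namespace CounterProg

variable {α : Type*} {m : ℕ}

/-- The iteration of a functional relation, which stays in place where the relation is
undefined. -/
noncomputable def advance {σ : Type*} (E : σ → σ → Prop) (c : σ) : σ :=
  open Classical in if h : ∃ d, E c d then h.choose else c

theorem advance_eq {σ : Type*} {E : σ → σ → Prop} (hE : ∀ c d d', E c d → E c d' → d = d')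
    {c d : σ} (h : E c d) : advance E c = d := by
  have h' : ∃ d, E c d := ⟨d, h⟩
  rw [advance, dif_pos h']
  exact hE _ _ _ h'.choose_spec h

theorem advance_eq_self {σ : Type*} {E : σ → σ → Prop} {c : σ} (h : ¬ ∃ d, E c d) :
    advance E c = c := by
  rw [advance, dif_neg h]

/-- Along a functional relation a path is an orbit. Standing still where the relation is undefined
adds no new points, since reachability is reflexive. -/
theorem reflTransGen_iff_iterate_advance {σ : Type*} {E : σ → σ → Prop}
    (hE : ∀ c d d', E c d → E c d' → d = d') {a b : σ} :
    Relation.ReflTransGen E a b ↔ ∃ t, (advance E)^[t] a = b := by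
  constructor
  · intro h
    induction h with
    | refl => exact ⟨0, rfl⟩
    | tail _ hcd ih =>
      obtain ⟨t, rfl⟩ := ih
      exact ⟨t + 1, by rw [Function.iterate_succ_apply', advance_eq hE hcd]⟩
  · rintro ⟨t, rfl⟩
    induction t with
    | zero => exact .refl
    | succ t ih =>
      rw [Function.iterate_succ_apply']
      by_cases h : ∃ d, E ((advance E)^[t] a) d
      · obtain ⟨d, hd⟩ := h
        rw [advance_eq hE hd]
        exact ih.tail hd
      · rwa [advance_eq_self h]

/-- Reachability within the pairs bounded by `N`, as a doubly bounded iteration. -/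
theorem reflTransGen_iff_iterate_lt {E : ℕ × ℕ → ℕ × ℕ → Prop} {N : ℕ}
    (hE : ∀ c d d', E c d → E c d' → d = d') (hN : ∀ c d, E c d → d.1 ≤ N ∧ d.2 ≤ N)
    {a b : ℕ × ℕ} (ha : a.1 ≤ N ∧ a.2 ≤ N) : Relation.ReflTransGen E a b ↔
      ∃ t < N + 1, ∃ u < N + 1, (advance E)^[u] (((advance E)^[N + 1])^[t] a) = b := by
  rw [reflTransGen_iff_iterate_advance hE]
  constructor
  · intro h
    obtain ⟨t, ht, h⟩ := Function.exists_iterate_lt_card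
      (Finset.range (N + 1) ×ˢ Finset.range (N + 1)) (a := a) (b := b) (f := advance E)
      (by simp; omega) (fun c hc => by
        by_cases h : ∃ d, E c d
        · obtain ⟨d, hd⟩ := h
          have := hN _ _ hd
          rw [advance_eq hE hd]
          simp
          omega
        · rwa [advance_eq_self h]) h
    rw [Finset.card_product, Finset.card_range] at ht
    -- A number of steps below `(N + 1)²` is split into quotient and remainder modulo `N + 1`, one
    -- for each of the two loops.
    refine ⟨t / (N + 1), Nat.div_lt_of_lt_mul ht, t % (N + 1), Nat.mod_lt _ (by omega), ?_⟩
    rw [← Function.iterate_mul, ← Function.iterate_add_apply, Nat.mod_add_div]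
    exact h
  · rintro ⟨t, -, u, -, h⟩
    rw [← Function.iterate_mul, ← Function.iterate_add_apply] at h
    exact ⟨_, h⟩

/-- Reachability along a functional relation on pairs of positions is decidable. -/
theorem Def.reach_last {E : List α → (Fin m → ℕ) → ℕ × ℕ → ℕ × ℕ → Prop}
    (hfun : ∀ x e c d d', E x e c d → E x e c d' → d = d')
    (hbd : ∀ x e c d, E x e c d → d.1 ≤ x.length ∧ d.2 ≤ x.length)
    (h : Def (m + 4) fun x e => E x (fun i => e (Fin.castAdd 4 i))
      (e (Fin.natAdd m 0), e (Fin.natAdd m 1)) (e (Fin.natAdd m 2), e (Fin.natAdd m 3))) :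
    Def (m + 4) fun x e => Relation.ReflTransGen (E x (fun i => e (Fin.castAdd 4 i)))
      (e (Fin.natAdd m 0), e (Fin.natAdd m 1)) (e (Fin.natAdd m 2), e (Fin.natAdd m 3)) := by
  intro L ρ
  -- Six variables are allotted beyond the `L` given ones: `L`, `L + 1` hold the current pair, `L +
  -- 2`, `L + 3` count the steps, and `L + 4`, `L + 5` receive a candidate successor. Variable `i`
  -- lives in counter `i + 2`.
  obtain ⟨p, hp⟩ := h (L + 4 + 1 + 1) (Fin.addCases
    (fun i => Fin.castLE (by omega) (ρ (Fin.castAdd 4 i)))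
    ![⟨L, by omega⟩, ⟨L + 1, by omega⟩, ⟨L + 4, by omega⟩, ⟨L + 5, by omega⟩])
  have hsearch := computes_search (computes_search hp)
  set find : CounterProg α α := search (L + 4 + 2) (search (L + 4 + 1 + 2) p)
  set tgt : Fin 2 → ℕ := fun i => ρ (Fin.natAdd m (Fin.natAdd 2 i)) + 2 with htgt
  set body : CounterProg α α :=
    seq (op (.eq (L + 2) (tgt 0))) (seq (ite (op (.eq (L + 3) (tgt 1))) skip)
      (ite skip (seq find (ite (seq (op (.copy (L + 2) (L + 6))) (seq (op (.copy (L + 3) (L + 7)))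
        (setAcc false .stay))) skip))))
  refine ⟨seq (op (.copy (L + 2) (ρ (Fin.natAdd m 0) + 2)))
    (seq (op (.copy (L + 3) (ρ (Fin.natAdd m 1) + 2)))
      (search (L + 2 + 2) (search (L + 2 + 1 + 2) body))), fun x s hs => ?_⟩
  set e := ctx L s.env with he
  set R : ℕ × ℕ → ℕ × ℕ → Prop := E x (fun i => e (ρ (Fin.castAdd 4 i)))
  set target : ℕ × ℕ := (e (ρ (Fin.natAdd m 2)), e (ρ (Fin.natAdd m 3)))
  have hR : ∀ c d d', R c d → R c d' → d = d' := hfun _ _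
  have hlt : ∀ i : Fin (m + 4), (ρ i : ℕ) < L := fun i => (ρ i).2
  -- One round: compare the current pair with the target; if they differ, look for a successor among
  -- all pairs and copy it over the current pair, or leave the pair alone if there is none.
  have hbody : Iterates L (L + 2 + 1 + 1) body x e (advance R) (· = target) := by
    intro t ht hte
    have ht0 : t.env (tgt 0) = target.1 := congrFun hte _
    have ht1 : t.env (tgt 1) = target.2 := congrFun hte _
    obtain ⟨pos, acc, hex, hacc⟩ : ∃ pos acc, Exec x
        (seq (op (.eq (L + 2) (tgt 0))) (ite (op (.eq (L + 3) (tgt 1))) skip))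
        t ⟨acc, pos, t.env, t.out⟩ ∧ (acc = true ↔ (t.env (L + 2), t.env (L + 3)) = target) := by
      have h1 := Exec.op (x := x) (.eq (L + 2) (tgt 0)) t (by simp)
      simp only [CounterOp.applyAcc, CounterOp.applyEnv, ht0] at h1
      by_cases hc : t.env (L + 2) = target.1
      · simp only [hc, decide_true] at h1
        have h2 := Exec.op (x := x) (.eq (L + 3) (tgt 1)) ⟨true, t.pos, t.env, t.out⟩ (by simp)
        simp only [CounterOp.applyAcc, CounterOp.applyEnv, ht1] at h2
        exact ⟨_, _, .seq h1 (.ite_true rfl h2), by simp [Prod.ext_iff, hc]⟩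
      · simp only [hc, decide_false] at h1
        exact ⟨_, false, .seq h1 (.ite_false rfl (exec_skip x _)), by simp [Prod.ext_iff, hc]⟩
    cases hex with
    | seq hex₁ hex₂ =>
    cases acc
    · simp only [Bool.false_eq_true, false_iff] at hacc
      obtain ⟨t', g1, g2, g3, g4, g5⟩ := hsearch x ⟨false, pos, t.env, t.out⟩ ht
      have hctx : ∀ a b : ℕ, (Fin.snoc (Fin.snoc (ctx (L + 4) t.env) a) b :
          Fin (L + 4 + 1 + 1) → ℕ) ∘ (Fin.addCases
            (fun i => Fin.castLE (by omega) (ρ (Fin.castAdd 4 i)))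
            ![⟨L, by omega⟩, ⟨L + 1, by omega⟩, ⟨L + 4, by omega⟩, ⟨L + 5, by omega⟩]) =
          Fin.addCases (fun i => e (ρ (Fin.castAdd 4 i)))
            ![t.env (L + 2), t.env (L + 3), a, b] := by
        intro a b
        funext i
        refine Fin.addCases (fun i => ?_) (fun i => ?_) i
        · have := hlt (Fin.castAdd 4 i)
          simp only [Function.comp_apply, Fin.addCases_left, Fin.snoc, Fin.val_castLE,
            Fin.castLT, cast_eq]
          rw [dif_pos (by omega), dif_pos (by omega), ← hte]
          rfl
        · fin_cases i <;> simp [Fin.snoc, ctx]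
      simp only [hctx, Fin.addCases_left, Fin.addCases_right] at g5
      have hE : ∀ i j, E x (fun i => e (ρ (Fin.castAdd 4 i)))
          (![t.env (L + 2), t.env (L + 3), i, j] 0, ![t.env (L + 2), t.env (L + 3), i, j] 1)
          (![t.env (L + 2), t.env (L + 3), i, j] 2, ![t.env (L + 2), t.env (L + 3), i, j] 3) =
          R (t.env (L + 2), t.env (L + 3)) (i, j) := fun _ _ => rfl
      simp only [hE] at g5
      cases hacc' : t'.acc
      · simp only [hacc', Bool.false_eq_true, if_false, false_iff, exists_const] at g5
        refine ⟨_, .seq hex₁ (.seq hex₂ (.ite_false rfl (.seq g1 (.ite_false hacc'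
          (exec_skip x _))))), g2, g3, fun i hi => g4 i (by omega), fun i hi hi' => g4 i (by omega),
          .inr ⟨hacc', hacc, ?_⟩⟩
        rw [advance_eq_self]
        · exact Prod.ext (g4 L (by omega)) (g4 (L + 1) (by omega))
        · rintro ⟨d, hd⟩
          exact g5 d.1 (hbd _ _ _ _ hd).1 d.2 (hbd _ _ _ _ hd).2 hd
      · simp only [hacc', if_true, true_iff] at g5
        obtain ⟨i, hi, hi', j, hj, hj', hij⟩ := g5
        have c1 := Exec.op (x := x) (.copy (L + 2) (L + 6)) t' (by simp)
        simp only [CounterOp.applyAcc, CounterOp.applyEnv] at c1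
        have c2 := Exec.op (x := x) (.copy (L + 3) (L + 7)) ⟨t'.acc, t'.pos,
          Function.update t'.env (L + 2) (t'.env (L + 6)), t'.out⟩ (by simp)
        simp only [CounterOp.applyAcc, CounterOp.applyEnv] at c2
        refine ⟨_, .seq hex₁ (.seq hex₂ (.ite_false rfl (.seq g1 (.ite_true hacc'
          (.seq c1 (.seq c2 (exec_setAcc x _ _ _))))))), ?_, g3, fun i hi => ?_, fun i hi hi' => ?_,
          .inr ⟨rfl, hacc, ?_⟩⟩
        · refine (g2.update (by omega) ?_).update (by omega) ?_
          · exact g2.2 _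
          · rw [Function.update_of_ne (by omega)]
            exact g2.2 _
        · dsimp only
          rw [Function.update_of_ne (by omega), Function.update_of_ne (by omega)]
          exact g4 i (by omega)
        · dsimp only
          rw [Function.update_of_ne (by omega), Function.update_of_ne (by omega)]
          exact g4 i (by omega)
        · rw [advance_eq hR hij]
          dsimp only
          rw [Function.update_of_ne (a := L + 2) (a' := L + 3) (by omega), Function.update_self,
            Function.update_self, Function.update_of_ne (by omega)]
          exact Prod.ext hi' hj'
    · simp only [true_iff] at hacc
      exact ⟨_, .seq hex₁ (.seq hex₂ (.ite_true rfl (exec_skip x _))), ht, rfl, fun _ _ => rfl,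
        fun _ _ _ => rfl, .inl ⟨rfl, hacc⟩⟩
  have hiter := (hbody.search (by omega)).search le_rfl
  have c1 := Exec.op (x := x) (.copy (L + 2) (ρ (Fin.natAdd m 0) + 2)) s (by simp)
  simp only [CounterOp.applyAcc, CounterOp.applyEnv] at c1
  have c2 := Exec.op (x := x) (.copy (L + 3) (ρ (Fin.natAdd m 1) + 2)) ⟨s.acc, s.pos,
    Function.update s.env (L + 2) (s.env (ρ (Fin.natAdd m 0) + 2)), s.out⟩ (by simp)
  simp only [CounterOp.applyAcc, CounterOp.applyEnv] at c2
  have hρ1 := hlt (Fin.natAdd m 1)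
  rw [Function.update_of_ne (by omega)] at c2
  have hg := (hs.update (v := L + 2) (by omega) (hs.2 (ρ (Fin.natAdd m 0) + 2))).update (v := L + 3)
    (by omega) (hs.2 (ρ (Fin.natAdd m 1) + 2))
  have hctx : ∀ i < L, Function.update (Function.update s.env (L + 2)
      (s.env (ρ (Fin.natAdd m 0) + 2))) (L + 3) (s.env (ρ (Fin.natAdd m 1) + 2)) (i + 2) =
        s.env (i + 2) := by
    intro i hi
    rw [Function.update_of_ne (by omega), Function.update_of_ne (by omega)]
  obtain ⟨s', g1, g2, g3, g4, -, g6⟩ := hiter ⟨s.acc, s.pos, Function.update (Function.update s.env (L + 2)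
      (s.env (ρ (Fin.natAdd m 0) + 2))) (L + 3) (s.env (ρ (Fin.natAdd m 1) + 2)), s.out⟩ hg
      (ctx_congr hctx)
  refine ⟨s', .seq c1 (.seq c2 g1), g2, g3, fun i hi => (g4 i hi).trans (hctx i hi), ?_⟩
  simp only [Function.comp_apply]
  rw [reflTransGen_iff_iterate_lt hR (hbd _ _) ⟨hs.2 _, hs.2 _⟩]
  simp only [Function.update_self, Function.update_of_ne (show L + 2 ≠ L + 3 by omega)] at g6
  rcases g6 with ⟨h1, h2⟩ | ⟨h1, h2, -⟩
  · exact iff_of_true h1 h2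
  · exact iff_of_false (by simp [h1]) h2

end CounterProg

namespace CounterProg

variable {α : Type*} {m : ℕ}

/-! ### Variables as terms -/

/-- `a` is the projection to one of the variables. -/
def IsVar (a : List α → (Fin m → ℕ) → ℕ) : Prop := ∃ i : Fin m, ∀ x e, a x e = e i

/-- Arguments are arbitrary terms that happen to be projections, not indices. Thus formulas can be
decomposed by `apply`, and each leaf is closed by `⟨_, fun _ _ => rfl⟩`. -/
theorem Def.vars {k : ℕ} {φ : List α → (Fin k → ℕ) → Prop} (h : Def k φ)
    {a : Fin k → List α → (Fin m → ℕ) → ℕ} (ha : ∀ i, IsVar (a i)) :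
    Def m fun x e => φ x fun i => a i x e := by
  choose ρ hρ using ha
  refine (h.subst ρ).congr fun x e _ => ?_
  have : (fun i => a i x e) = e ∘ ρ := funext fun i => hρ i x e
  rw [this]

section App

variable {a b c d p q r : List α → (Fin m → ℕ) → ℕ}

theorem Def.app1 {R : List α → ℕ → Prop} (h : Def 1 fun x e => R x (e 0)) (ha : IsVar a) :
    Def m fun x e => R x (a x e) :=
  h.vars (a := ![a]) (by simp [ha])

theorem Def.app2 {R : List α → ℕ → ℕ → Prop} (h : Def 2 fun x e => R x (e 0) (e 1))
    (ha : IsVar a) (hb : IsVar b) : Def m fun x e => R x (a x e) (b x e) :=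
  h.vars (a := ![a, b]) (by simp [Fin.forall_fin_succ, ha, hb])

theorem Def.app3 {R : List α → ℕ → ℕ → ℕ → Prop} (h : Def 3 fun x e => R x (e 0) (e 1) (e 2))
    (ha : IsVar a) (hb : IsVar b) (hc : IsVar c) :
    Def m fun x e => R x (a x e) (b x e) (c x e) :=
  h.vars (a := ![a, b, c]) (by simp [Fin.forall_fin_succ, ha, hb, hc])

theorem Def.app4 {R : List α → ℕ → ℕ → ℕ → ℕ → Prop}
    (h : Def 4 fun x e => R x (e 0) (e 1) (e 2) (e 3))
    (ha : IsVar a) (hb : IsVar b) (hc : IsVar c) (hd : IsVar d) :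
    Def m fun x e => R x (a x e) (b x e) (c x e) (d x e) :=
  h.vars (a := ![a, b, c, d]) (by simp [Fin.forall_fin_succ, ha, hb, hc, hd])

theorem Def.app5 {R : List α → ℕ → ℕ → ℕ → ℕ → ℕ → Prop}
    (h : Def 5 fun x e => R x (e 0) (e 1) (e 2) (e 3) (e 4))
    (ha : IsVar a) (hb : IsVar b) (hc : IsVar c) (hd : IsVar d) (hp : IsVar p) :
    Def m fun x e => R x (a x e) (b x e) (c x e) (d x e) (p x e) :=
  h.vars (a := ![a, b, c, d, p]) (by simp [Fin.forall_fin_succ, ha, hb, hc, hd, hp])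

theorem Def.app6 {R : List α → ℕ → ℕ → ℕ → ℕ → ℕ → ℕ → Prop}
    (h : Def 6 fun x e => R x (e 0) (e 1) (e 2) (e 3) (e 4) (e 5))
    (ha : IsVar a) (hb : IsVar b) (hc : IsVar c) (hd : IsVar d) (hp : IsVar p) (hq : IsVar q) :
    Def m fun x e => R x (a x e) (b x e) (c x e) (d x e) (p x e) (q x e) :=
  h.vars (a := ![a, b, c, d, p, q]) (by simp [Fin.forall_fin_succ, ha, hb, hc, hd, hp, hq])

theorem Def.add (ha : IsVar a) (hb : IsVar b) (hc : IsVar c) :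
    Def m fun x e => a x e + b x e = c x e :=
  .app3 (R := fun _ i j k => i + j = k) (.add_index 0 1 2) ha hb hc

theorem Def.eq (ha : IsVar a) (hb : IsVar b) : Def m fun x e => a x e = b x e :=
  .app2 (R := fun _ i j => i = j) (.eq_index 0 1) ha hb

theorem Def.get (g : Option α → Prop) (ha : IsVar a) : Def m fun x e => g (x[a x e]?) :=
  .app1 (R := fun x i => g (x[i]?)) (.get_index g 0) ha

theorem Def.le (ha : IsVar a) (hb : IsVar b) : Def m fun x e => a x e ≤ b x e := by
  refine .app2 (R := fun _ i j => i ≤ j) ?_ ha hb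
  refine Def.congr (φ := fun x e => ∃ k ≤ x.length, e 0 + k = e 1)
    (.ex (.add ⟨_, fun _ _ => rfl⟩ ⟨_, fun _ _ => rfl⟩ ⟨_, fun _ _ => rfl⟩)) fun x e he => ?_
  constructor
  · intro h
    exact ⟨e 1 - e 0, by have := he 1; omega, by omega⟩
  · rintro ⟨k, -, h⟩
    omega

theorem Def.lt (ha : IsVar a) (hb : IsVar b) : Def m fun x e => a x e < b x e :=
  (Def.le hb ha).not.congr fun _ _ _ => by simp

theorem Def.eqZero (ha : IsVar a) : Def m fun x e => a x e = 0 :=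
  (Def.add ha ha ha).congr fun _ _ _ => by omega

/-- There is no constant `1` to add, so the successor is described by the order: the larger number
with nothing in between. -/
theorem Def.succ (ha : IsVar a) (hb : IsVar b) : Def m fun x e => a x e + 1 = b x e := by
  refine .app2 (R := fun _ i j => i + 1 = j) ?_ ha hb
  refine Def.congr (φ := fun x e => e 0 < e 1 ∧ ∀ k ≤ x.length, k ≤ e 0 ∨ e 1 ≤ k)
    (.and (.lt ⟨_, fun _ _ => rfl⟩ ⟨_, fun _ _ => rfl⟩) (.all (.or
      (.le ⟨_, fun _ _ => rfl⟩ ⟨_, fun _ _ => rfl⟩) (.le ⟨_, fun _ _ => rfl⟩ ⟨_, fun _ _ => rfl⟩))))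
    fun x e he => ?_
  constructor
  · intro h
    exact ⟨by omega, fun k _ => by omega⟩
  · rintro ⟨h1, h2⟩
    have := he 1
    have := h2 (e 0 + 1) (by omega)
    omega

theorem Def.eqLength (ha : IsVar a) : Def m fun x e => a x e = x.length := by
  refine .app1 (R := fun x i => i = x.length) ?_ ha
  refine Def.congr (φ := fun x e => ∀ k ≤ x.length, k ≤ e 0)
    (.all (.le ⟨_, fun _ _ => rfl⟩ ⟨_, fun _ _ => rfl⟩)) fun x e he => ?_
  have := he 0
  exact ⟨fun h k hk => h ▸ hk, fun h => le_antisymm this (h _ le_rfl)⟩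

/-- Two parameters suffice for all applications: they carry the sizes `n` and `k` on which the
encoded types depend. -/
theorem Def.reach {E : List α → ℕ → ℕ → ℕ × ℕ → ℕ × ℕ → Prop}
    (hfun : ∀ x n k u v v', E x n k u v → E x n k u v' → v = v')
    (hbd : ∀ x n k u v, E x n k u v → v.1 ≤ x.length ∧ v.2 ≤ x.length)
    (h : Def 6 fun x e => E x (e 0) (e 1) (e 2, e 3) (e 4, e 5))
    (hp : IsVar p) (hq : IsVar q)
    (ha : IsVar a) (hb : IsVar b) (hc : IsVar c) (hd : IsVar d) :
    Def m fun x e => Relation.ReflTransGen (E x (p x e) (q x e)) (a x e, b x e) (c x e, d x e) :=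
  .app6 (R := fun x n k i j i' j' => Relation.ReflTransGen (E x n k) (i, j) (i', j'))
    (Def.reach_last (m := 2) (E := fun x e => E x (e 0) (e 1)) (fun x _ => hfun x _ _)
      (fun x _ => hbd x _ _) h) hp hq ha hb hc hd

end App

/-! ## Functions computed by counter programs -/

/-- `p` appends `g` to the output and preserves the first `L` variables. -/
def Outputs (L : ℕ) (p : CounterProg α α) (g : List α → (Fin L → ℕ) → List α) : Prop :=
  ∀ (x : List α) (s : CounterStore α), GoodEnv x s.env → ∃ s', Exec x p s s' ∧ GoodEnv x s'.env ∧
    (∀ i < L, s'.env (i + 2) = s.env (i + 2)) ∧ s'.out = s.out ++ g x (ctx L s.env)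

/-- The function `g` of `m` variables is output by a program, for every allocation of the
variables. -/
def Out (m : ℕ) (g : List α → (Fin m → ℕ) → List α) : Prop :=
  ∀ (L : ℕ) (ρ : Fin m → Fin L), ∃ p : CounterProg α α, Outputs L p fun x e => g x (e ∘ ρ)

variable {g g' : List α → (Fin m → ℕ) → List α}

theorem Out.congr (h : Out m g) (hg : ∀ x e, (∀ i, e i ≤ x.length) → g' x e = g x e) :
    Out m g' := by
  intro L ρ
  obtain ⟨p, hp⟩ := h L ρ
  refine ⟨p, fun x s hs => ?_⟩
  obtain ⟨s', h1, h2, h3, h4⟩ := hp x s hs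
  exact ⟨s', h1, h2, h3, h4.trans (congrArg (s.out ++ ·)
    (hg x (ctx L s.env ∘ ρ) fun i => hs.2 _).symm)⟩

theorem Out.vars {k : ℕ} {g : List α → (Fin k → ℕ) → List α} (h : Out k g)
    {a : Fin k → List α → (Fin m → ℕ) → ℕ} (ha : ∀ i, IsVar (a i)) :
    Out m fun x e => g x fun i => a i x e := by
  choose ρ hρ using ha
  refine Out.congr (g := fun x e => g x (e ∘ ρ)) (fun L σ => h L (σ ∘ ρ)) fun x e _ => ?_
  have : (fun i => a i x e) = e ∘ ρ := funext fun i => hρ i x e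
  rw [this]

theorem Out.nil : Out m fun (_ : List α) _ => [] := fun _ _ =>
  ⟨skip, fun x s hs => ⟨_, exec_skip x s, hs, fun _ _ => rfl, by simp⟩⟩

theorem Out.emit (c : α) : Out m fun (_ : List α) _ => [c] := fun _ _ =>
  ⟨pure fun _ _ => (false, .stay, some c), fun _ s hs =>
    ⟨_, .pure _ s false .stay (some c) rfl, hs, fun _ _ => rfl, rfl⟩⟩

theorem Out.append (h : Out m g) (h' : Out m g') : Out m fun x e => g x e ++ g' x e := by
  intro L ρ
  obtain ⟨p, hp⟩ := h L ρ
  obtain ⟨q, hq⟩ := h' L ρ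
  refine ⟨seq p q, fun x s hs => ?_⟩
  obtain ⟨s', h1, h2, h3, h4⟩ := hp x s hs
  obtain ⟨s'', g1, g2, g3, g4⟩ := hq x s' h2
  exact ⟨s'', .seq h1 g1, g2, fun i hi => (g3 i hi).trans (h3 i hi), by
    rw [g4, h4, ctx_congr h3, List.append_assoc]⟩

open Classical in
theorem Out.ite {φ : List α → (Fin m → ℕ) → Prop} (hφ : Def m φ) (h : Out m g) (h' : Out m g') :
    Out m fun x e => if φ x e then g x e else g' x e := by
  intro L ρ
  obtain ⟨r, hr⟩ := hφ L ρ
  obtain ⟨p, hp⟩ := h L ρ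
  obtain ⟨q, hq⟩ := h' L ρ
  refine ⟨seq r (CounterProg.ite p q), fun x s hs => ?_⟩
  obtain ⟨s₁, h1, h2, h3, h4, h5⟩ := hr x s hs
  cases hacc : s₁.acc
  · obtain ⟨s', g1, g2, g3, g4⟩ := hq x s₁ h2
    refine ⟨s', .seq h1 (.ite_false hacc g1), g2, fun i hi => (g3 i hi).trans (h4 i hi), ?_⟩
    dsimp only at h5 g4 ⊢
    rw [if_neg fun h => by simpa [hacc] using h5.2 h, g4, h3, ctx_congr h4]
  · obtain ⟨s', g1, g2, g3, g4⟩ := hp x s₁ h2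
    refine ⟨s', .seq h1 (.ite_true hacc g1), g2, fun i hi => (g3 i hi).trans (h4 i hi), ?_⟩
    dsimp only at h5 g4 ⊢
    rw [if_pos (h5.1 hacc), g4, h3, ctx_congr h4]

/-- A search whose body always reports failure runs through all values `0, …, |x|`, and the body
prints its contribution for each of them. -/
theorem Out.flatMapRange {g : List α → (Fin m → ℕ) → ℕ → List α}
    (h : Out (m + 1) fun x e => g x (Fin.init e) (e (Fin.last m))) :
    Out m fun x e => (List.range (x.length + 1)).flatMap (g x e) := by
  intro L ρ
  obtain ⟨p, hp⟩ := h (L + 1) (Fin.snoc (fun j => (ρ j).castSucc) (Fin.last L))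
  simp only at hp
  refine ⟨search (L + 2) (seq p (setAcc false .stay)), fun x s hs => ?_⟩
  refine (exec_search x (L + 2) (seq p (setAcc false .stay))
    (fun i env out => GoodEnv x env ∧ (∀ j < L, env (j + 2) = s.env (j + 2)) ∧
      env (L + 2) = i ∧ out = s.out ++ (List.range i).flatMap (g x (ctx L s.env ∘ ρ)))
    (fun b env out => GoodEnv x env ∧ (∀ j < L, env (j + 2) = s.env (j + 2)) ∧
      out = s.out ++ (List.range (x.length + 1)).flatMap (g x (ctx L s.env ∘ ρ))) ?_ s ?_).imp
      fun s' h => h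
  · rintro i hi t ⟨hg, hctx, hv, hout⟩
    obtain ⟨t', g1, g2, g3, g4⟩ := hp x t hg
    dsimp only at g4
    rw [ctx_succ, hv, ctx_congr hctx, snoc_comp_snoc, Fin.init_snoc, Fin.snoc_last] at g4
    have hout' : t'.out = s.out ++ (List.range (i + 1)).flatMap (g x (ctx L s.env ∘ ρ)) := by
      rw [g4, hout, List.range_succ]
      simp
    refine ⟨_, .seq g1 (exec_setAcc x _ _ _), (g3 L (by omega)).trans hv, g2.1, by simp,
      fun _ hlt => ⟨g2.update (by omega) hlt, fun j hj => ?_, by simp, hout'⟩, fun _ heq =>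
      ⟨g2, fun j hj => (g3 j (by omega)).trans (hctx j hj), heq ▸ hout'⟩⟩
    dsimp only
    rw [Function.update_of_ne (by omega), g3 j (by omega), hctx j hj]
  · refine ⟨hs.update (by omega) (Nat.zero_le _), fun j hj => ?_, by simp, by simp⟩
    rw [Function.update_of_ne (by omega)]

theorem Out.flatMapList {ι : Type*} {g : ι → List α → (Fin m → ℕ) → List α}
    (h : ∀ i, Out m (g i)) (l : List ι) : Out m fun x e => l.flatMap fun i => g i x e := by
  induction l with
  | nil => exact .nil
  | cons i l ih => exact ((h i).append ih).congr fun _ _ _ => by simp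

/-- Store the length of the input in counter `0`. -/
def countInput : CounterProg α α :=
  loop (seq (setAcc false .right)
    (seq (pure fun _ a => match a with
      | .right => (true, .stay, none)
      | _ => (false, .stay, none)) (CounterProg.ite skip (op (.inc 0)))))

theorem exec_countInput (x : List α) (n i : ℕ) (hi : i + n = x.length) (b : Bool) :
    Exec x countInput ⟨b, i, Function.update (fun _ => 0) 0 i, []⟩
      ⟨true, x.length + 1, Function.update (fun _ => 0) 0 x.length, []⟩ := by
  induction n generalizing i b with
  | zero =>
    obtain rfl : i = x.length := by omega
    have h1 := exec_setAcc x false .right ⟨b, x.length, Function.update (fun _ => 0) 0 x.length,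
      ([] : List α)⟩
    have h2 := Exec.pure (x := x) (β := α) (fun _ a => match a with
      | .right => (true, .stay, none)
      | _ => (false, .stay, none))
      ⟨false, x.length + 1, Function.update (fun _ => 0) 0 x.length, []⟩ true .stay none
      (by simp [inputSymbol_succ])
    have h3 := exec_skip x ⟨true, x.length + 1, Function.update (fun _ => 0) 0 x.length,
      ([] : List α)⟩
    simp only [HeadMove.apply, min_self, Option.toList_none, List.append_nil] at h1 h2 h3
    exact .loop_done (.seq h1 (.seq h2 (.ite_true rfl h3))) rfl
  | succ n ih =>
    have h1 := exec_setAcc x false .right ⟨b, i, Function.update (fun _ => 0) 0 i,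
      ([] : List α)⟩
    have h2 := Exec.pure (x := x) (β := α) (fun _ a => match a with
      | .right => (true, .stay, none)
      | _ => (false, .stay, none))
      ⟨false, i + 1, Function.update (fun _ => 0) 0 i, []⟩ false .stay none
      (by simp [inputSymbol_succ, List.getElem?_eq_getElem (show i < x.length by omega)])
    have h3 := Exec.op (x := x) (.inc 0) ⟨false, i + 1, Function.update (fun _ => 0) 0 i,
      ([] : List α)⟩ (by
        rintro v hv
        cases hv
        simp only [Function.update_self]
        omega)
    simp only [HeadMove.apply, min_eq_left (show i + 1 ≤ x.length + 1 by omega),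
      Option.toList_none, List.append_nil, CounterOp.applyAcc, CounterOp.applyEnv,
      Function.update_self, Function.update_idem] at h1 h2 h3
    exact .loop_next (.seq h1 (.seq h2 (.ite_false rfl h3))) rfl (ih (i + 1) (by omega) false)

/-- Functions output by counter programs are computable in logarithmic space. -/
theorem Out.logSpaceComputable {f : List α → List α}
    (h : Out 0 fun (x : List α) (_ : Fin 0 → ℕ) => f x) : LogSpaceComputable f := by
  obtain ⟨p, hp⟩ := h 0 Fin.elim0
  refine CounterProg.logSpaceComputable (seq countInput p) f fun x => ?_
  have h1 := exec_countInput x x.length 0 (by simp) false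
  rw [Function.update_eq_self_iff.2 rfl] at h1
  obtain ⟨s', g1, -, -, g4⟩ := hp x ⟨true, x.length + 1, Function.update (fun _ => 0) 0 x.length,
    []⟩ ⟨by simp, fun v => by
      simp only [Function.update_apply]
      split_ifs <;> simp⟩
  exact ⟨s', .seq h1 g1, by simpa using g4⟩

end CounterProg

/-! ## Prefix codes and segments of words -/

section PrefixCode

variable {α Γ τ : Type*}

/-- The codes of `enc` can be read off uniquely from the left. -/
def IsPrefixCode (enc : τ → List α) : Prop :=
  ∀ t t' u u', enc t ++ u = enc t' ++ u' → t = t' ∧ u = u'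

/-- The codes of `enc` are nonempty and do not start with a semicolon. -/
def AvoidsSemicolon (enc : τ → List (DSym Γ)) : Prop :=
  ∀ t u u', enc t ++ u ≠ DSym.semicolon :: u'

theorem isPrefixCode_encNum : IsPrefixCode (encNum : ℕ → List (DSym Γ)) := by
  intro m
  induction m with
  | zero =>
    intro m' u u' h
    cases m' with
    | zero => simpa [encNum] using h
    | succ m' => simp [encNum, List.replicate_succ] at h
  | succ m ih =>
    intro m' u u' h
    cases m' with
    | zero => simp [encNum, List.replicate_succ] at h
    | succ m' =>
      have := ih m' u u' (by simpa [encNum, List.replicate_succ] using h)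
      exact ⟨congrArg _ this.1, this.2⟩

theorem avoidsSemicolon_encNum : AvoidsSemicolon (encNum : ℕ → List (DSym Γ)) := by
  intro m u u'
  cases m <;> simp [encNum, List.replicate_succ]

theorem isPrefixCode_encNum_fin {n : ℕ} :
    IsPrefixCode (fun s : Fin n => (encNum s : List (DSym Γ))) := fun t t' u u' h => by
  have := isPrefixCode_encNum _ _ _ _ h
  exact ⟨Fin.ext this.1, this.2⟩

theorem avoidsSemicolon_encNum_fin {n : ℕ} :
    AvoidsSemicolon (fun s : Fin n => (encNum s : List (DSym Γ))) := fun t =>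
  avoidsSemicolon_encNum (t : ℕ)

/-- The closing semicolon cannot be mistaken for the beginning of a further code, so both lists end
at the same place. -/
theorem IsPrefixCode.encList {enc : τ → List (DSym Γ)} (h : IsPrefixCode enc)
    (h' : AvoidsSemicolon enc) : IsPrefixCode (encList enc) := by
  intro l
  induction l with
  | nil =>
    intro l' u u' heq
    cases l' with
    | nil => simpa [_root_.encList] using heq
    | cons t l' =>
      simp only [_root_.encList, List.flatMap_nil, List.nil_append, List.flatMap_cons,
        List.append_assoc, List.singleton_append] at heq
      exact absurd heq.symm (h' _ _ _)
  | cons t l ih =>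
    intro l' u u' heq
    cases l' with
    | nil =>
      simp only [_root_.encList, List.flatMap_nil, List.nil_append, List.flatMap_cons,
        List.append_assoc, List.singleton_append] at heq
      exact absurd heq (h' _ _ _)
    | cons t' l' =>
      simp only [_root_.encList, List.flatMap_cons, List.append_assoc] at heq
      obtain ⟨rfl, heq⟩ := h _ _ _ _ heq
      obtain ⟨rfl, rfl⟩ := ih l' u u' (by simpa [_root_.encList] using heq)
      exact ⟨rfl, rfl⟩

theorem isPrefixCode_encRead {k : ℕ} :
    IsPrefixCode (encRead : Option (Endmarked (Fin k)) → List (DSym Γ)) := by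
  have hnum : ∀ (i : ℕ) (u u' : List (DSym Γ)) (c : DSym Γ), c ≠ .tick → c ≠ .comma →
      encNum i ++ u ≠ c :: u' := by
    intro i u u' c h1 h2
    cases i <;> simp [encNum, List.replicate_succ, h1.symm, h2.symm]
  rintro (_ | _ | _ | i) (_ | _ | _ | j) u u' h <;>
    simp only [encRead, List.singleton_append, List.cons.injEq, reduceCtorEq, false_and,
      true_and] at h
  case none.none => exact ⟨rfl, h⟩
  case some.left.some.left => exact ⟨rfl, h⟩
  case some.right.some.right => exact ⟨rfl, h⟩
  case some.letter.some.letter =>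
    obtain ⟨h1, h2⟩ := isPrefixCode_encNum _ _ _ _ h
    exact ⟨by rw [Fin.ext h1], h2⟩
  all_goals first
    | exact absurd h (hnum _ _ _ _ (by simp) (by simp))
    | exact absurd h.symm (hnum _ _ _ _ (by simp) (by simp))

variable {W Q R : Type*}

/-- The code of the letter `a` of a word over the write alphabet. -/
def encLetter (a : W) : List (DSym (PLetter W Q R)) := [DSym.letter (PLetter.wr a)]

theorem isPrefixCode_encLetter : IsPrefixCode (encLetter (W := W) (Q := Q) (R := R)) := by
  intro a b u u' h
  simpa [encLetter] using h

theorem avoidsSemicolon_encLetter : AvoidsSemicolon (encLetter (W := W) (Q := Q) (R := R)) := by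
  intro a u u'
  simp [encLetter]

theorem isPrefixCode_encWriteRule {n k : ℕ} :
    IsPrefixCode (encWriteRule (W := W) (Q := Q) (R := R) (n := n) (k := k)) := by
  rintro ⟨s, r, w, t⟩ ⟨s', r', w', t'⟩ u u' h
  simp only [encWriteRule, List.append_assoc] at h
  obtain ⟨h1, h'⟩ := isPrefixCode_encNum_fin _ _ _ _ h
  obtain ⟨h2, h''⟩ := isPrefixCode_encRead _ _ _ _ h'
  obtain ⟨h3, h'''⟩ := isPrefixCode_encLetter.encList avoidsSemicolon_encLetter _ _ _ _ h''
  obtain ⟨h4, h5⟩ := isPrefixCode_encNum_fin _ _ _ _ h'''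
  simp only [h1, h2, h3, h4, h5, and_true]

theorem avoidsSemicolon_encWriteRule {n k : ℕ} :
    AvoidsSemicolon (encWriteRule (W := W) (Q := Q) (R := R) (n := n) (k := k)) := by
  intro t u u'
  simp only [encWriteRule, List.append_assoc]
  exact avoidsSemicolon_encNum _ _ _

theorem isPrefixCode_encQueryRule {n : ℕ} :
    IsPrefixCode (encQueryRule (W := W) (Q := Q) (R := R) (n := n)) := by
  rintro ⟨s, q, r, t⟩ ⟨s', q', r', t'⟩ u u' h
  simp only [encQueryRule, List.append_assoc] at h
  obtain ⟨h1, h'⟩ := isPrefixCode_encNum_fin _ _ _ _ h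
  simp only [List.cons_append, List.cons.injEq, DSym.letter.injEq, PLetter.query.injEq,
    PLetter.resp.injEq, List.nil_append] at h'
  obtain ⟨h2, h3, h''⟩ := h'
  obtain ⟨h4, h5⟩ := isPrefixCode_encNum_fin _ _ _ _ h''
  simp only [h1, h2, h3, h4, h5, and_true]

theorem avoidsSemicolon_encQueryRule {n : ℕ} :
    AvoidsSemicolon (encQueryRule (W := W) (Q := Q) (R := R) (n := n)) := by
  intro t u u'
  simp only [encQueryRule, List.append_assoc]
  exact avoidsSemicolon_encNum _ _ _

end PrefixCode

/-! ### Words carried by segments between two positions -/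

section Seg

variable {α Γ τ : Type*} {x : List α} {p q : ℕ}

/-- The positions `p, …, q - 1` of `x` carry the word `w`. -/
def Seg (x : List α) (p : ℕ) (w : List α) (q : ℕ) : Prop :=
  ∃ u v, x = u ++ w ++ v ∧ u.length = p ∧ p + w.length = q

theorem Seg.le_length {w : List α} (h : Seg x p w q) : q ≤ x.length := by
  obtain ⟨u, v, rfl, rfl, rfl⟩ := h
  simp

theorem Seg.add_eq {w : List α} (h : Seg x p w q) : p + w.length = q := by
  obtain ⟨u, v, rfl, rfl, rfl⟩ := h
  rfl

theorem Seg.le {w : List α} (h : Seg x p w q) : p ≤ q := by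
  have := h.add_eq
  omega

theorem seg_nil : Seg x p [] q ↔ p = q ∧ q ≤ x.length := by
  constructor
  · intro h
    exact ⟨h.add_eq, h.le_length⟩
  · rintro ⟨rfl, h⟩
    exact ⟨x.take p, x.drop p, by simp, by simpa using h, rfl⟩

/-- Concatenation becomes an existential quantifier over an intermediate position. This turns the
format of descriptions into formulas about positions. -/
theorem seg_append {w w' : List α} :
    Seg x p (w ++ w') q ↔ ∃ r, Seg x p w r ∧ Seg x r w' q := by
  constructor
  · rintro ⟨u, v, rfl, rfl, rfl⟩
    exact ⟨u.length + w.length, ⟨u, w' ++ v, by simp, rfl, rfl⟩,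
      ⟨u ++ w, v, by simp, by simp, by simp; omega⟩⟩
  · rintro ⟨r, ⟨u, v, hx, rfl, rfl⟩, ⟨u', v', hx', hu', rfl⟩⟩
    have : u ++ w = u' := by
      have h1 : u ++ w <+: x := ⟨v, hx.symm⟩
      have h2 : u' <+: x := ⟨w' ++ v', by rw [hx']; simp⟩
      exact (List.prefix_of_prefix_length_le h1 h2 (by simp; omega)).eq_of_length (by simp; omega)
    subst this
    exact ⟨u, v', by rw [hx']; simp, rfl, by simp; omega⟩

theorem seg_singleton {c : α} : Seg x p [c] q ↔ x[p]? = some c ∧ p + 1 = q := by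
  constructor
  · rintro ⟨u, v, rfl, rfl, rfl⟩
    simp
  · rintro ⟨h, rfl⟩
    obtain ⟨hp, h⟩ := List.getElem?_eq_some_iff.1 h
    refine ⟨x.take p, x.drop (p + 1), ?_, by simp; omega, rfl⟩
    rw [← h]
    simp

theorem Seg.unique {w w' : List α} (h : Seg x p w q) (h' : Seg x p w' q) : w = w' := by
  obtain ⟨u, v, rfl, rfl, rfl⟩ := h
  obtain ⟨u', v', hx, hu, hl⟩ := h'
  rw [List.append_assoc, List.append_assoc] at hx
  obtain ⟨-, hx⟩ := List.append_inj hx hu.symm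
  exact (List.append_inj hx (by omega)).1

theorem Seg.exists_drop {w : List α} (h : Seg x p w q) : ∃ v, x.drop p = w ++ v ∧ x.drop q = v := by
  obtain ⟨u, v, rfl, rfl, rfl⟩ := h
  exact ⟨v, by simp, by rw [← List.drop_drop]; simp⟩

theorem seg_zero_length {w : List α} : Seg x 0 w x.length ↔ x = w := by
  constructor
  · rintro ⟨u, v, hx, hu, hl⟩
    obtain rfl := List.length_eq_zero_iff.1 hu
    have := congrArg List.length hx
    have hv : v.length = 0 := by simp at this; omega
    obtain rfl := List.length_eq_zero_iff.1 hv
    simpa using hx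
  · rintro rfl
    exact ⟨[], [], by simp, rfl, by simp⟩

theorem IsPrefixCode.seg {enc : τ → List α} (h : IsPrefixCode enc) {t t' : τ} {q' : ℕ}
    (h1 : Seg x p (enc t) q) (h2 : Seg x p (enc t') q') : t = t' ∧ q = q' := by
  obtain ⟨v, hv, -⟩ := h1.exists_drop
  obtain ⟨v', hv', -⟩ := h2.exists_drop
  obtain ⟨rfl, -⟩ := h _ _ _ _ (hv.symm.trans hv')
  exact ⟨rfl, h1.add_eq.symm.trans h2.add_eq⟩

theorem AvoidsSemicolon.seg {x : List (DSym Γ)} {enc : τ → List (DSym Γ)} (h : AvoidsSemicolon enc)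
    {t : τ} (h1 : Seg x p (enc t) q) : x[p]? ≠ some .semicolon := by
  intro h2
  obtain ⟨v, hv, -⟩ := h1.exists_drop
  obtain ⟨v', hv', -⟩ := (seg_singleton.2 ⟨h2, rfl⟩).exists_drop
  exact h t v v' (hv.symm.trans hv')

/-- A segment all of whose letters satisfy a condition. -/
theorem exists_seg_map {f : τ → α} : (∃ l : List τ, Seg x p (l.map f) q) ↔
    p ≤ q ∧ q ≤ x.length ∧ ∀ i ≤ x.length, p ≤ i → i < q → ∃ t, x[i]? = some (f t) := by
  constructor
  · rintro ⟨l, u, v, rfl, rfl, rfl⟩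
    refine ⟨by omega, by simp, fun i _ hi hi' => ?_⟩
    obtain ⟨j, rfl⟩ := Nat.exists_eq_add_of_le hi
    have hj : j < l.length := by simpa using hi'
    refine ⟨l[j], ?_⟩
    simp [List.getElem?_append_right, List.getElem?_append_left, hj]
  · rintro ⟨h1, h2, h3⟩
    obtain ⟨d, rfl⟩ := Nat.exists_eq_add_of_le h1
    induction d with
    | zero => exact ⟨[], seg_nil.2 ⟨rfl, h2⟩⟩
    | succ d ih =>
      obtain ⟨l, hl⟩ := ih (by omega) (by omega) fun i hi hi' hi'' => h3 i hi hi' (by omega)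
      obtain ⟨t, ht⟩ := h3 (p + d) (by omega) (by omega) (by omega)
      refine ⟨l ++ [t], ?_⟩
      rw [List.map_append, seg_append]
      exact ⟨_, hl, seg_singleton.2 ⟨ht, rfl⟩⟩

/-- A numeral is the distance to its comma. In particular every number encoded in `x` is bounded by
`|x|` and fits into a counter. -/
theorem seg_encNum {x : List (DSym Γ)} {m : ℕ} : Seg x p (encNum m) q ↔
    ∃ r ≤ x.length, p + m = r ∧ (∀ i ≤ x.length, p ≤ i → i < r → x[i]? = some .tick) ∧
      x[r]? = some .comma ∧ r + 1 = q := by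
  rw [encNum, seg_append]
  constructor
  · rintro ⟨r, h1, h2⟩
    obtain ⟨h3, rfl⟩ := seg_singleton.1 h2
    have := (exists_seg_map (f := fun _ : Unit => (DSym.tick : DSym Γ)) (x := x) (p := p)
      (q := r)).1 ⟨List.replicate m (), by simpa using h1⟩
    exact ⟨r, h1.le_length, by simpa using h1.add_eq, fun i hi h h' => by
      simpa using this.2.2 i hi h h', h3, rfl⟩
  · rintro ⟨r, hr, hm, h1, h2, rfl⟩
    obtain ⟨l, hl⟩ := (exists_seg_map (f := fun _ : Unit => (DSym.tick : DSym Γ)) (x := x) (p := p)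
      (q := r)).2 ⟨by omega, hr, fun i hi h h' => ⟨(), h1 i hi h h'⟩⟩
    refine ⟨r, ?_, seg_singleton.2 ⟨h2, rfl⟩⟩
    have hlen := hl.add_eq
    rw [List.length_map] at hlen
    obtain rfl : m = l.length := by omega
    simpa using hl

/-- The elements of a list that is encoded at the position `r` are determined. -/
theorem exists_append_of_seg {x : List (DSym Γ)} {enc : τ → List (DSym Γ)} (h : IsPrefixCode enc)
    (h' : AvoidsSemicolon enc) {l l₁ : List τ} {t : τ} {r r' : ℕ}
    (hl : Seg x r (encList enc l) r') (hl₁ : Seg x r (l₁.flatMap enc) p) (ht : Seg x p (enc t) q) :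
    ∃ l₂, l = l₁ ++ t :: l₂ := by
  induction l₁ generalizing l r with
  | nil =>
    obtain ⟨rfl, -⟩ := seg_nil.1 hl₁
    rcases l with _ | ⟨t', l⟩
    · have := seg_singleton.1 hl
      exact absurd this.1 (h'.seg ht)
    · rw [encList, List.flatMap_cons, List.append_assoc, seg_append] at hl
      obtain ⟨r₁, h1, -⟩ := hl
      obtain ⟨rfl, -⟩ := h.seg ht h1
      exact ⟨l, rfl⟩
  | cons t₁ l₁ ih =>
    rw [List.flatMap_cons, seg_append] at hl₁
    obtain ⟨r₂, h2, h3⟩ := hl₁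
    rcases l with _ | ⟨t', l⟩
    · have := seg_singleton.1 hl
      exact absurd this.1 (h'.seg h2)
    · rw [encList, List.flatMap_cons, List.append_assoc, seg_append] at hl
      obtain ⟨r₁, h1, hl⟩ := hl
      obtain ⟨rfl, rfl⟩ := h.seg h1 h2
      obtain ⟨l₂, rfl⟩ := ih (l := l) hl h3
      exact ⟨l₂, rfl⟩

theorem seg_encList {x : List (DSym Γ)} {enc : τ → List (DSym Γ)} {l : List τ} {r r' : ℕ} :
    Seg x r (encList enc l) r' ↔
      ∃ p, Seg x r (l.flatMap enc) p ∧ x[p]? = some .semicolon ∧ p + 1 = r' := by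
  simp only [encList, seg_append, seg_singleton]

theorem exists_seg_of_mem {x : List (DSym Γ)} {enc : τ → List (DSym Γ)} {l : List τ} {t : τ}
    {r r' : ℕ} (hl : Seg x r (encList enc l) r') (ht : t ∈ l) :
    ∃ l₁ l₂ p q, l = l₁ ++ t :: l₂ ∧ Seg x r (l₁.flatMap enc) p ∧ Seg x p (enc t) q := by
  obtain ⟨l₁, l₂, rfl⟩ := List.append_of_mem ht
  obtain ⟨p, h, -⟩ := seg_encList.1 hl
  rw [List.flatMap_append, List.flatMap_cons, seg_append] at h
  obtain ⟨p, h1, h2⟩ := h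
  obtain ⟨q, h3, -⟩ := seg_append.1 h2
  exact ⟨l₁, l₂, p, q, rfl, h1, h3⟩

end Seg

namespace CounterProg

/-! ## Deciding the components of descriptions -/

section Basic

variable {α Γ : Type*} {m : ℕ}

theorem Def.sym {a : List α → (Fin m → ℕ) → ℕ} (c : α) (ha : IsVar a) :
    Def m fun x e => x[a x e]? = some c :=
  .get (· = some c) ha

theorem Def.segSym {a b : List α → (Fin m → ℕ) → ℕ} (c : α) (ha : IsVar a) (hb : IsVar b) :
    Def m fun x e => Seg x (a x e) [c] (b x e) :=
  ((Def.sym c ha).and (.succ ha hb)).congr fun _ _ _ => seg_singleton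

variable {a b c d : List (DSym Γ) → (Fin m → ℕ) → ℕ}

theorem Def.segNum (ha : IsVar a) (hb : IsVar b) (hc : IsVar c) :
    Def m fun x e => Seg x (a x e) (encNum (b x e)) (c x e) := by
  refine .app3 (R := fun x p n q => Seg x p (encNum n) q) ?_ ha hb hc
  refine Def.congr (φ := fun x e => ∃ r ≤ x.length, e 0 + e 1 = r ∧
    (∀ i ≤ x.length, e 0 ≤ i → i < r → x[i]? = some .tick) ∧ x[r]? = some .comma ∧ r + 1 = e 2) ?_
    fun x e _ => seg_encNum
  repeat' first
    | exact ⟨_, fun _ _ => rfl⟩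
    | apply Def.ex | apply Def.all | apply Def.succ | apply Def.add | apply Def.lt | apply Def.le
    | apply Def.sym | apply Def.and | apply Def.imp

theorem Def.segNumFin (ha : IsVar a) (hb : IsVar b) (hc : IsVar c) :
    Def m fun x e => ∃ s : Fin (a x e), Seg x (b x e) (encNum s) (c x e) := by
  refine .app3 (R := fun x n p q => ∃ s : Fin n, Seg x p (encNum s) q) ?_ ha hb hc
  refine Def.congr (φ := fun x e => ∃ s ≤ x.length, s < e 0 ∧ Seg x (e 1) (encNum s) (e 2)) ?_
    fun x e he => ?_
  · repeat' first
      | exact ⟨_, fun _ _ => rfl⟩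
      | apply Def.ex | apply Def.lt | apply Def.segNum | apply Def.and
  · constructor
    · rintro ⟨s, h⟩
      exact ⟨s, by have := s.2; have := he 0; omega, s.2, h⟩
    · rintro ⟨s, -, h, h'⟩
      exact ⟨⟨s, h⟩, h'⟩

theorem Def.segRead (ha : IsVar a) (hb : IsVar b) (hc : IsVar c) :
    Def m fun x e => ∃ r : Option (Endmarked (Fin (a x e))),
      Seg x (b x e) (encRead r) (c x e) := by
  refine .app3 (R := fun x k p q => ∃ r : Option (Endmarked (Fin k)), Seg x p (encRead r) q) ?_
    ha hb hc
  refine Def.congr (φ := fun x e => (Seg x (e 1) [.eps] (e 2) ∨ Seg x (e 1) [.left] (e 2)) ∨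
    (Seg x (e 1) [.right] (e 2) ∨ ∃ i : Fin (e 0), Seg x (e 1) (encNum i) (e 2))) ?_
    fun x e _ => ?_
  · repeat' first
      | exact ⟨_, fun _ _ => rfl⟩
      | apply Def.segSym | apply Def.segNumFin | apply Def.or
  · constructor
    · rintro ⟨_ | _ | _ | i, h⟩
      · exact .inl (.inl h)
      · exact .inl (.inr h)
      · exact .inr (.inl h)
      · exact .inr (.inr ⟨i, h⟩)
    · rintro ((h | h) | (h | ⟨i, h⟩))
      · exact ⟨none, h⟩
      · exact ⟨some .left, h⟩
      · exact ⟨some .right, h⟩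
      · exact ⟨some (.letter i), h⟩

/-- Lists of codes of a prefix code are decidable, if the codes are. -/
theorem Def.segFlatMap {τ : ℕ → ℕ → Type*} {enc : ∀ n k, τ n k → List (DSym Γ)}
    (henc : ∀ n k, IsPrefixCode (enc n k))
    (h : Def 4 fun x e => ∃ t : τ (e 0) (e 1), Seg x (e 2) (enc (e 0) (e 1) t) (e 3))
    (ha : IsVar a) (hb : IsVar b) (hc : IsVar c) (hd : IsVar d) :
    Def m fun x e => ∃ l : List (τ (a x e) (b x e)), Seg x (c x e) (l.flatMap (enc _ _)) (d x e) := by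
  refine .app4 (R := fun x n k p q => ∃ l : List (τ n k), Seg x p (l.flatMap (enc n k)) q) ?_
    ha hb hc hd
  -- An edge leads from the beginning of a code to its end, which is unique for a prefix code; lists
  -- of codes are the paths. Reachability is available for pairs, so the second component is kept at
  -- `0`.
  let E : List (DSym Γ) → ℕ → ℕ → ℕ × ℕ → ℕ × ℕ → Prop := fun x n k u v =>
    (∃ t : τ n k, Seg x u.1 (enc n k t) v.1) ∧ v.2 = 0
  refine Def.congr (φ := fun x e => ∃ z ≤ x.length, z = 0 ∧
    Relation.ReflTransGen (E x (e 0) (e 1)) (e 2, z) (e 3, z)) ?_ fun x e he => ?_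
  · refine .ex (.and (.eqZero ⟨_, fun _ _ => rfl⟩) (.reach (E := E) ?_ ?_ ?_ ⟨_, fun _ _ => rfl⟩
      ⟨_, fun _ _ => rfl⟩ ⟨_, fun _ _ => rfl⟩ ⟨_, fun _ _ => rfl⟩ ⟨_, fun _ _ => rfl⟩
      ⟨_, fun _ _ => rfl⟩))
    · rintro x n k u v v' ⟨⟨t, h1⟩, h2⟩ ⟨⟨t', h1'⟩, h2'⟩
      exact Prod.ext ((henc n k).seg h1 h1').2 (h2.trans h2'.symm)
    · rintro x n k u v ⟨⟨t, h1⟩, h2⟩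
      exact ⟨h1.le_length, h2 ▸ Nat.zero_le _⟩
    · exact .and (.app4 (R := fun x n k p q => ∃ t : τ n k, Seg x p (enc n k t) q) h
        ⟨_, fun _ _ => rfl⟩ ⟨_, fun _ _ => rfl⟩ ⟨_, fun _ _ => rfl⟩ ⟨_, fun _ _ => rfl⟩)
        (.eqZero ⟨_, fun _ _ => rfl⟩)
  · constructor
    · rintro ⟨l, hl⟩
      refine ⟨0, Nat.zero_le _, rfl, ?_⟩
      have hp := he 2
      generalize e 2 = p at *
      induction l generalizing p with
      | nil =>
        rw [(seg_nil.1 hl).1]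
      | cons t l ih =>
        rw [List.flatMap_cons, seg_append] at hl
        obtain ⟨r, h1, h2⟩ := hl
        exact .head (b := (r, 0)) ⟨⟨t, h1⟩, rfl⟩ (ih r h2 h1.le_length)
    · rintro ⟨z, -, rfl, hreach⟩
      suffices H : ∀ v, Relation.ReflTransGen (E x (e 0) (e 1)) (e 2, 0) v →
          ∃ l : List (τ (e 0) (e 1)), Seg x (e 2) (l.flatMap (enc _ _)) v.1 from H _ hreach
      intro v hv
      induction hv with
      | refl => exact ⟨[], seg_nil.2 ⟨rfl, he 2⟩⟩
      | tail _ hstep ih =>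
        obtain ⟨l, hl⟩ := ih
        obtain ⟨⟨t, ht⟩, -⟩ := hstep
        exact ⟨l ++ [t], by rw [List.flatMap_append, seg_append]; exact ⟨_, hl, by simpa using ht⟩⟩

theorem Def.segEncList {τ : ℕ → ℕ → Type*} {enc : ∀ n k, τ n k → List (DSym Γ)}
    (henc : ∀ n k, IsPrefixCode (enc n k))
    (h : Def 4 fun x e => ∃ t : τ (e 0) (e 1), Seg x (e 2) (enc (e 0) (e 1) t) (e 3))
    (ha : IsVar a) (hb : IsVar b) (hc : IsVar c) (hd : IsVar d) :
    Def m fun x e => ∃ l : List (τ (a x e) (b x e)), Seg x (c x e) (encList (enc _ _) l) (d x e) := by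
  refine .app4 (R := fun x n k p q => ∃ l : List (τ n k), Seg x p (encList (enc n k) l) q) ?_
    ha hb hc hd
  refine Def.congr (φ := fun x e => ∃ r ≤ x.length,
    (∃ l : List (τ (e 0) (e 1)), Seg x (e 2) (l.flatMap (enc (e 0) (e 1))) r) ∧
      Seg x r [.semicolon] (e 3)) ?_ fun x e _ => ?_
  · exact .ex (.and (.segFlatMap henc h ⟨_, fun _ _ => rfl⟩ ⟨_, fun _ _ => rfl⟩
      ⟨_, fun _ _ => rfl⟩ ⟨_, fun _ _ => rfl⟩) (.segSym _ ⟨_, fun _ _ => rfl⟩ ⟨_, fun _ _ => rfl⟩))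
  · simp only [encList, seg_append]
    constructor
    · rintro ⟨l, r, h1, h2⟩
      exact ⟨r, h1.le_length, ⟨l, h1⟩, h2⟩
    · rintro ⟨r, -, ⟨l, h1⟩, h2⟩
      exact ⟨l, r, h1, h2⟩

theorem Def.segLetters {ι : Type*} [Finite ι] (f : ι → α) {a b : List α → (Fin m → ℕ) → ℕ}
    (ha : IsVar a) (hb : IsVar b) :
    Def m fun x e => ∃ l : List ι, Seg x (a x e) (l.map f) (b x e) := by
  refine .app2 (R := fun x p q => ∃ l : List ι, Seg x p (l.map f) q) ?_ ha hb
  refine Def.congr (φ := fun x e => e 0 ≤ e 1 ∧ ∀ i ≤ x.length, e 0 ≤ i → i < e 1 →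
    ∃ t, x[i]? = some (f t)) ?_ fun x e he => ?_
  · repeat' first
      | exact ⟨_, fun _ _ => rfl⟩
      | apply Def.all | apply Def.lt | apply Def.le | apply Def.sym | apply Def.and | apply Def.imp
      | (apply Def.existsFinite; intro)
  · rw [exists_seg_map]
    exact ⟨fun h => ⟨h.1, h.2.2⟩, fun h => ⟨h.1, he 1, h.2⟩⟩

end Basic

end CounterProg

/-! ## The components of a description, located by positions -/

section Layout

variable {W Q R : Type*}

/-- The codes of states or input letters. -/
def encFin {Γ : Type*} (n : ℕ) (s : Fin n) : List (DSym Γ) := encNum s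

variable (x : List (DSym (PLetter W Q R)))

/-- The numbers `n`, `k` of states and of input letters are encoded before `p`. -/
def AfterSizes (n k p : ℕ) : Prop := ∃ r, Seg x 0 (encNum n) r ∧ Seg x r (encNum k) p

/-- The listing of the query states starts at `p`. -/
def QueryStatesAt (n k p : ℕ) : Prop := ∃ r, AfterSizes x n k r ∧ ∃ s : Fin n, Seg x r (encNum s) p

/-- The listing of the final states starts at `p`. -/
def FinalStatesAt (n k p : ℕ) : Prop :=
  ∃ r, QueryStatesAt x n k r ∧ ∃ l : List (Fin n), Seg x r (encList (encFin n) l) p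

/-- The listing of the write rules starts at `p`. -/
def WriteRulesAt (n k p : ℕ) : Prop :=
  ∃ r, FinalStatesAt x n k r ∧ ∃ l : List (Fin n), Seg x r (encList (encFin n) l) p

/-- The listing of the query rules starts at `p`. -/
def QueryRulesAt (n k p : ℕ) : Prop :=
  ∃ r, WriteRulesAt x n k r ∧ ∃ l : List (WriteRule W (Fin n) (Fin k)),
    Seg x r (encList encWriteRule l) p

/-- The input word starts at `p`. -/
def InputAt (n k p : ℕ) : Prop :=
  ∃ r, QueryRulesAt x n k r ∧ ∃ l : List (QueryRule Q R (Fin n)), Seg x r (encList encQueryRule l) p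

/-- The description ends at `p`. -/
def DescriptionEnd (n k p : ℕ) : Prop :=
  ∃ r, InputAt x n k r ∧ ∃ l : List (Fin k), Seg x r (encList (encFin k) l) p

/-- `s` is listed as a query state. -/
def IsQueryState (s : ℕ) : Prop := ∃ n k r p q, QueryStatesAt x n k r ∧
  (∃ l : List (Fin n), Seg x r (l.flatMap (encFin n)) p) ∧ s < n ∧ Seg x p (encNum s) q

/-- `s` is listed as a final state. -/
def IsFinalState (s : ℕ) : Prop := ∃ n k r p q, FinalStatesAt x n k r ∧
  (∃ l : List (Fin n), Seg x r (l.flatMap (encFin n)) p) ∧ s < n ∧ Seg x p (encNum s) q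

/-- The positions `p`, …, `q` delimit the components of a write rule. -/
def IsWriteRule (p p₁ p₂ p₃ q : ℕ) : Prop := ∃ n k r, WriteRulesAt x n k r ∧
  (∃ l : List (WriteRule W (Fin n) (Fin k)), Seg x r (l.flatMap encWriteRule) p) ∧
  ∃ t : WriteRule W (Fin n) (Fin k), Seg x p (encNum t.src) p₁ ∧ Seg x p₁ (encRead t.read) p₂ ∧
    Seg x p₂ (encList encLetter t.word) p₃ ∧ Seg x p₃ (encNum t.tgt) q

/-- The positions `p`, …, `q` delimit the components of a query rule. -/
def IsQueryRule (p p₁ p₂ p₃ q : ℕ) : Prop := ∃ n k r, QueryRulesAt x n k r ∧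
  (∃ l : List (QueryRule Q R (Fin n)), Seg x r (l.flatMap encQueryRule) p) ∧
  ∃ t : QueryRule Q R (Fin n), Seg x p (encNum t.src) p₁ ∧
    Seg x p₁ [DSym.letter (PLetter.query t.q)] p₂ ∧ Seg x p₂ [DSym.letter (PLetter.resp t.r)] p₃ ∧
    Seg x p₃ (encNum t.tgt) q

variable {x}

theorem isPrefixCode_encFin {Γ : Type*} (n : ℕ) :
    IsPrefixCode (encFin n : Fin n → List (DSym Γ)) := isPrefixCode_encNum_fin

theorem avoidsSemicolon_encFin {Γ : Type*} (n : ℕ) :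
    AvoidsSemicolon (encFin n : Fin n → List (DSym Γ)) := avoidsSemicolon_encNum_fin

theorem isPrefixCode_encList_encFin {Γ : Type*} (n : ℕ) :
    IsPrefixCode (encList (encFin n) : List (Fin n) → List (DSym Γ)) :=
  (isPrefixCode_encFin n).encList (avoidsSemicolon_encFin n)

/-- Reading from the left, each component is a prefix code, so the word alone determines `n`, `k`
and the position where the component ends. The following uniqueness statements extend this one
component at a time. -/
theorem AfterSizes.unique {n k p n' k' p' : ℕ} (h : AfterSizes x n k p)
    (h' : AfterSizes x n' k' p') : n = n' ∧ k = k' ∧ p = p' := by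
  obtain ⟨r, h1, h2⟩ := h
  obtain ⟨r', h1', h2'⟩ := h'
  obtain ⟨rfl, rfl⟩ := isPrefixCode_encNum.seg h1 h1'
  obtain ⟨rfl, rfl⟩ := isPrefixCode_encNum.seg h2 h2'
  exact ⟨rfl, rfl, rfl⟩

theorem QueryStatesAt.unique {n k p n' k' p' : ℕ} (h : QueryStatesAt x n k p)
    (h' : QueryStatesAt x n' k' p') : n = n' ∧ k = k' ∧ p = p' := by
  obtain ⟨r, h1, s, h2⟩ := h
  obtain ⟨r', h1', s', h2'⟩ := h'
  obtain ⟨rfl, rfl, rfl⟩ := h1.unique h1'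
  exact ⟨rfl, rfl, (isPrefixCode_encNum.seg h2 h2').2⟩

theorem FinalStatesAt.unique {n k p n' k' p' : ℕ} (h : FinalStatesAt x n k p)
    (h' : FinalStatesAt x n' k' p') : n = n' ∧ k = k' ∧ p = p' := by
  obtain ⟨r, h1, s, h2⟩ := h
  obtain ⟨r', h1', s', h2'⟩ := h'
  obtain ⟨rfl, rfl, rfl⟩ := h1.unique h1'
  exact ⟨rfl, rfl, ((isPrefixCode_encList_encFin n).seg h2 h2').2⟩

theorem WriteRulesAt.unique {n k p n' k' p' : ℕ} (h : WriteRulesAt x n k p)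
    (h' : WriteRulesAt x n' k' p') : n = n' ∧ k = k' ∧ p = p' := by
  obtain ⟨r, h1, s, h2⟩ := h
  obtain ⟨r', h1', s', h2'⟩ := h'
  obtain ⟨rfl, rfl, rfl⟩ := h1.unique h1'
  exact ⟨rfl, rfl, ((isPrefixCode_encList_encFin n).seg h2 h2').2⟩

theorem QueryRulesAt.unique {n k p n' k' p' : ℕ} (h : QueryRulesAt x n k p)
    (h' : QueryRulesAt x n' k' p') : n = n' ∧ k = k' ∧ p = p' := by
  obtain ⟨r, h1, s, h2⟩ := h
  obtain ⟨r', h1', s', h2'⟩ := h'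
  obtain ⟨rfl, rfl, rfl⟩ := h1.unique h1'
  exact ⟨rfl, rfl,
    ((isPrefixCode_encWriteRule.encList avoidsSemicolon_encWriteRule).seg h2 h2').2⟩

theorem InputAt.unique {n k p n' k' p' : ℕ} (h : InputAt x n k p)
    (h' : InputAt x n' k' p') : n = n' ∧ k = k' ∧ p = p' := by
  obtain ⟨r, h1, s, h2⟩ := h
  obtain ⟨r', h1', s', h2'⟩ := h'
  obtain ⟨rfl, rfl, rfl⟩ := h1.unique h1'
  exact ⟨rfl, rfl,
    ((isPrefixCode_encQueryRule.encList avoidsSemicolon_encQueryRule).seg h2 h2').2⟩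

theorem AfterSizes.le {n k p : ℕ} (h : AfterSizes x n k p) : n ≤ x.length ∧ k ≤ x.length ∧ p ≤ x.length := by
  obtain ⟨r, h1, h2⟩ := h
  have e1 := h1.add_eq
  have e2 := h2.add_eq
  have := h1.le_length
  have := h2.le_length
  simp only [encNum, List.length_append, List.length_replicate, List.length_singleton] at e1 e2
  omega

theorem QueryStatesAt.le {n k p : ℕ} (h : QueryStatesAt x n k p) :
    n ≤ x.length ∧ k ≤ x.length ∧ p ≤ x.length := by
  obtain ⟨r, h1, s, h2⟩ := h
  exact ⟨h1.le.1, h1.le.2.1, h2.le_length⟩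

theorem FinalStatesAt.le {n k p : ℕ} (h : FinalStatesAt x n k p) :
    n ≤ x.length ∧ k ≤ x.length ∧ p ≤ x.length := by
  obtain ⟨r, h1, s, h2⟩ := h
  exact ⟨h1.le.1, h1.le.2.1, h2.le_length⟩

theorem WriteRulesAt.le {n k p : ℕ} (h : WriteRulesAt x n k p) :
    n ≤ x.length ∧ k ≤ x.length ∧ p ≤ x.length := by
  obtain ⟨r, h1, s, h2⟩ := h
  exact ⟨h1.le.1, h1.le.2.1, h2.le_length⟩

theorem QueryRulesAt.le {n k p : ℕ} (h : QueryRulesAt x n k p) :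
    n ≤ x.length ∧ k ≤ x.length ∧ p ≤ x.length := by
  obtain ⟨r, h1, s, h2⟩ := h
  exact ⟨h1.le.1, h1.le.2.1, h2.le_length⟩

theorem InputAt.le {n k p : ℕ} (h : InputAt x n k p) :
    n ≤ x.length ∧ k ≤ x.length ∧ p ≤ x.length := by
  obtain ⟨r, h1, s, h2⟩ := h
  exact ⟨h1.le.1, h1.le.2.1, h2.le_length⟩

/-- Write rules and their positions. -/
theorem seg_encWriteRule {n k p q : ℕ} {t : WriteRule W (Fin n) (Fin k)} :
    Seg x p (encWriteRule t) q ↔ ∃ p₁ p₂ p₃, Seg x p (encNum t.src) p₁ ∧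
      Seg x p₁ (encRead t.read) p₂ ∧ Seg x p₂ (encList encLetter t.word) p₃ ∧
        Seg x p₃ (encNum t.tgt) q := by
  simp only [encWriteRule, seg_append]
  constructor
  · rintro ⟨p₃, ⟨p₂, ⟨p₁, h1, h2⟩, h3⟩, h4⟩
    exact ⟨p₁, p₂, p₃, h1, h2, h3, h4⟩
  · rintro ⟨p₁, p₂, p₃, h1, h2, h3, h4⟩
    exact ⟨p₃, ⟨p₂, ⟨p₁, h1, h2⟩, h3⟩, h4⟩

theorem seg_encQueryRule {n p q : ℕ} {t : QueryRule Q R (Fin n)} :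
    Seg x p (encQueryRule t) q ↔ ∃ p₁ p₂ p₃, Seg x p (encNum t.src) p₁ ∧
      Seg x p₁ [DSym.letter (PLetter.query t.q)] p₂ ∧
        Seg x p₂ [DSym.letter (PLetter.resp t.r)] p₃ ∧ Seg x p₃ (encNum t.tgt) q := by
  rw [encQueryRule, show [DSym.letter (PLetter.query t.q : PLetter W Q R),
    DSym.letter (PLetter.resp t.r)] = [DSym.letter (PLetter.query t.q)] ++
      [DSym.letter (PLetter.resp t.r)] from rfl]
  simp only [seg_append]
  constructor
  · rintro ⟨p₃, ⟨p₁, h1, ⟨p₂, h2, h3⟩⟩, h4⟩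
    exact ⟨p₁, p₂, p₃, h1, h2, h3, h4⟩
  · rintro ⟨p₁, p₂, p₃, h1, h2, h3, h4⟩
    exact ⟨p₃, ⟨p₁, h1, ⟨p₂, h2, h3⟩⟩, h4⟩

end Layout

/-! ### Definability of the layout of a description -/

namespace CounterProg

variable {W Q R : Type*} {m : ℕ}
  {a b c d f : List (DSym (PLetter W Q R)) → (Fin m → ℕ) → ℕ}

/-- `Fin n` depends on one size only, so the same variable is passed for both parameters of
`Def.segEncList`. -/
theorem Def.segListFin (ha : IsVar a) (hb : IsVar b) (hc : IsVar c) :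
    Def m fun x e => ∃ l : List (Fin (a x e)), Seg x (b x e) (encList (encFin _) l) (c x e) :=
  .segEncList (τ := fun n _ => Fin n) (enc := fun n _ => encFin n) (fun n _ => isPrefixCode_encFin n)
    (.segNumFin ⟨0, fun _ _ => rfl⟩ ⟨2, fun _ _ => rfl⟩ ⟨3, fun _ _ => rfl⟩) ha ha hb hc

theorem Def.segFlatMapFin (ha : IsVar a) (hb : IsVar b) (hc : IsVar c) :
    Def m fun x e => ∃ l : List (Fin (a x e)), Seg x (b x e) (l.flatMap (encFin _)) (c x e) :=
  .segFlatMap (τ := fun n _ => Fin n) (enc := fun n _ => encFin n) (fun n _ => isPrefixCode_encFin n)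
    (.segNumFin ⟨0, fun _ _ => rfl⟩ ⟨2, fun _ _ => rfl⟩ ⟨3, fun _ _ => rfl⟩) ha ha hb hc

theorem Def.afterSizes (ha : IsVar a) (hb : IsVar b) (hc : IsVar c) :
    Def m fun x e => AfterSizes x (a x e) (b x e) (c x e) := by
  refine .app3 (R := fun x n k p => AfterSizes x n k p) ?_ ha hb hc
  refine Def.congr (φ := fun x e => ∃ z ≤ x.length, z = 0 ∧ ∃ r ≤ x.length,
    Seg x z (encNum (e 0)) r ∧ Seg x r (encNum (e 1)) (e 2)) ?_ fun x e _ => ?_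
  · repeat' first
      | exact ⟨_, fun _ _ => rfl⟩
      | apply Def.ex | apply Def.eqZero | apply Def.segNum | apply Def.and
  · constructor
    · rintro ⟨r, h1, h2⟩
      exact ⟨0, Nat.zero_le _, rfl, r, h1.le_length, h1, h2⟩
    · rintro ⟨_, -, rfl, r, -, h1, h2⟩
      exact ⟨r, h1, h2⟩

theorem Def.queryStatesAt (ha : IsVar a) (hb : IsVar b) (hc : IsVar c) :
    Def m fun x e => QueryStatesAt x (a x e) (b x e) (c x e) := by
  refine .app3 (R := fun x n k p => QueryStatesAt x n k p) ?_ ha hb hc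
  refine Def.congr (φ := fun x e => ∃ r ≤ x.length,
    AfterSizes x (e 0) (e 1) r ∧ ∃ s : Fin (e 0), Seg x r (encNum s) (e 2)) ?_ fun x e _ => ?_
  · repeat' first
      | exact ⟨_, fun _ _ => rfl⟩
      | apply Def.ex | apply Def.afterSizes | apply Def.segNumFin | apply Def.and
  · exact ⟨fun ⟨r, h1, h2⟩ => ⟨r, h1.le.2.2, h1, h2⟩, fun ⟨r, _, h1, h2⟩ => ⟨r, h1, h2⟩⟩

theorem Def.finalStatesAt (ha : IsVar a) (hb : IsVar b) (hc : IsVar c) :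
    Def m fun x e => FinalStatesAt x (a x e) (b x e) (c x e) := by
  refine .app3 (R := fun x n k p => FinalStatesAt x n k p) ?_ ha hb hc
  refine Def.congr (φ := fun x e => ∃ r ≤ x.length, QueryStatesAt x (e 0) (e 1) r ∧
    ∃ l : List (Fin (e 0)), Seg x r (encList (encFin (e 0)) l) (e 2)) ?_ fun x e _ => ?_
  · repeat' first
      | exact ⟨_, fun _ _ => rfl⟩
      | apply Def.ex | apply Def.queryStatesAt | apply Def.segListFin | apply Def.and
  · exact ⟨fun ⟨r, h1, h2⟩ => ⟨r, h1.le.2.2, h1, h2⟩, fun ⟨r, _, h1, h2⟩ => ⟨r, h1, h2⟩⟩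

theorem Def.writeRulesAt (ha : IsVar a) (hb : IsVar b) (hc : IsVar c) :
    Def m fun x e => WriteRulesAt x (a x e) (b x e) (c x e) := by
  refine .app3 (R := fun x n k p => WriteRulesAt x n k p) ?_ ha hb hc
  refine Def.congr (φ := fun x e => ∃ r ≤ x.length, FinalStatesAt x (e 0) (e 1) r ∧
    ∃ l : List (Fin (e 0)), Seg x r (encList (encFin (e 0)) l) (e 2)) ?_ fun x e _ => ?_
  · repeat' first
      | exact ⟨_, fun _ _ => rfl⟩
      | apply Def.ex | apply Def.finalStatesAt | apply Def.segListFin | apply Def.and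
  · exact ⟨fun ⟨r, h1, h2⟩ => ⟨r, h1.le.2.2, h1, h2⟩, fun ⟨r, _, h1, h2⟩ => ⟨r, h1, h2⟩⟩

theorem Def.isQueryState (ha : IsVar a) : Def m fun x e => IsQueryState x (a x e) := by
  refine .app1 (R := fun x s => IsQueryState x s) ?_ ha
  refine Def.congr (φ := fun x e => ∃ n ≤ x.length, ∃ k ≤ x.length, ∃ r ≤ x.length,
    ∃ p ≤ x.length, ∃ q ≤ x.length, QueryStatesAt x n k r ∧
      (∃ l : List (Fin n), Seg x r (l.flatMap (encFin n)) p) ∧ e 0 < n ∧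
        Seg x p (encNum (e 0)) q) ?_ fun x e _ => ?_
  · repeat' first
      | exact ⟨_, fun _ _ => rfl⟩
      | apply Def.ex | apply Def.queryStatesAt | apply Def.segFlatMapFin | apply Def.lt
      | apply Def.segNum | apply Def.and
  · constructor
    · rintro ⟨n, k, r, p, q, h1, ⟨l, h2⟩, h3, h4⟩
      exact ⟨n, h1.le.1, k, h1.le.2.1, r, h1.le.2.2, p, h2.le_length, q, h4.le_length, h1, ⟨l, h2⟩,
        h3, h4⟩
    · rintro ⟨n, -, k, -, r, -, p, -, q, -, h⟩
      exact ⟨n, k, r, p, q, h⟩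

theorem Def.isFinalState (ha : IsVar a) : Def m fun x e => IsFinalState x (a x e) := by
  refine .app1 (R := fun x s => IsFinalState x s) ?_ ha
  refine Def.congr (φ := fun x e => ∃ n ≤ x.length, ∃ k ≤ x.length, ∃ r ≤ x.length,
    ∃ p ≤ x.length, ∃ q ≤ x.length, FinalStatesAt x n k r ∧
      (∃ l : List (Fin n), Seg x r (l.flatMap (encFin n)) p) ∧ e 0 < n ∧
        Seg x p (encNum (e 0)) q) ?_ fun x e _ => ?_
  · repeat' first
      | exact ⟨_, fun _ _ => rfl⟩
      | apply Def.ex | apply Def.finalStatesAt | apply Def.segFlatMapFin | apply Def.lt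
      | apply Def.segNum | apply Def.and
  · constructor
    · rintro ⟨n, k, r, p, q, h1, ⟨l, h2⟩, h3, h4⟩
      exact ⟨n, h1.le.1, k, h1.le.2.1, r, h1.le.2.2, p, h2.le_length, q, h4.le_length, h1, ⟨l, h2⟩,
        h3, h4⟩
    · rintro ⟨n, -, k, -, r, -, p, -, q, -, h⟩
      exact ⟨n, k, r, p, q, h⟩

/-- The parts of a write rule are decidable. -/
theorem Def.writeRuleParts [Finite W] : Def 7 fun (x : List (DSym (PLetter W Q R))) e =>
    ∃ t : WriteRule W (Fin (e 0)) (Fin (e 1)), Seg x (e 2) (encNum t.src) (e 3) ∧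
      Seg x (e 3) (encRead t.read) (e 4) ∧ Seg x (e 4) (encList encLetter t.word) (e 5) ∧
        Seg x (e 5) (encNum t.tgt) (e 6) := by
  refine Def.congr (φ := fun x e => (∃ s : Fin (e 0), Seg x (e 2) (encNum s) (e 3)) ∧
    (∃ r : Option (Endmarked (Fin (e 1))), Seg x (e 3) (encRead r) (e 4)) ∧
    (∃ i ≤ x.length, (∃ l : List W, Seg x (e 4) (l.map fun a => .letter (.wr a)) i) ∧
      Seg x i [.semicolon] (e 5)) ∧
    (∃ s : Fin (e 0), Seg x (e 5) (encNum s) (e 6))) ?_ fun x e _ => ?_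
  · repeat' first
      | exact ⟨_, fun _ _ => rfl⟩
      | apply Def.segNumFin | apply Def.segRead | apply Def.ex | apply Def.segLetters
      | apply Def.segSym | apply Def.and
  · have hmap : ∀ l : List W, l.flatMap (encLetter (Q := Q) (R := R)) =
        l.map fun a => .letter (.wr a) := fun l => by
      induction l <;> simp_all [encLetter]
    constructor
    · rintro ⟨⟨s, r, w, t⟩, h1, h2, h3, h4⟩
      obtain ⟨i, h3, h5⟩ := seg_append.1 h3
      exact ⟨⟨s, h1⟩, ⟨r, h2⟩, ⟨i, h3.le_length, ⟨w, hmap w ▸ h3⟩, h5⟩, ⟨t, h4⟩⟩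
    · rintro ⟨⟨s, h1⟩, ⟨r, h2⟩, ⟨i, -, ⟨w, h3⟩, h5⟩, ⟨t, h4⟩⟩
      exact ⟨⟨s, r, w, t⟩, h1, h2, seg_append.2 ⟨i, (hmap w).symm ▸ h3, h5⟩, h4⟩

/-- The parts of a query rule are decidable. -/
theorem Def.queryRuleParts [Finite Q] [Finite R] :
    Def 6 fun (x : List (DSym (PLetter W Q R))) e =>
    ∃ t : QueryRule Q R (Fin (e 0)), Seg x (e 1) (encNum t.src) (e 2) ∧
      Seg x (e 2) [DSym.letter (PLetter.query t.q)] (e 3) ∧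
        Seg x (e 3) [DSym.letter (PLetter.resp t.r)] (e 4) ∧
        Seg x (e 4) (encNum t.tgt) (e 5) := by
  refine Def.congr (φ := fun x e => (∃ s : Fin (e 0), Seg x (e 1) (encNum s) (e 2)) ∧
    (∃ q : Q, Seg x (e 2) [.letter (.query q)] (e 3)) ∧
    (∃ r : R, Seg x (e 3) [.letter (.resp r)] (e 4)) ∧
    (∃ s : Fin (e 0), Seg x (e 4) (encNum s) (e 5))) ?_ fun x e _ => ?_
  · repeat' first
      | exact ⟨_, fun _ _ => rfl⟩
      | apply Def.segNumFin | apply Def.segSym | apply Def.and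
      | (apply Def.existsFinite; intro)
  · constructor
    · rintro ⟨⟨s, q, r, t⟩, h1, h2, h3, h4⟩
      exact ⟨⟨s, h1⟩, ⟨q, h2⟩, ⟨r, h3⟩, ⟨t, h4⟩⟩
    · rintro ⟨⟨s, h1⟩, ⟨q, h2⟩, ⟨r, h3⟩, ⟨t, h4⟩⟩
      exact ⟨⟨s, q, r, t⟩, h1, h2, h3, h4⟩

theorem Def.segWriteRule [Finite W] : Def 4 fun (x : List (DSym (PLetter W Q R))) e =>
    ∃ t : WriteRule W (Fin (e 0)) (Fin (e 1)), Seg x (e 2) (encWriteRule t) (e 3) := by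
  refine Def.congr (φ := fun x e => ∃ p₁ ≤ x.length, ∃ p₂ ≤ x.length, ∃ p₃ ≤ x.length,
    ∃ t : WriteRule W (Fin (e 0)) (Fin (e 1)), Seg x (e 2) (encNum t.src) p₁ ∧
      Seg x p₁ (encRead t.read) p₂ ∧ Seg x p₂ (encList encLetter t.word) p₃ ∧
        Seg x p₃ (encNum t.tgt) (e 3)) ?_ fun x e _ => ?_
  · refine .ex (.ex (.ex ?_))
    exact Def.writeRuleParts.vars (a := ![fun _ e => e 0, fun _ e => e 1, fun _ e => e 2,
      fun _ e => e 4, fun _ e => e 5, fun _ e => e 6, fun _ e => e 3])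
      (by intro i; fin_cases i <;> exact ⟨_, fun _ _ => rfl⟩)
  · simp only [seg_encWriteRule]
    constructor
    · rintro ⟨t, p₁, p₂, p₃, h1, h2, h3, h4⟩
      exact ⟨p₁, h1.le_length, p₂, h2.le_length, p₃, h3.le_length, t, h1, h2, h3, h4⟩
    · rintro ⟨p₁, -, p₂, -, p₃, -, t, h⟩
      exact ⟨t, p₁, p₂, p₃, h⟩

theorem Def.segQueryRule [Finite Q] [Finite R] : Def 4 fun (x : List (DSym (PLetter W Q R))) e =>
    ∃ t : QueryRule Q R (Fin (e 0)), Seg x (e 2) (encQueryRule t) (e 3) := by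
  refine Def.congr (φ := fun x e => ∃ p₁ ≤ x.length, ∃ p₂ ≤ x.length, ∃ p₃ ≤ x.length,
    ∃ t : QueryRule Q R (Fin (e 0)), Seg x (e 2) (encNum t.src) p₁ ∧
      Seg x p₁ [.letter (.query t.q)] p₂ ∧ Seg x p₂ [.letter (.resp t.r)] p₃ ∧
        Seg x p₃ (encNum t.tgt) (e 3)) ?_ fun x e _ => ?_
  · refine .ex (.ex (.ex ?_))
    exact Def.queryRuleParts.vars (a := ![fun _ e => e 0, fun _ e => e 2,
      fun _ e => e 4, fun _ e => e 5, fun _ e => e 6, fun _ e => e 3])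
      (by intro i; fin_cases i <;> exact ⟨_, fun _ _ => rfl⟩)
  · simp only [seg_encQueryRule]
    constructor
    · rintro ⟨t, p₁, p₂, p₃, h1, h2, h3, h4⟩
      exact ⟨p₁, h1.le_length, p₂, h2.le_length, p₃, h3.le_length, t, h1, h2, h3, h4⟩
    · rintro ⟨p₁, -, p₂, -, p₃, -, t, h⟩
      exact ⟨t, p₁, p₂, p₃, h⟩

theorem Def.queryRulesAt [Finite W] (ha : IsVar a) (hb : IsVar b) (hc : IsVar c) :
    Def m fun x e => QueryRulesAt x (a x e) (b x e) (c x e) := by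
  refine .app3 (R := fun x n k p => QueryRulesAt x n k p) ?_ ha hb hc
  refine Def.congr (φ := fun x e => ∃ r ≤ x.length, WriteRulesAt x (e 0) (e 1) r ∧
    ∃ l : List (WriteRule W (Fin (e 0)) (Fin (e 1))), Seg x r (encList encWriteRule l) (e 2)) ?_
    fun x e _ => ?_
  · refine .ex (.and (.writeRulesAt ⟨_, fun _ _ => rfl⟩ ⟨_, fun _ _ => rfl⟩ ⟨_, fun _ _ => rfl⟩) ?_)
    exact .segEncList (τ := fun n k => WriteRule W (Fin n) (Fin k))
      (enc := fun n k => encWriteRule) (fun _ _ => isPrefixCode_encWriteRule) .segWriteRule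
      ⟨_, fun _ _ => rfl⟩ ⟨_, fun _ _ => rfl⟩ ⟨_, fun _ _ => rfl⟩ ⟨_, fun _ _ => rfl⟩
  · exact ⟨fun ⟨r, h1, h2⟩ => ⟨r, h1.le.2.2, h1, h2⟩, fun ⟨r, _, h1, h2⟩ => ⟨r, h1, h2⟩⟩

theorem Def.inputAt [Finite W] [Finite Q] [Finite R] (ha : IsVar a) (hb : IsVar b) (hc : IsVar c) :
    Def m fun x e => InputAt x (a x e) (b x e) (c x e) := by
  refine .app3 (R := fun x n k p => InputAt x n k p) ?_ ha hb hc
  refine Def.congr (φ := fun x e => ∃ r ≤ x.length, QueryRulesAt x (e 0) (e 1) r ∧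
    ∃ l : List (QueryRule Q R (Fin (e 0))), Seg x r (encList encQueryRule l) (e 2)) ?_
    fun x e _ => ?_
  · refine .ex (.and (.queryRulesAt ⟨_, fun _ _ => rfl⟩ ⟨_, fun _ _ => rfl⟩ ⟨_, fun _ _ => rfl⟩) ?_)
    exact .segEncList (τ := fun n _ => QueryRule Q R (Fin n))
      (enc := fun n k => encQueryRule) (fun _ _ => isPrefixCode_encQueryRule) .segQueryRule
      ⟨_, fun _ _ => rfl⟩ ⟨0, fun _ _ => rfl⟩ ⟨_, fun _ _ => rfl⟩ ⟨_, fun _ _ => rfl⟩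
  · exact ⟨fun ⟨r, h1, h2⟩ => ⟨r, h1.le.2.2, h1, h2⟩, fun ⟨r, _, h1, h2⟩ => ⟨r, h1, h2⟩⟩

theorem Def.descriptionEnd [Finite W] [Finite Q] [Finite R] (ha : IsVar a) (hb : IsVar b)
    (hc : IsVar c) : Def m fun x e => DescriptionEnd x (a x e) (b x e) (c x e) := by
  refine .app3 (R := fun x n k p => DescriptionEnd x n k p) ?_ ha hb hc
  refine Def.congr (φ := fun x e => ∃ r ≤ x.length, InputAt x (e 0) (e 1) r ∧
    ∃ l : List (Fin (e 1)), Seg x r (encList (encFin (e 1)) l) (e 2)) ?_ fun x e _ => ?_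
  · repeat' first
      | exact ⟨_, fun _ _ => rfl⟩
      | apply Def.ex | apply Def.inputAt | apply Def.segListFin | apply Def.and
  · exact ⟨fun ⟨r, h1, h2⟩ => ⟨r, h1.le.2.2, h1, h2⟩, fun ⟨r, _, h1, h2⟩ => ⟨r, h1, h2⟩⟩

theorem Def.isWriteRule [Finite W] (ha : IsVar a) (hb : IsVar b) (hc : IsVar c) (hd : IsVar d)
    (hf : IsVar f) :
    Def m fun x e => IsWriteRule x (a x e) (b x e) (c x e) (d x e) (f x e) := by
  refine .app5 (R := fun x p p₁ p₂ p₃ q => IsWriteRule x p p₁ p₂ p₃ q) ?_ ha hb hc hd hf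
  refine Def.congr (φ := fun x e => ∃ n ≤ x.length, ∃ k ≤ x.length, ∃ r ≤ x.length,
    WriteRulesAt x n k r ∧
    (∃ l : List (WriteRule W (Fin n) (Fin k)), Seg x r (l.flatMap encWriteRule) (e 0)) ∧
    ∃ t : WriteRule W (Fin n) (Fin k), Seg x (e 0) (encNum t.src) (e 1) ∧
      Seg x (e 1) (encRead t.read) (e 2) ∧ Seg x (e 2) (encList encLetter t.word) (e 3) ∧
      Seg x (e 3) (encNum t.tgt) (e 4)) ?_ fun x e _ => ?_
  · refine .ex (.ex (.ex (.and (.writeRulesAt ⟨_, fun _ _ => rfl⟩ ⟨_, fun _ _ => rfl⟩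
      ⟨_, fun _ _ => rfl⟩) (.and ?_ ?_))))
    · exact .segFlatMap (τ := fun n k => WriteRule W (Fin n) (Fin k))
        (enc := fun n k => encWriteRule) (fun _ _ => isPrefixCode_encWriteRule) .segWriteRule
        ⟨_, fun _ _ => rfl⟩ ⟨_, fun _ _ => rfl⟩ ⟨_, fun _ _ => rfl⟩ ⟨_, fun _ _ => rfl⟩
    · exact Def.writeRuleParts.vars (a := ![fun _ e => e 5, fun _ e => e 6, fun _ e => e 0,
        fun _ e => e 1, fun _ e => e 2, fun _ e => e 3, fun _ e => e 4])
        (by intro i; fin_cases i <;> exact ⟨_, fun _ _ => rfl⟩)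
  · constructor
    · rintro ⟨n, k, r, h1, h⟩
      exact ⟨n, h1.le.1, k, h1.le.2.1, r, h1.le.2.2, h1, h⟩
    · rintro ⟨n, -, k, -, r, -, h⟩
      exact ⟨n, k, r, h⟩

theorem Def.isQueryRule [Finite W] [Finite Q] [Finite R] (ha : IsVar a) (hb : IsVar b)
    (hc : IsVar c) (hd : IsVar d) (hf : IsVar f) :
    Def m fun x e => IsQueryRule x (a x e) (b x e) (c x e) (d x e) (f x e) := by
  refine .app5 (R := fun x p p₁ p₂ p₃ q => IsQueryRule x p p₁ p₂ p₃ q) ?_ ha hb hc hd hf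
  refine Def.congr (φ := fun x e => ∃ n ≤ x.length, ∃ k ≤ x.length, ∃ r ≤ x.length,
    QueryRulesAt x n k r ∧
    (∃ l : List (QueryRule Q R (Fin n)), Seg x r (l.flatMap encQueryRule) (e 0)) ∧
    ∃ t : QueryRule Q R (Fin n), Seg x (e 0) (encNum t.src) (e 1) ∧
      Seg x (e 1) [.letter (.query t.q)] (e 2) ∧ Seg x (e 2) [.letter (.resp t.r)] (e 3) ∧
      Seg x (e 3) (encNum t.tgt) (e 4)) ?_ fun x e _ => ?_
  · refine .ex (.ex (.ex (.and (.queryRulesAt ⟨_, fun _ _ => rfl⟩ ⟨_, fun _ _ => rfl⟩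
      ⟨_, fun _ _ => rfl⟩) (.and ?_ ?_))))
    · exact .segFlatMap (τ := fun n _ => QueryRule Q R (Fin n))
        (enc := fun n k => encQueryRule) (fun _ _ => isPrefixCode_encQueryRule) .segQueryRule
        ⟨_, fun _ _ => rfl⟩ ⟨0, fun _ _ => rfl⟩ ⟨_, fun _ _ => rfl⟩ ⟨_, fun _ _ => rfl⟩
    · exact Def.queryRuleParts.vars (a := ![fun _ e => e 5, fun _ e => e 0,
        fun _ e => e 1, fun _ e => e 2, fun _ e => e 3, fun _ e => e 4])
        (by intro i; fin_cases i <;> exact ⟨_, fun _ _ => rfl⟩)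
  · constructor
    · rintro ⟨n, k, r, h1, h⟩
      exact ⟨n, h1.le.1, k, h1.le.2.1, r, h1.le.2.2, h1, h⟩
    · rintro ⟨n, -, k, -, r, -, h⟩
      exact ⟨n, k, r, h⟩

end CounterProg

/-! ## Listings of the components of an instance -/

/-- The data listed in a description. -/
structure Listing (W Q R : Type*) (n k : ℕ) where
  start : Fin n
  queryStates : List (Fin n)
  final : List (Fin n)
  writeRules : List (WriteRule W (Fin n) (Fin k))
  queryRules : List (QueryRule Q R (Fin n))
  input : List (Fin k)

namespace Listing

variable {W Q R : Type*} {n k : ℕ}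

def code (D : Listing W Q R n k) : List (DSym (PLetter W Q R)) :=
  encNum n ++ encNum k ++ encNum D.start ++ encList (encFin n) D.queryStates
    ++ encList (encFin n) D.final ++ encList encWriteRule D.writeRules
    ++ encList encQueryRule D.queryRules ++ encList (encFin k) D.input

theorem exists_seg (D : Listing W Q R n k) : ∃ r₀ r₁ r₂ r₃ r₄ r₅,
    AfterSizes D.code n k r₀ ∧ Seg D.code r₀ (encNum D.start) r₁ ∧
    Seg D.code r₁ (encList (encFin n) D.queryStates) r₂ ∧
    Seg D.code r₂ (encList (encFin n) D.final) r₃ ∧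
    Seg D.code r₃ (encList encWriteRule D.writeRules) r₄ ∧
    Seg D.code r₄ (encList encQueryRule D.queryRules) r₅ ∧
    Seg D.code r₅ (encList (encFin k) D.input) D.code.length := by
  have h : Seg D.code 0 (encNum n ++ encNum k ++ encNum D.start
    ++ encList (encFin n) D.queryStates
    ++ encList (encFin n) D.final ++ encList encWriteRule D.writeRules
    ++ encList encQueryRule D.queryRules ++ encList (encFin k) D.input) D.code.length :=
    seg_zero_length.2 rfl
  simp only [seg_append] at h
  obtain ⟨r₅, ⟨r₄, ⟨r₃, ⟨r₂, ⟨r₁, ⟨r₀, h0, h1⟩, h2⟩, h3⟩, h4⟩, h5⟩, h6⟩ := h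
  exact ⟨r₀, r₁, r₂, r₃, r₄, r₅, h0, h1, h2, h3, h4, h5, h6⟩

theorem descriptionEnd_iff {x : List (DSym (PLetter W Q R))} :
    DescriptionEnd x n k x.length ↔ ∃ D : Listing W Q R n k, x = D.code := by
  constructor
  · rintro ⟨r₅, ⟨r₄, ⟨r₃, ⟨r₂, ⟨r₁, ⟨r₀, ⟨r, h, h0⟩, s, h1⟩, lq, h2⟩, lf, h3⟩, lw, h4⟩, lr, h5⟩,
      w, h6⟩
    refine ⟨⟨s, lq, lf, lw, lr, w⟩, seg_zero_length.1 ?_⟩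
    simp only [code, seg_append]
    exact ⟨r₅, ⟨r₄, ⟨r₃, ⟨r₂, ⟨r₁, ⟨r₀, ⟨r, h, h0⟩, h1⟩, h2⟩, h3⟩, h4⟩, h5⟩, h6⟩
  · rintro ⟨D, rfl⟩
    obtain ⟨r₀, r₁, r₂, r₃, r₄, r₅, h0, h1, h2, h3, h4, h5, h6⟩ := D.exists_seg
    exact ⟨r₅, ⟨r₄, ⟨r₃, ⟨r₂, ⟨r₁, ⟨r₀, h0, _, h1⟩, _, h2⟩, _, h3⟩, _, h4⟩, _, h5⟩, _, h6⟩

theorem exists_startAt (D : Listing W Q R n k) :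
    ∃ r q, AfterSizes D.code n k r ∧ Seg D.code r (encNum D.start) q := by
  obtain ⟨r₀, r₁, -, -, -, -, h0, h1, -⟩ := D.exists_seg
  exact ⟨r₀, r₁, h0, h1⟩

theorem exists_queryStatesAt (D : Listing W Q R n k) :
    ∃ r r', QueryStatesAt D.code n k r ∧ Seg D.code r (encList (encFin n) D.queryStates) r' := by
  obtain ⟨r₀, r₁, r₂, r₃, r₄, r₅, h0, h1, h2, h3, h4, h5, h6⟩ := D.exists_seg
  exact ⟨r₁, r₂, ⟨r₀, h0, _, h1⟩, h2⟩

theorem exists_finalStatesAt (D : Listing W Q R n k) :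
    ∃ r r', FinalStatesAt D.code n k r ∧ Seg D.code r (encList (encFin n) D.final) r' := by
  obtain ⟨r₀, r₁, r₂, r₃, r₄, r₅, h0, h1, h2, h3, h4, h5, h6⟩ := D.exists_seg
  exact ⟨r₂, r₃, ⟨r₁, ⟨r₀, h0, _, h1⟩, _, h2⟩, h3⟩

theorem exists_writeRulesAt (D : Listing W Q R n k) :
    ∃ r r', WriteRulesAt D.code n k r ∧ Seg D.code r (encList encWriteRule D.writeRules) r' := by
  obtain ⟨r₀, r₁, r₂, r₃, r₄, r₅, h0, h1, h2, h3, h4, h5, h6⟩ := D.exists_seg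
  exact ⟨r₃, r₄, ⟨r₂, ⟨r₁, ⟨r₀, h0, _, h1⟩, _, h2⟩, _, h3⟩, h4⟩

theorem exists_queryRulesAt (D : Listing W Q R n k) :
    ∃ r r', QueryRulesAt D.code n k r ∧ Seg D.code r (encList encQueryRule D.queryRules) r' := by
  obtain ⟨r₀, r₁, r₂, r₃, r₄, r₅, h0, h1, h2, h3, h4, h5, h6⟩ := D.exists_seg
  exact ⟨r₄, r₅, ⟨r₃, ⟨r₂, ⟨r₁, ⟨r₀, h0, _, h1⟩, _, h2⟩, _, h3⟩, _, h4⟩, h5⟩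

theorem exists_inputAt (D : Listing W Q R n k) : ∃ r, InputAt D.code n k r ∧
    Seg D.code r (encList (encFin k) D.input) D.code.length := by
  obtain ⟨r₀, r₁, r₂, r₃, r₄, r₅, h0, h1, h2, h3, h4, h5, h6⟩ := D.exists_seg
  exact ⟨r₅, ⟨r₄, ⟨r₃, ⟨r₂, ⟨r₁, ⟨r₀, h0, _, h1⟩, _, h2⟩, _, h3⟩, _, h4⟩, _, h5⟩, h6⟩

/-- The whole codes between the start of the listing and `p` guarantee that `p` is the beginning of
an element, and not a place inside a longer numeral. -/
theorem isQueryState_iff (D : Listing W Q R n k) {s : ℕ} :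
    IsQueryState D.code s ↔ ∃ h : s < n, ⟨s, h⟩ ∈ D.queryStates := by
  obtain ⟨r, r', h1, h2⟩ := D.exists_queryStatesAt
  constructor
  · rintro ⟨n', k', r₁, p, q, g1, ⟨l, g2⟩, g3, g4⟩
    obtain ⟨rfl, rfl, rfl⟩ := h1.unique g1
    obtain ⟨l₂, h⟩ := exists_append_of_seg (isPrefixCode_encFin n) (avoidsSemicolon_encFin n)
      (t := ⟨s, g3⟩) h2 g2 g4
    exact ⟨g3, by simp [h]⟩
  · rintro ⟨h, hs⟩
    obtain ⟨l₁, -, p, q, -, g1, g2⟩ := exists_seg_of_mem h2 hs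
    exact ⟨n, k, r, p, q, h1, ⟨l₁, g1⟩, h, g2⟩

theorem isFinalState_iff (D : Listing W Q R n k) {s : ℕ} :
    IsFinalState D.code s ↔ ∃ h : s < n, ⟨s, h⟩ ∈ D.final := by
  obtain ⟨r, r', h1, h2⟩ := D.exists_finalStatesAt
  constructor
  · rintro ⟨n', k', r₁, p, q, g1, ⟨l, g2⟩, g3, g4⟩
    obtain ⟨rfl, rfl, rfl⟩ := h1.unique g1
    obtain ⟨l₂, h⟩ := exists_append_of_seg (isPrefixCode_encFin n) (avoidsSemicolon_encFin n)
      (t := ⟨s, g3⟩) h2 g2 g4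
    exact ⟨g3, by simp [h]⟩
  · rintro ⟨h, hs⟩
    obtain ⟨l₁, -, p, q, -, g1, g2⟩ := exists_seg_of_mem h2 hs
    exact ⟨n, k, r, p, q, h1, ⟨l₁, g1⟩, h, g2⟩

theorem exists_of_isWriteRule (D : Listing W Q R n k) {p p₁ p₂ p₃ q : ℕ}
    (h : IsWriteRule D.code p p₁ p₂ p₃ q) : ∃ t ∈ D.writeRules,
      Seg D.code p (encNum t.src) p₁ ∧ Seg D.code p₁ (encRead t.read) p₂ ∧
      Seg D.code p₂ (encList encLetter t.word) p₃ ∧ Seg D.code p₃ (encNum t.tgt) q := by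
  obtain ⟨r, r', h1, h2⟩ := D.exists_writeRulesAt
  obtain ⟨n', k', r₁, g1, ⟨l, g2⟩, t, g3⟩ := h
  obtain ⟨rfl, rfl, rfl⟩ := h1.unique g1
  obtain ⟨l₂, h⟩ := exists_append_of_seg isPrefixCode_encWriteRule avoidsSemicolon_encWriteRule
    h2 g2 (seg_encWriteRule.2 ⟨_, _, _, g3⟩)
  exact ⟨t, by simp [h], g3⟩

theorem exists_isWriteRule (D : Listing W Q R n k) {t : WriteRule W (Fin n) (Fin k)}
    (ht : t ∈ D.writeRules) : ∃ p p₁ p₂ p₃ q, IsWriteRule D.code p p₁ p₂ p₃ q ∧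
      Seg D.code p (encNum t.src) p₁ ∧ Seg D.code p₁ (encRead t.read) p₂ ∧
      Seg D.code p₂ (encList encLetter t.word) p₃ ∧ Seg D.code p₃ (encNum t.tgt) q := by
  obtain ⟨r, r', h1, h2⟩ := D.exists_writeRulesAt
  obtain ⟨l₁, -, p, q, -, g1, g2⟩ := exists_seg_of_mem h2 ht
  obtain ⟨p₁, p₂, p₃, g3⟩ := seg_encWriteRule.1 g2
  exact ⟨p, p₁, p₂, p₃, q, ⟨n, k, r, h1, ⟨l₁, g1⟩, t, g3⟩, g3⟩

theorem exists_of_isQueryRule (D : Listing W Q R n k) {p p₁ p₂ p₃ q : ℕ}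
    (h : IsQueryRule D.code p p₁ p₂ p₃ q) : ∃ t ∈ D.queryRules,
      Seg D.code p (encNum t.src) p₁ ∧ Seg D.code p₁ [.letter (.query t.q)] p₂ ∧
      Seg D.code p₂ [.letter (.resp t.r)] p₃ ∧ Seg D.code p₃ (encNum t.tgt) q := by
  obtain ⟨r, r', h1, h2⟩ := D.exists_queryRulesAt
  obtain ⟨n', k', r₁, g1, ⟨l, g2⟩, t, g3⟩ := h
  obtain ⟨rfl, rfl, rfl⟩ := h1.unique g1
  obtain ⟨l₂, h⟩ := exists_append_of_seg isPrefixCode_encQueryRule avoidsSemicolon_encQueryRule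
    h2 g2 (seg_encQueryRule.2 ⟨_, _, _, g3⟩)
  exact ⟨t, by simp [h], g3⟩

theorem exists_isQueryRule (D : Listing W Q R n k) {t : QueryRule Q R (Fin n)}
    (ht : t ∈ D.queryRules) : ∃ p p₁ p₂ p₃ q, IsQueryRule D.code p p₁ p₂ p₃ q ∧
      Seg D.code p (encNum t.src) p₁ ∧ Seg D.code p₁ [.letter (.query t.q)] p₂ ∧
      Seg D.code p₂ [.letter (.resp t.r)] p₃ ∧ Seg D.code p₃ (encNum t.tgt) q := by
  obtain ⟨r, r', h1, h2⟩ := D.exists_queryRulesAt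
  obtain ⟨l₁, -, p, q, -, g1, g2⟩ := exists_seg_of_mem h2 ht
  obtain ⟨p₁, p₂, p₃, g3⟩ := seg_encQueryRule.1 g2
  exact ⟨p, p₁, p₂, p₃, q, ⟨n, k, r, h1, ⟨l₁, g1⟩, t, g3⟩, g3⟩

/-- A query rule is determined by the position of its query. -/
theorem start_eq_of_isQueryRule (D : Listing W Q R n k) {a p p₂ p₃ q p' p₂' p₃' q' : ℕ}
    (h : IsQueryRule D.code p a p₂ p₃ q) (h' : IsQueryRule D.code p' a p₂' p₃' q') : p = p' := by
  wlog hlt : p < p' generalizing p p' p₂ p₃ q p₂' p₃' q'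
  · by_contra hne
    exact hne (this h' h (by omega)).symm
  obtain ⟨r, r', h1, h2⟩ := D.exists_queryRulesAt
  obtain ⟨n₁, k₁, r₁, g1, ⟨l, g2⟩, t, g3, g4⟩ := h
  obtain ⟨rfl, rfl, rfl⟩ := h1.unique g1
  obtain ⟨n₂, k₂, r₂, g1', ⟨l', g2'⟩, t', g3', g4'⟩ := h'
  obtain ⟨rfl, rfl, rfl⟩ := h1.unique g1'
  have e1 := seg_encQueryRule.2 ⟨_, _, _, g3, g4⟩
  have e2 := seg_encQueryRule.2 ⟨_, _, _, g3', g4'⟩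
  obtain ⟨m, hm⟩ := exists_append_of_seg isPrefixCode_encQueryRule avoidsSemicolon_encQueryRule
    h2 g2 e1
  obtain ⟨m', hm'⟩ := exists_append_of_seg isPrefixCode_encQueryRule avoidsSemicolon_encQueryRule
    h2 g2' e2
  rw [hm] at hm'
  rcases List.append_eq_append_iff.1 hm' with ⟨c, hc, hc'⟩ | ⟨c, hc, hc'⟩
  · rcases c with _ | ⟨t'', c⟩
    · obtain rfl : l' = l := by simpa using hc
      have := g2.add_eq
      have := g2'.add_eq
      omega
    -- Here the rule at `p` is followed by the one at `p'`, so it ends at or before `p'`, and `p' ≤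
    -- a`. But its query sits at `a`, strictly before its end.
    · obtain ⟨rfl, -⟩ := List.cons.inj hc'
      have l1 := g2.add_eq
      have l2 := g2'.add_eq
      have l3 := e1.add_eq
      have l4 := g4.1.le
      have l5 := g4.1.add_eq
      have l6 := g4.2.1.le
      have l7 := g4.2.2.le
      have l8 := g3'.le
      simp only [hc, List.flatMap_append, List.flatMap_cons, List.length_append,
        List.length_singleton] at l2 l5
      omega
  · have l1 := g2.add_eq
    have l2 := g2'.add_eq
    simp only [hc, List.flatMap_append, List.length_append] at l1
    omega

end Listing

theorem ADSAutomaton.isDescription_iff {W Q R : Type*} {n k : ℕ}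
    {M : ADSAutomaton W Q R (Fin n) (Fin k)} {w : List (Fin k)} {x : List (DSym (PLetter W Q R))} :
    M.IsDescription w x ↔ ∃ D : Listing W Q R n k, x = D.code ∧ D.input = w ∧ D.start = M.start ∧
      (∀ s, s ∈ D.queryStates ↔ s ∈ M.queryStates) ∧ (∀ s, s ∈ D.final ↔ s ∈ M.final) ∧
      (∀ t, t ∈ D.writeRules ↔ t ∈ M.writeRules) ∧ (∀ t, t ∈ D.queryRules ↔ t ∈ M.queryRules) := by
  constructor
  · rintro ⟨lq, lf, lw, lr, h1, h2, h3, h4, rfl⟩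
    exact ⟨⟨M.start, lq, lf, lw, lr, w⟩, rfl, rfl, rfl, h1, h2, h3, h4⟩
  · rintro ⟨D, rfl, rfl, h, h1, h2, h3, h4⟩
    exact ⟨D.queryStates, D.final, D.writeRules, D.queryRules, h1, h2, h3, h4, by rw [← h]; rfl⟩

/-! ## Deterministic listings -/

section Finite

variable {W Q R Γ : Type*}

instance [Finite W] [Finite Q] [Finite R] : Finite (PLetter W Q R) :=
  Finite.of_surjective (Sum.elim PLetter.wr (Sum.elim PLetter.query PLetter.resp))
    (by
      rintro (a | q | r)
      · exact ⟨.inl a, rfl⟩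
      · exact ⟨.inr (.inl q), rfl⟩
      · exact ⟨.inr (.inr r), rfl⟩)

instance [Finite Γ] : Finite (DSym Γ) :=
  Finite.of_surjective (Sum.elim DSym.letter
      ![DSym.tick, DSym.comma, DSym.semicolon, DSym.left, DSym.right, DSym.eps])
    (by
      rintro (_ | _ | _ | _ | _ | _ | a)
      exacts [⟨.inr 0, rfl⟩, ⟨.inr 1, rfl⟩, ⟨.inr 2, rfl⟩, ⟨.inr 3, rfl⟩, ⟨.inr 4, rfl⟩,
        ⟨.inr 5, rfl⟩, ⟨.inl a, rfl⟩])

end Finite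

/-- The positions from `p` to `q` and from `p'` to `q'` carry the same word. -/
def SegEq {α : Type*} (x : List α) (p q p' q' : ℕ) : Prop := ∃ w, Seg x p w q ∧ Seg x p' w q'

/-- Equality of words is tested letter by letter; over a finite alphabet the quantifier over `c` is
a finite disjunction, and all others range over positions. -/
theorem segEq_iff {α : Type*} {x : List α} {p q p' q' : ℕ} : SegEq x p q p' q' ↔
    q ≤ x.length ∧ q' ≤ x.length ∧ ∃ d ≤ x.length, p + d = q ∧ p' + d = q' ∧
      ∀ i ≤ x.length, i < d → ∃ c : α, ∃ j ≤ x.length, ∃ j' ≤ x.length,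
        (p + i = j ∧ p' + i = j') ∧ (x[j]? = some c ∧ x[j']? = some c) := by
  constructor
  · rintro ⟨w, h, h'⟩
    have l1 := h.add_eq
    have l2 := h'.add_eq
    have l3 := h.le_length
    have l4 := h'.le_length
    refine ⟨l3, l4, w.length, by omega, l1, l2, fun i hi hiw => ⟨w[i], p + i, by omega, p' + i,
      by omega, ⟨rfl, rfl⟩, ?_, ?_⟩⟩
    · obtain ⟨u, v, rfl, rfl, -⟩ := h
      simp [List.getElem?_append_right, List.getElem?_append_left, hiw]
    · obtain ⟨u, v, rfl, rfl, -⟩ := h'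
      simp [List.getElem?_append_right, List.getElem?_append_left, hiw]
  · rintro ⟨h1, h2, d, -, rfl, rfl, h⟩
    induction d with
    | zero => exact ⟨[], seg_nil.2 ⟨rfl, h1⟩, seg_nil.2 ⟨rfl, h2⟩⟩
    | succ d ih =>
      obtain ⟨w, g1, g2⟩ := ih (by omega) (fun i hi hid => h i hi (by omega)) (by omega)
      obtain ⟨c, j, -, j', -, ⟨rfl, rfl⟩, g3, g4⟩ := h d (by omega) (by omega)
      exact ⟨w ++ [c], seg_append.2 ⟨_, g1, seg_singleton.2 ⟨g3, rfl⟩⟩,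
        seg_append.2 ⟨_, g2, seg_singleton.2 ⟨g4, rfl⟩⟩⟩

/-- Equality of encoded objects can thus be tested on the words, without decoding them. -/
theorem IsPrefixCode.segEq {α τ : Type*} {x : List α} {p q p' q' : ℕ} {enc : τ → List α}
    (h : IsPrefixCode enc) {t t' : τ} (h1 : Seg x p (enc t) q) (h2 : Seg x p' (enc t') q') :
    SegEq x p q p' q' ↔ t = t' := by
  constructor
  · rintro ⟨w, g1, g2⟩
    rw [g1.unique h1] at g2
    exact (h _ _ [] [] (by rw [h2.unique g2])).1.symm
  · rintro rfl
    exact ⟨_, h1, h2⟩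

/-- Two pairs of a query and a response that occur after a common history. -/
def Compatible {W Q R : Type*} (P : Language (PLetter W Q R)) (c c' : Q × R) : Prop :=
  ∃ p u, IsProtocol Set.univ p ∧ p ++ queryBlock u c.1 c.2 ∈ P ∧ p ++ queryBlock u c'.1 c'.2 ∈ P

namespace Listing

variable {W Q R : Type*} {n k : ℕ}

def IsWellFormed (D : Listing W Q R n k) : Prop :=
  D.start ∉ D.final ∧ (∀ t ∈ D.writeRules, t.src ∉ D.queryStates) ∧
    ∀ t ∈ D.queryRules, t.src ∈ D.queryStates ∧ t.tgt ∉ D.queryStates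

/-- No configuration allows two different moves. -/
def IsDeterministic (D : Listing W Q R n k) (P : Language (PLetter W Q R)) : Prop :=
  (∀ t ∈ D.writeRules, ∀ t' ∈ D.writeRules, t.src = t'.src →
    t.read = t'.read ∨ t.read = none → t = t') ∧
  ∀ t ∈ D.queryRules, ∀ t' ∈ D.queryRules, t.src = t'.src →
    Compatible P (t.q, t.r) (t'.q, t'.r) → t = t'

/-- The automaton listed by `D`. -/
def automaton (D : Listing W Q R n k) (h : D.IsWellFormed) : ADSAutomaton W Q R (Fin n) (Fin k) where
  queryStates := {s | s ∈ D.queryStates}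
  start := D.start
  final := {s | s ∈ D.final}
  start_notMem_final := h.1
  writeRules := {t | t ∈ D.writeRules}
  queryRules := {t | t ∈ D.queryRules}
  writeRules_finite := D.writeRules.finite_toSet
  src_of_writeRule := h.2.1
  src_of_queryRule := fun t ht => (h.2.2 t ht).1
  tgt_of_queryRule := fun t ht => (h.2.2 t ht).2

/-- The listing fixes all data of the automaton and the remaining fields are proofs. So there is at
most one such automaton, and it exists exactly when the listing is well-formed. -/
theorem exists_isDescription_iff {D : Listing W Q R n k} {w : List (Fin k)}
    (p : ADSAutomaton W Q R (Fin n) (Fin k) → Prop) :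
    (∃ M : ADSAutomaton W Q R (Fin n) (Fin k), (D.input = w ∧ D.start = M.start ∧
      (∀ s, s ∈ D.queryStates ↔ s ∈ M.queryStates) ∧ (∀ s, s ∈ D.final ↔ s ∈ M.final) ∧
      (∀ t, t ∈ D.writeRules ↔ t ∈ M.writeRules) ∧
      (∀ t, t ∈ D.queryRules ↔ t ∈ M.queryRules)) ∧ p M) ↔
    D.input = w ∧ ∃ h : D.IsWellFormed, p (D.automaton h) := by
  constructor
  · rintro ⟨⟨qs, s, f, h1, lw, lr, h2, h3, h4, h5⟩, ⟨h0, rfl, g1, g2, g3, g4⟩, hp⟩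
    obtain rfl : qs = {s | s ∈ D.queryStates} := Set.ext fun s => (g1 s).symm
    obtain rfl : f = {s | s ∈ D.final} := Set.ext fun s => (g2 s).symm
    obtain rfl : lw = {s | s ∈ D.writeRules} := Set.ext fun s => (g3 s).symm
    obtain rfl : lr = {s | s ∈ D.queryRules} := Set.ext fun s => (g4 s).symm
    exact ⟨h0, ⟨h1, h3, fun t ht => ⟨h4 t ht, h5 t ht⟩⟩, hp⟩
  · rintro ⟨h0, h, hp⟩
    exact ⟨D.automaton h, ⟨h0, rfl, fun _ => Iff.rfl, fun _ => Iff.rfl, fun _ => Iff.rfl,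
      fun _ => Iff.rfl⟩, hp⟩

theorem mem_membershipProblem1D_iff {P : Language (PLetter W Q R)}
    {x : List (DSym (PLetter W Q R))} : x ∈ membershipProblem1D P ↔
      ∃ (n k : ℕ) (D : Listing W Q R n k) (h : D.IsWellFormed), x = D.code ∧
        (D.automaton h).IsDeterministic P ∧ D.input ∈ (D.automaton h).language P := by
  constructor
  · rintro ⟨n, k, M, w, h, h1, h2⟩
    obtain ⟨D, hD, hM⟩ := ADSAutomaton.isDescription_iff.1 h
    obtain ⟨rfl, h, h'⟩ := (exists_isDescription_iff (D := D) (w := w)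
      fun M => M.IsDeterministic P ∧ w ∈ M.language P).1 ⟨M, hM, h1, h2⟩
    exact ⟨n, k, D, h, hD, h'⟩
  · rintro ⟨n, k, D, h, hD, h1, h2⟩
    exact ⟨n, k, D.automaton h, D.input, ADSAutomaton.isDescription_iff.2 ⟨D, hD, rfl, rfl,
      fun _ => Iff.rfl, fun _ => Iff.rfl, fun _ => Iff.rfl, fun _ => Iff.rfl⟩, h1, h2⟩

/-- Determinism concerns well-formed configurations only; this supplies one in which a rule with the
given reading component applies. -/
theorem exists_suffix_endmark {A : Type*} (a : Option (Endmarked A)) :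
    ∃ v w, a.toList ++ v <:+ endmark w := by
  rcases a with _ | _ | _ | a
  · exact ⟨[], [], List.nil_suffix⟩
  · exact ⟨[.right], [], by simp [endmark]⟩
  · exact ⟨[], [], [.left], by simp [endmark]⟩
  · exact ⟨[.right], [a], [.left], by simp [endmark]⟩

/-- Two competing rules are confronted in one configuration: for write rules the query tape and the
protocol are empty, for query rules `Compatible` provides the history. A write rule never competes
with a query rule, since their sources are states of different kinds. -/
theorem automaton_isDeterministic_iff {D : Listing W Q R n k} (h : D.IsWellFormed)
    (P : Language (PLetter W Q R)) :
    (D.automaton h).IsDeterministic P ↔ D.IsDeterministic P := by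
  constructor
  · intro hdet
    constructor
    · intro t ht t' ht' hsrc hread
      obtain ⟨v, w, hv⟩ := exists_suffix_endmark t'.read
      have hstep' := ADSAutomaton.Step.write (M := D.automaton h) (P := P) t' ht' v [] []
      have hwf : (⟨t'.src, t'.read.toList ++ v, [], []⟩ : ADSConfig W Q R (Fin n)
        (Fin k)).IsWellFormed := ⟨⟨w, hv⟩, [], by simp, rfl⟩
      obtain ⟨v', hv'⟩ : ∃ v', t.read.toList ++ v' = t'.read.toList ++ v := by
        rcases hread with hread | hread
        · exact ⟨v, by rw [hread]⟩
        · exact ⟨t'.read.toList ++ v, by rw [hread]; rfl⟩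
      have hstep := ADSAutomaton.Step.write (M := D.automaton h) (P := P) t ht v' [] []
      rw [hsrc, hv'] at hstep
      have := hdet _ _ _ hwf hstep hstep'
      simp only [ADSConfig.mk.injEq, List.nil_append, and_true] at this
      obtain ⟨h1, rfl, h2⟩ := this
      -- Both moves start from the same unread input and leave the same rest, so they consume the
      -- same letters. This excludes that only one of the two is an `ε`-rule.
      have h3 : t.read = t'.read := by
        have := List.append_cancel_right hv'
        generalize t.read = a at *
        generalize t'.read = b at *
        cases a <;> cases b <;> simp_all
      cases t
      cases t'
      simp_all
    · rintro t ht t' ht' hsrc ⟨p, u, hp, h1, h2⟩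
      have hstep := ADSAutomaton.Step.query (M := D.automaton h) (P := P) t ht [] u p h1
      have hstep' := ADSAutomaton.Step.query (M := D.automaton h) (P := P) t' ht' [] u p h2
      rw [hsrc] at hstep
      have := hdet _ _ _ ⟨⟨[], List.nil_suffix⟩, hp⟩ hstep hstep'
      simp only [ADSConfig.mk.injEq, true_and, queryBlock, List.append_cancel_left_eq,
        List.cons.injEq, PLetter.query.injEq, PLetter.resp.injEq, and_true] at this
      cases t
      cases t'
      simp_all
  · rintro ⟨hw, hq⟩ c c₁ c₂ ⟨-, hp⟩ h1 h2
    rcases h1 with ⟨t, ht, v, u, p⟩ | ⟨t, ht, v, u, p, h1⟩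
    · generalize hc : (⟨t.src, t.read.toList ++ v, u, p⟩ : ADSConfig W Q R (Fin n) (Fin k)) = c
        at h2
      rcases h2 with ⟨t', ht', v', u', p'⟩ | ⟨t', ht', v', u', p', h2⟩
      · simp only [ADSConfig.mk.injEq] at hc
        obtain ⟨h3, h4, rfl, rfl⟩ := hc
        have : t = t' := by
          by_cases h5 : t'.read = none
          · exact (hw t' ht' t ht h3.symm (.inr h5)).symm
          · refine hw t ht t' ht' h3 ?_
            generalize t.read = a at *
            generalize t'.read = b at *
            cases a <;> cases b <;> simp_all
        subst this
        rw [List.append_cancel_left h4]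
      · simp only [ADSConfig.mk.injEq] at hc
        exact absurd (h.2.2 t' ht').1 (hc.1 ▸ h.2.1 t ht)
    · generalize hc : (⟨t.src, v, u, p⟩ : ADSConfig W Q R (Fin n) (Fin k)) = c at h2
      rcases h2 with ⟨t', ht', v', u', p'⟩ | ⟨t', ht', v', u', p', h2⟩
      · simp only [ADSConfig.mk.injEq] at hc
        exact absurd (h.2.2 t ht).1 (hc.1 ▸ h.2.1 t' ht')
      · simp only [ADSConfig.mk.injEq] at hc
        obtain ⟨h3, rfl, rfl, rfl⟩ := hc
        obtain rfl := hq t ht t' ht' h3 ⟨p, u, hp, h1, h2⟩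
        rfl

end Listing

/-! ## Deciding whether a word describes a deterministic automaton -/

section Valid

variable {W Q R : Type*} (x : List (DSym (PLetter W Q R)))

/-- The code of a listed query state extends from `p` to `q`. -/
def QueryStateFrom (p q : ℕ) : Prop := ∃ s, IsQueryState x s ∧ Seg x p (encNum s) q

/-- The code of a listed final state extends from `p` to `q`. -/
def FinalStateFrom (p q : ℕ) : Prop := ∃ s, IsFinalState x s ∧ Seg x p (encNum s) q

/-- The code of the initial state starts at `p`. -/
def StartAt (p : ℕ) : Prop := ∃ n k, AfterSizes x n k p

def HasWellFormedListing : Prop :=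
  (∃ n k, DescriptionEnd x n k x.length) ∧ (∀ p q, StartAt x p → ¬ FinalStateFrom x p q) ∧
    (∀ p p₁ p₂ p₃ q, IsWriteRule x p p₁ p₂ p₃ q → ¬ QueryStateFrom x p p₁) ∧
    ∀ p p₁ p₂ p₃ q, IsQueryRule x p p₁ p₂ p₃ q → QueryStateFrom x p p₁ ∧ ¬ QueryStateFrom x p₃ q

/-- Determinism in terms of positions: rules are compared through the segments that carry them, and
the letters `a`, `b`, `a'`, `b'` are looked up so that `Compatible` is applied to constants. -/
def HasDeterministicListing (P : Language (PLetter W Q R)) : Prop :=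
  (∀ p p₁ p₂ p₃ q, IsWriteRule x p p₁ p₂ p₃ q → ∀ p' p₁' p₂' p₃' q',
    IsWriteRule x p' p₁' p₂' p₃' q' → SegEq x p p₁ p' p₁' →
      SegEq x p₁ p₂ p₁' p₂' ∨ x[p₁]? = some .eps → SegEq x p q p' q') ∧
  ∀ p p₁ p₂ p₃ q, IsQueryRule x p p₁ p₂ p₃ q → ∀ p' p₁' p₂' p₃' q',
    IsQueryRule x p' p₁' p₂' p₃' q' → SegEq x p p₁ p' p₁' →
      ∀ a b a' b', Compatible P (a, b) (a', b') →
        (x[p₁]? = some (.letter (.query a)) ∧ x[p₂]? = some (.letter (.resp b))) →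
        (x[p₁']? = some (.letter (.query a')) ∧ x[p₂']? = some (.letter (.resp b'))) →
        SegEq x p q p' q'

variable {x}

theorem IsWriteRule.le {p p₁ p₂ p₃ q : ℕ} (h : IsWriteRule x p p₁ p₂ p₃ q) :
    p ≤ x.length ∧ p₁ ≤ x.length ∧ p₂ ≤ x.length ∧ p₃ ≤ x.length ∧ q ≤ x.length := by
  obtain ⟨_, _, _, _, _, t, h1, h2, h3, h4⟩ := h
  exact ⟨h1.le.trans h1.le_length, h1.le_length, h2.le_length, h3.le_length, h4.le_length⟩

theorem IsQueryRule.le {p p₁ p₂ p₃ q : ℕ} (h : IsQueryRule x p p₁ p₂ p₃ q) :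
    p ≤ x.length ∧ p₁ ≤ x.length ∧ p₂ ≤ x.length ∧ p₃ ≤ x.length ∧ q ≤ x.length := by
  obtain ⟨_, _, _, _, _, t, h1, h2, h3, h4⟩ := h
  exact ⟨h1.le.trans h1.le_length, h1.le_length, h2.le_length, h3.le_length, h4.le_length⟩

theorem num_le_of_seg {Γ : Type*} {x : List (DSym Γ)} {s p q : ℕ} (h : Seg x p (encNum s) q) :
    s ≤ x.length := by
  obtain ⟨r, h1, h2, -⟩ := seg_encNum.1 h
  omega

namespace Listing

variable {n k : ℕ} (D : Listing W Q R n k)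

theorem queryStateFrom_iff {s : Fin n} {p q : ℕ} (h : Seg D.code p (encNum s) q) :
    QueryStateFrom D.code p q ↔ s ∈ D.queryStates := by
  constructor
  · rintro ⟨s', h1, h2⟩
    obtain ⟨rfl, -⟩ := isPrefixCode_encNum.seg h h2
    exact (D.isQueryState_iff.1 h1).2
  · exact fun hs => ⟨s, D.isQueryState_iff.2 ⟨s.2, hs⟩, h⟩

theorem finalStateFrom_iff {s : Fin n} {p q : ℕ} (h : Seg D.code p (encNum s) q) :
    FinalStateFrom D.code p q ↔ s ∈ D.final := by
  constructor
  · rintro ⟨s', h1, h2⟩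
    obtain ⟨rfl, -⟩ := isPrefixCode_encNum.seg h h2
    exact (D.isFinalState_iff.1 h1).2
  · exact fun hs => ⟨s, D.isFinalState_iff.2 ⟨s.2, hs⟩, h⟩

theorem startAt_iff {p : ℕ} :
    StartAt D.code p ↔ AfterSizes D.code n k p := by
  obtain ⟨r, q, h, -⟩ := D.exists_startAt
  constructor
  · rintro ⟨n', k', h'⟩
    obtain ⟨rfl, rfl, rfl⟩ := h.unique h'
    exact h
  · exact fun h => ⟨n, k, h⟩

theorem hasWellFormedListing_iff : HasWellFormedListing D.code ↔ D.IsWellFormed := by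
  constructor
  · rintro ⟨-, h1, h2, h3⟩
    refine ⟨fun hs => ?_, fun t ht hs => ?_, fun t ht => ?_⟩
    · obtain ⟨r, q, g1, g2⟩ := D.exists_startAt
      exact h1 r q (D.startAt_iff.2 g1) ((D.finalStateFrom_iff g2).2 hs)
    · obtain ⟨p, p₁, p₂, p₃, q, g1, g2, -⟩ := D.exists_isWriteRule ht
      exact h2 _ _ _ _ _ g1 ((D.queryStateFrom_iff g2).2 hs)
    · obtain ⟨p, p₁, p₂, p₃, q, g1, g2, -, -, g3⟩ := D.exists_isQueryRule ht
      rw [← D.queryStateFrom_iff g2, ← D.queryStateFrom_iff g3]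
      exact h3 _ _ _ _ _ g1
  · rintro ⟨h1, h2, h3⟩
    refine ⟨⟨n, k, descriptionEnd_iff.2 ⟨D, rfl⟩⟩, fun p q hp hs => ?_, fun p p₁ p₂ p₃ q h hs => ?_,
      fun p p₁ p₂ p₃ q h => ?_⟩
    · obtain ⟨r, q', g1, g2⟩ := D.exists_startAt
      obtain ⟨-, -, rfl⟩ := g1.unique (D.startAt_iff.1 hp)
      obtain ⟨s, hs1, hs2⟩ := id hs
      obtain ⟨-, rfl⟩ := isPrefixCode_encNum.seg g2 hs2
      exact h1 ((D.finalStateFrom_iff g2).1 hs)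
    · obtain ⟨t, ht, g1, -⟩ := D.exists_of_isWriteRule h
      exact h2 t ht ((D.queryStateFrom_iff g1).1 hs)
    · obtain ⟨t, ht, g1, -, -, g2⟩ := D.exists_of_isQueryRule h
      rw [D.queryStateFrom_iff g1, D.queryStateFrom_iff g2]
      exact h3 t ht

theorem encRead_eq_eps {p q : ℕ} {a : Option (Endmarked (Fin k))} {x : List (DSym (PLetter W Q R))}
    (h : Seg x p (encRead a) q) : x[p]? = some .eps ↔ a = none := by
  constructor
  · intro h'
    exact (isPrefixCode_encRead.seg h (t' := none) (seg_singleton.2 ⟨h', rfl⟩)).1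
  · rintro rfl
    exact (seg_singleton.1 h).1

theorem hasDeterministicListing_iff (P : Language (PLetter W Q R)) :
    HasDeterministicListing D.code P ↔ D.IsDeterministic P := by
  constructor
  · rintro ⟨h1, h2⟩
    refine ⟨fun t ht t' ht' hs hr => ?_, fun t ht t' ht' hs hc => ?_⟩
    · obtain ⟨p, p₁, p₂, p₃, q, g0, g1, g2, g3, g4⟩ := D.exists_isWriteRule ht
      obtain ⟨p', p₁', p₂', p₃', q', k0, k1, k2, k3, k4⟩ := D.exists_isWriteRule ht'
      refine (isPrefixCode_encWriteRule.segEq (seg_encWriteRule.2 ⟨_, _, _, g1, g2, g3, g4⟩)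
        (seg_encWriteRule.2 ⟨_, _, _, k1, k2, k3, k4⟩)).1 (h1 _ _ _ _ _ g0 _ _ _ _ _ k0
          ((isPrefixCode_encNum_fin.segEq g1 k1).2 hs) ?_)
      rwa [isPrefixCode_encRead.segEq g2 k2, encRead_eq_eps g2]
    · obtain ⟨p, p₁, p₂, p₃, q, g0, g1, g2, g3, g4⟩ := D.exists_isQueryRule ht
      obtain ⟨p', p₁', p₂', p₃', q', k0, k1, k2, k3, k4⟩ := D.exists_isQueryRule ht'
      exact (isPrefixCode_encQueryRule.segEq (seg_encQueryRule.2 ⟨_, _, _, g1, g2, g3, g4⟩)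
        (seg_encQueryRule.2 ⟨_, _, _, k1, k2, k3, k4⟩)).1 (h2 _ _ _ _ _ g0 _ _ _ _ _ k0
          ((isPrefixCode_encNum_fin.segEq g1 k1).2 hs) _ _ _ _ hc
          ⟨(seg_singleton.1 g2).1, (seg_singleton.1 g3).1⟩
          ⟨(seg_singleton.1 k2).1, (seg_singleton.1 k3).1⟩)
  · rintro ⟨h1, h2⟩
    refine ⟨fun p p₁ p₂ p₃ q h p' p₁' p₂' p₃' q' h' hs hr => ?_,
      fun p p₁ p₂ p₃ q h p' p₁' p₂' p₃' q' h' hs a b a' b' hc he he' => ?_⟩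
    · obtain ⟨t, ht, g1, g2, g3, g4⟩ := D.exists_of_isWriteRule h
      obtain ⟨t', ht', k1, k2, k3, k4⟩ := D.exists_of_isWriteRule h'
      rw [isPrefixCode_encRead.segEq g2 k2, encRead_eq_eps g2] at hr
      exact (isPrefixCode_encWriteRule.segEq (seg_encWriteRule.2 ⟨_, _, _, g1, g2, g3, g4⟩)
        (seg_encWriteRule.2 ⟨_, _, _, k1, k2, k3, k4⟩)).2
        (h1 t ht t' ht' ((isPrefixCode_encNum_fin.segEq g1 k1).1 hs) hr)
    · obtain ⟨t, ht, g1, g2, g3, g4⟩ := D.exists_of_isQueryRule h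
      obtain ⟨t', ht', k1, k2, k3, k4⟩ := D.exists_of_isQueryRule h'
      rw [(seg_singleton.1 g2).1, (seg_singleton.1 g3).1] at he
      rw [(seg_singleton.1 k2).1, (seg_singleton.1 k3).1] at he'
      simp only [Option.some.injEq, DSym.letter.injEq, PLetter.query.injEq,
        PLetter.resp.injEq] at he he'
      obtain ⟨rfl, rfl⟩ := he
      obtain ⟨rfl, rfl⟩ := he'
      exact (isPrefixCode_encQueryRule.segEq (seg_encQueryRule.2 ⟨_, _, _, g1, g2, g3, g4⟩)
        (seg_encQueryRule.2 ⟨_, _, _, k1, k2, k3, k4⟩)).2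
        (h2 t ht t' ht' ((isPrefixCode_encNum_fin.segEq g1 k1).1 hs) hc)

end Listing

theorem hasWellFormedListing_iff_exists : HasWellFormedListing x ↔
    ∃ (n k : ℕ) (D : Listing W Q R n k), x = D.code ∧ D.IsWellFormed := by
  constructor
  · intro h
    obtain ⟨n, k, hx⟩ := h.1
    obtain ⟨D, rfl⟩ := Listing.descriptionEnd_iff.1 hx
    exact ⟨n, k, D, rfl, D.hasWellFormedListing_iff.1 h⟩
  · rintro ⟨n, k, D, rfl, h⟩
    exact D.hasWellFormedListing_iff.2 h

end Valid

/-! ### Definability of well-formed and deterministic listings -/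

namespace CounterProg

section Quantifiers

variable {W Q R : Type*} {m : ℕ}
  {φ : List (DSym (PLetter W Q R)) → (Fin m → ℕ) → ℕ → ℕ → ℕ → ℕ → ℕ → Prop}

/-- The positions delimiting a rule are at most `|x|`, so quantifying over rules is a bounded
quantification. The nested `Fin.init` and `Fin.last` address the five variables bound innermost. -/
theorem Def.allWriteRule [Finite W] (h : Def (m + 5) fun x e =>
      φ x (Fin.init (Fin.init (Fin.init (Fin.init (Fin.init e)))))
        (Fin.init (Fin.init (Fin.init (Fin.init e))) (Fin.last m))
        (Fin.init (Fin.init (Fin.init e)) (Fin.last _)) (Fin.init (Fin.init e) (Fin.last _))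
        (Fin.init e (Fin.last _)) (e (Fin.last _))) :
    Def m fun x e => ∀ p p₁ p₂ p₃ q, IsWriteRule x p p₁ p₂ p₃ q → φ x e p p₁ p₂ p₃ q := by
  refine Def.congr (φ := fun x e => ∀ p ≤ x.length, ∀ p₁ ≤ x.length, ∀ p₂ ≤ x.length,
    ∀ p₃ ≤ x.length, ∀ q ≤ x.length, IsWriteRule x p p₁ p₂ p₃ q → φ x e p p₁ p₂ p₃ q) ?_
    fun x e _ => ⟨fun h p _ p₁ _ p₂ _ p₃ _ q _ => h p p₁ p₂ p₃ q, fun h p p₁ p₂ p₃ q hr =>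
      h p hr.le.1 p₁ hr.le.2.1 p₂ hr.le.2.2.1 p₃ hr.le.2.2.2.1 q hr.le.2.2.2.2 hr⟩
  exact .all (.all (.all (.all (.all (.imp (.isWriteRule ⟨_, fun _ _ => rfl⟩ ⟨_, fun _ _ => rfl⟩
    ⟨_, fun _ _ => rfl⟩ ⟨_, fun _ _ => rfl⟩ ⟨_, fun _ _ => rfl⟩) h)))))

theorem Def.allQueryRule [Finite W] [Finite Q] [Finite R] (h : Def (m + 5) fun x e =>
      φ x (Fin.init (Fin.init (Fin.init (Fin.init (Fin.init e)))))
        (Fin.init (Fin.init (Fin.init (Fin.init e))) (Fin.last m))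
        (Fin.init (Fin.init (Fin.init e)) (Fin.last _)) (Fin.init (Fin.init e) (Fin.last _))
        (Fin.init e (Fin.last _)) (e (Fin.last _))) :
    Def m fun x e => ∀ p p₁ p₂ p₃ q, IsQueryRule x p p₁ p₂ p₃ q → φ x e p p₁ p₂ p₃ q := by
  refine Def.congr (φ := fun x e => ∀ p ≤ x.length, ∀ p₁ ≤ x.length, ∀ p₂ ≤ x.length,
    ∀ p₃ ≤ x.length, ∀ q ≤ x.length, IsQueryRule x p p₁ p₂ p₃ q → φ x e p p₁ p₂ p₃ q) ?_
    fun x e _ => ⟨fun h p _ p₁ _ p₂ _ p₃ _ q _ => h p p₁ p₂ p₃ q, fun h p p₁ p₂ p₃ q hr =>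
      h p hr.le.1 p₁ hr.le.2.1 p₂ hr.le.2.2.1 p₃ hr.le.2.2.2.1 q hr.le.2.2.2.2 hr⟩
  exact .all (.all (.all (.all (.all (.imp (.isQueryRule ⟨_, fun _ _ => rfl⟩ ⟨_, fun _ _ => rfl⟩
    ⟨_, fun _ _ => rfl⟩ ⟨_, fun _ _ => rfl⟩ ⟨_, fun _ _ => rfl⟩) h)))))

end Quantifiers

section Valid

variable {W Q R : Type*} {m : ℕ}

theorem Def.segEq {α : Type*} [Finite α] {a b c d : List α → (Fin m → ℕ) → ℕ} (ha : IsVar a)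
    (hb : IsVar b) (hc : IsVar c) (hd : IsVar d) :
    Def m fun x e => SegEq x (a x e) (b x e) (c x e) (d x e) := by
  refine .app4 (R := fun x p q p' q' => SegEq x p q p' q') ?_ ha hb hc hd
  refine Def.congr (φ := fun x e => ∃ d ≤ x.length, e 0 + d = e 1 ∧ e 2 + d = e 3 ∧
      ∀ i ≤ x.length, i < d → ∃ c : α, ∃ j ≤ x.length, ∃ j' ≤ x.length,
        (e 0 + i = j ∧ e 2 + i = j') ∧ (x[j]? = some c ∧ x[j']? = some c)) ?_ fun x e he => ?_
  · repeat' first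
      | exact ⟨_, fun _ _ => rfl⟩
      | apply Def.ex | apply Def.all | apply Def.add | apply Def.lt | apply Def.sym
      | apply Def.and | apply Def.imp | (apply Def.existsFinite; intro)
  · rw [segEq_iff]
    exact ⟨fun h => h.2.2, fun h => ⟨he 1, he 3, h⟩⟩

variable {a b : List (DSym (PLetter W Q R)) → (Fin m → ℕ) → ℕ}

theorem Def.queryStateFrom (ha : IsVar a) (hb : IsVar b) :
    Def m fun x e => QueryStateFrom x (a x e) (b x e) := by
  refine .app2 (R := fun x p q => QueryStateFrom x p q) ?_ ha hb
  refine Def.congr (φ := fun x e => ∃ s ≤ x.length, IsQueryState x s ∧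
    Seg x (e 0) (encNum s) (e 1)) ?_ fun x e _ => ?_
  · repeat' first
      | exact ⟨_, fun _ _ => rfl⟩
      | apply Def.ex | apply Def.isQueryState | apply Def.segNum | apply Def.and
  · exact ⟨fun ⟨s, h, h'⟩ => ⟨s, num_le_of_seg h', h, h'⟩, fun ⟨s, _, h⟩ => ⟨s, h⟩⟩

theorem Def.finalStateFrom (ha : IsVar a) (hb : IsVar b) :
    Def m fun x e => FinalStateFrom x (a x e) (b x e) := by
  refine .app2 (R := fun x p q => FinalStateFrom x p q) ?_ ha hb
  refine Def.congr (φ := fun x e => ∃ s ≤ x.length, IsFinalState x s ∧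
    Seg x (e 0) (encNum s) (e 1)) ?_ fun x e _ => ?_
  · repeat' first
      | exact ⟨_, fun _ _ => rfl⟩
      | apply Def.ex | apply Def.isFinalState | apply Def.segNum | apply Def.and
  · exact ⟨fun ⟨s, h, h'⟩ => ⟨s, num_le_of_seg h', h, h'⟩, fun ⟨s, _, h⟩ => ⟨s, h⟩⟩

theorem Def.startAt (ha : IsVar a) : Def m fun x e => StartAt x (a x e) := by
  refine .app1 (R := fun x p => StartAt x p) ?_ ha
  refine Def.congr (φ := fun x e => ∃ n ≤ x.length, ∃ k ≤ x.length, AfterSizes x n k (e 0)) ?_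
    fun x e _ => ?_
  · repeat' first
      | exact ⟨_, fun _ _ => rfl⟩
      | apply Def.ex | apply Def.afterSizes
  · exact ⟨fun ⟨n, k, h⟩ => ⟨n, h.le.1, k, h.le.2.1, h⟩, fun ⟨n, _, k, _, h⟩ => ⟨n, k, h⟩⟩

variable [Finite W] [Finite Q] [Finite R]

theorem Def.hasWellFormedListing :
    Def m fun (x : List (DSym (PLetter W Q R))) _ => HasWellFormedListing x := by
  refine .and ?_ (.and ?_ (.and ?_ ?_))
  · refine Def.congr (φ := fun x _ => ∃ n ≤ x.length, ∃ k ≤ x.length, ∃ l ≤ x.length,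
      l = x.length ∧ DescriptionEnd x n k l) ?_ fun x e _ => ?_
    · repeat' first
        | exact ⟨_, fun _ _ => rfl⟩
        | apply Def.ex | apply Def.eqLength | apply Def.descriptionEnd | apply Def.and
    · constructor
      · rintro ⟨n, k, h⟩
        obtain ⟨r, h1, -⟩ := id h
        exact ⟨n, h1.le.1, k, h1.le.2.1, _, le_rfl, rfl, h⟩
      · rintro ⟨n, -, k, -, _, -, rfl, h⟩
        exact ⟨n, k, h⟩
  · refine Def.congr (φ := fun x _ => ∀ p ≤ x.length, ∀ q ≤ x.length, StartAt x p →
      ¬ FinalStateFrom x p q) ?_ fun x e _ => ?_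
    · repeat' first
        | exact ⟨_, fun _ _ => rfl⟩
        | apply Def.all | apply Def.startAt | apply Def.finalStateFrom | apply Def.not
        | apply Def.imp
    · constructor
      · exact fun h p _ q _ => h p q
      · intro h p q hp hq
        obtain ⟨n, k, h1⟩ := id hp
        obtain ⟨s, h2, h3⟩ := id hq
        exact h p h1.le.2.2 q h3.le_length hp hq
  · refine .allWriteRule ?_
    repeat' first
      | exact ⟨_, fun _ _ => rfl⟩
      | apply Def.queryStateFrom | apply Def.not
  · refine .allQueryRule ?_
    repeat' first
      | exact ⟨_, fun _ _ => rfl⟩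
      | apply Def.queryStateFrom | apply Def.not | apply Def.and

/-- `Compatible P` is a relation on a finite set, hence a finite table: running over all letters
leaves constants, and `P` itself need not be decidable. -/
theorem Def.hasDeterministicListing (P : Language (PLetter W Q R)) :
    Def m fun (x : List (DSym (PLetter W Q R))) _ => HasDeterministicListing x P := by
  refine .and (.allWriteRule (.allWriteRule ?_)) (.allQueryRule (.allQueryRule ?_))
  · repeat' first
      | exact ⟨_, fun _ _ => rfl⟩
      | apply Def.segEq | apply Def.sym | apply Def.imp | apply Def.or
  · refine .imp (.segEq ⟨_, fun _ _ => rfl⟩ ⟨_, fun _ _ => rfl⟩ ⟨_, fun _ _ => rfl⟩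
      ⟨_, fun _ _ => rfl⟩) (.forallFinite fun a => .forallFinite fun b => .forallFinite fun a' =>
        .forallFinite fun b' => .imp (.const _) ?_)
    repeat' first
      | exact ⟨_, fun _ _ => rfl⟩
      | apply Def.segEq | apply Def.sym | apply Def.imp | apply Def.and

end Valid

end CounterProg

/-! ## The automaton as a labelled transition system -/

section Labelled

variable {M Γ σ : Type*} (mm : M → Option Γ → M → Prop)

/-- Moves without a label. -/
def EpsStep (m m' : M) : Prop := mm m none m'

/-- Reading the letter `c` after some moves without a label. -/
def LetterStep (c : Γ) (m m' : M) : Prop :=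
  ∃ m₁, Relation.ReflTransGen (EpsStep mm) m m₁ ∧ mm m₁ (some c) m'

/-- One move, reading its label from a word. -/
def WordStep (u v : M × List Γ) : Prop := ∃ l : Option Γ, mm u.1 l v.1 ∧ u.2 = l.toList ++ v.2

/-- There is at most one move without a label, which excludes all others, and at most one move for
every label. -/
structure IsDeterministicLTS : Prop where
  unique : ∀ m l m₁ m₂, mm m l m₁ → mm m l m₂ → m₁ = m₂
  disjoint : ∀ m m₁ c m₂, mm m none m₁ → ¬ mm m (some c) m₂

variable {mm}

/-- Unlabelled moves form a single path, and a state in which a letter is read has no unlabelled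
move. So on both sides the letter is read at the end of that path, in the same state. -/
theorem IsDeterministicLTS.letterStep_unique (h : IsDeterministicLTS mm) {c : Γ} {m m₁ m₂ : M}
    (h₁ : LetterStep mm c m m₁) (h₂ : LetterStep mm c m m₂) : m₁ = m₂ := by
  obtain ⟨n₁, g₁, k₁⟩ := h₁
  obtain ⟨n₂, g₂, k₂⟩ := h₂
  have hpoint : ∀ n n' : M, Relation.ReflTransGen (EpsStep mm) n n' → ∀ m', mm n (some c) m' →
      n = n' := by
    intro n n' hn m' hm'
    rcases hn.cases_head with h' | ⟨n'', h', -⟩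
    · exact h'
    · exact absurd hm' (h.disjoint _ _ _ _ h')
  have hn : n₁ = n₂ := by
    rcases Relation.ReflTransGen.total_of_right_unique (fun a b b' => h.unique a none b b') g₁ g₂
      with h' | h'
    · exact hpoint _ _ h' _ k₁
    · exact (hpoint _ _ h' _ k₂).symm
  subst hn
  exact h.unique _ _ _ _ k₁ k₂

theorem wordStep_of_epsStep {m m' : M} (h : Relation.ReflTransGen (EpsStep mm) m m') (z : List Γ) :
    Relation.ReflTransGen (WordStep mm) (m, z) (m', z) := by
  induction h with
  | refl => exact .refl
  | tail _ hstep ih => exact ih.tail ⟨none, hstep, rfl⟩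

theorem wordStep_nil {m m' : M} : Relation.ReflTransGen (WordStep mm) (m, []) (m', []) ↔
    Relation.ReflTransGen (EpsStep mm) m m' := by
  constructor
  · intro h
    generalize hu : (m, ([] : List Γ)) = u at h
    induction h using Relation.ReflTransGen.head_induction_on generalizing m with
    | refl =>
      obtain ⟨rfl, -⟩ := Prod.mk.inj hu
      exact .refl
    | head hstep _ ih =>
      subst hu
      obtain ⟨l, h1, h2⟩ := hstep
      rename_i v _
      obtain ⟨n, z⟩ := v
      simp only [List.nil_eq, List.append_eq_nil_iff, Option.toList_eq_nil_iff] at h2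
      obtain ⟨rfl, rfl⟩ := h2
      exact .head h1 (ih rfl)
  · exact fun h => wordStep_of_epsStep h []

theorem wordStep_cons {m m' : M} {c : Γ} {z : List Γ} :
    Relation.ReflTransGen (WordStep mm) (m, c :: z) (m', []) ↔
      ∃ m₂, LetterStep mm c m m₂ ∧ Relation.ReflTransGen (WordStep mm) (m₂, z) (m', []) := by
  constructor
  · intro h
    generalize hu : (m, c :: z) = u at h
    induction h using Relation.ReflTransGen.head_induction_on generalizing m with
    | refl => simp at hu
    | head hstep hrest ih =>
      subst hu
      obtain ⟨l, h1, h2⟩ := hstep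
      rename_i v
      obtain ⟨n, z'⟩ := v
      cases l with
      | none =>
        obtain rfl : c :: z = z' := h2
        obtain ⟨m₂, ⟨m₁, g1, g2⟩, g3⟩ := ih rfl
        exact ⟨m₂, ⟨m₁, .head h1 g1, g2⟩, g3⟩
      | some c' =>
        obtain ⟨rfl, rfl⟩ := List.cons.inj h2
        exact ⟨n, ⟨m, .refl, h1⟩, hrest⟩
  · rintro ⟨m₂, ⟨m₁, h1, h2⟩, h3⟩
    exact (wordStep_of_epsStep h1 _).trans (.head ⟨some c, h2, rfl⟩ h3)

/-- A DFA whose states represent states of a deterministic transition system, or dead ends. -/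
theorem mem_acceptsFrom_iff (B : DFA Γ σ) (Rep : σ → M → Prop) (Dead : σ → Prop) (acc : M → Prop)
    (h1 : ∀ d m c m', Rep d m → LetterStep mm c m m' → Rep (B.step d c) m')
    (h2 : ∀ d m c, Rep d m → (¬ ∃ m', LetterStep mm c m m') → Dead (B.step d c))
    (h3 : ∀ d c, Dead d → Dead (B.step d c)) (h4 : ∀ d, Dead d → d ∉ B.accept)
    (h5 : ∀ d m, Rep d m →
      (d ∈ B.accept ↔ ∃ m', Relation.ReflTransGen (EpsStep mm) m m' ∧ acc m'))
    (h6 : IsDeterministicLTS mm) (d : σ) (m : M) (h : Rep d m) (z : List Γ) :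
    z ∈ B.acceptsFrom d ↔
      ∃ m', Relation.ReflTransGen (WordStep mm) (m, z) (m', []) ∧ acc m' := by
  have hdead : ∀ (z : List Γ) d, Dead d → z ∉ B.acceptsFrom d := by
    intro z
    induction z with
    | nil => exact fun d hd h => h4 d hd (by simpa [DFA.mem_acceptsFrom] using h)
    | cons c z ih =>
      exact fun d hd h => ih _ (h3 d c hd) (by simpa [DFA.mem_acceptsFrom] using h)
  induction z generalizing d m with
  | nil =>
    simp only [wordStep_nil, ← h5 d m h, DFA.mem_acceptsFrom, DFA.evalFrom_nil]
  | cons c z ih =>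
    have hcons : c :: z ∈ B.acceptsFrom d ↔ z ∈ B.acceptsFrom (B.step d c) := by
      simp [DFA.mem_acceptsFrom]
    simp only [hcons, wordStep_cons]
    by_cases hc : ∃ m', LetterStep mm c m m'
    · obtain ⟨m₂, hm₂⟩ := hc
      refine (ih _ _ (h1 d m c m₂ h hm₂)).trans ?_
      constructor
      · rintro ⟨m', g1, g2⟩
        exact ⟨m', ⟨m₂, hm₂, g1⟩, g2⟩
      · rintro ⟨m', ⟨m₃, g0, g1⟩, g2⟩
        obtain rfl := h6.letterStep_unique hm₂ g0
        exact ⟨m', g1, g2⟩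
    · refine iff_of_false (hdead z _ (h2 d m c h hc)) ?_
      rintro ⟨m', ⟨m₃, g0, -⟩, -⟩
      exact hc ⟨m₃, g0⟩

end Labelled

/-- The states of the transition system: between two transitions, inside the word of a write
transition, or between a query and its response. -/
inductive MicroState (W Q S A : Type*) where
  | node (s : S) (v : List (Endmarked A))
  | word (u : List W) (s : S) (v : List (Endmarked A))
  | mid (s : S) (q : Q) (v : List (Endmarked A))

namespace Listing

variable {W Q R : Type*} {n k : ℕ}

/-- The moves, labelled with letters of the protocol. -/
inductive Micro (D : Listing W Q R n k) (P : Language (PLetter W Q R)) :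
    MicroState W Q (Fin n) (Fin k) → Option (PLetter W Q R) → MicroState W Q (Fin n) (Fin k) →
      Prop where
  | read (t : WriteRule W (Fin n) (Fin k)) (ht : t ∈ D.writeRules) (v : List (Endmarked (Fin k))) :
      Micro D P (.node t.src (t.read.toList ++ v)) none (.word t.word t.tgt v)
  | done (s : Fin n) (v : List (Endmarked (Fin k))) : Micro D P (.word [] s v) none (.node s v)
  | write (a : W) (u : List W) (s : Fin n) (v : List (Endmarked (Fin k))) :
      Micro D P (.word (a :: u) s v) (some (.wr a)) (.word u s v)
  | query (t : QueryRule Q R (Fin n)) (ht : t ∈ D.queryRules) (v : List (Endmarked (Fin k))) :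
      Micro D P (.node t.src v) (some (.query t.q)) (.mid t.src t.q v)
  | resp (t : QueryRule Q R (Fin n)) (ht : t ∈ D.queryRules)
      (hc : Compatible P (t.q, t.r) (t.q, t.r)) (v : List (Endmarked (Fin k))) :
      Micro D P (.mid t.src t.q v) (some (.resp t.r)) (.node t.tgt v)

variable {D : Listing W Q R n k} {P : Language (PLetter W Q R)}

/-- Query moves are unique because the intermediate state keeps only the source and the query. For
response moves the side condition in `Micro.resp` is essential: a deterministic automaton may
contain two query rules that differ only in their targets, provided the pair `(q, r)` never occurs
in `P`. -/
theorem isDeterministicLTS_micro (h : D.IsWellFormed) (hdet : D.IsDeterministic P) :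
    IsDeterministicLTS (D.Micro P) where
  unique := by
    intro m l m₁ m₂ h1 h2
    rcases h1 with ⟨t, ht, v⟩ | ⟨s, v⟩ | ⟨a, u, s, v⟩ | ⟨t, ht, v⟩ | ⟨t, ht, hc, v⟩
    · generalize hm : (MicroState.node t.src (t.read.toList ++ v) :
        MicroState W Q (Fin n) (Fin k)) = m at h2
      rcases h2 with ⟨t', ht', v'⟩ | _
      · simp only [MicroState.node.injEq] at hm
        obtain ⟨h3, h4⟩ := hm
        have : t = t' := by
          by_cases h5 : t'.read = none
          · exact (hdet.1 t' ht' t ht h3.symm (.inr h5)).symm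
          · refine hdet.1 t ht t' ht' h3 ?_
            generalize t.read = a at *
            generalize t'.read = b at *
            cases a <;> cases b <;> simp_all
        subst this
        rw [List.append_cancel_left h4]
      · simp at hm
    · cases h2
      rfl
    · cases h2
      rfl
    · generalize hm : (MicroState.node t.src v : MicroState W Q (Fin n) (Fin k)) = m at h2
      generalize hl : some (PLetter.query t.q : PLetter W Q R) = l at h2
      rcases h2 with _ | _ | _ | ⟨t', ht', v'⟩ | _ <;>
        simp only [MicroState.node.injEq, reduceCtorEq, Option.some.injEq, PLetter.query.injEq]
          at hm hl
      rw [hm.1, hm.2, hl]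
    · generalize hm : (MicroState.mid t.src t.q v : MicroState W Q (Fin n) (Fin k)) = m at h2
      generalize hl : some (PLetter.resp t.r : PLetter W Q R) = l at h2
      rcases h2 with _ | _ | _ | _ | ⟨t', ht', hc', v'⟩ <;>
        simp only [MicroState.mid.injEq, reduceCtorEq, Option.some.injEq, PLetter.resp.injEq]
          at hm hl
      obtain ⟨h3, h4, rfl⟩ := hm
      obtain rfl := hdet.2 t ht t' ht' h3 (by rw [← h4, ← hl]; exact hc)
      rfl
  disjoint := by
    intro m m₁ c m₂ h1 h2
    rcases h1 with ⟨t, ht, v⟩ | ⟨s, v⟩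
    · generalize hm : (MicroState.node t.src (t.read.toList ++ v) :
        MicroState W Q (Fin n) (Fin k)) = m at h2
      generalize hl : some c = l at h2
      rcases h2 with _ | _ | _ | ⟨t', ht', v'⟩ | _ <;>
        simp only [MicroState.node.injEq, reduceCtorEq] at hm hl
      exact h.2.1 t ht (hm.1 ▸ (h.2.2 t' ht').1)
    · cases h2

end Listing

/-! ## Protocols -/

section Protocol

variable {W Q R : Type*} {valid : Set (Q × R)}

theorem IsProtocol.append_queryBlock {p : List (PLetter W Q R)} (h : IsProtocol Set.univ p)
    (u : List W) (q : Q) (r : R) : IsProtocol Set.univ (p ++ queryBlock u q r) := by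
  obtain ⟨bs, -, rfl⟩ := h
  exact ⟨bs ++ [(u, q, r)], by simp, by simp⟩

theorem IsProtocol.eq_nil_or_concat {p : List (PLetter W Q R)} (h : IsProtocol valid p) :
    p = [] ∨ ∃ p' r, p = p' ++ [.resp r] := by
  obtain ⟨bs, -, rfl⟩ := h
  rcases List.eq_nil_or_concat bs with rfl | ⟨bs, ⟨u, q, r⟩, rfl⟩
  · exact .inl rfl
  · exact .inr ⟨(bs.flatMap fun b => queryBlock b.1 b.2.1 b.2.2) ++ (u.map .wr ++ [.query q]), r,
      by simp [queryBlock]⟩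

/-- The prefixes of a protocol that end with a response are protocols. -/
theorem IsProtocol.of_append_resp {p s : List (PLetter W Q R)} {r : R}
    (h : IsProtocol valid (p ++ .resp r :: s)) : IsProtocol valid (p ++ [.resp r]) := by
  obtain ⟨bs, hbs, h⟩ := h
  induction bs generalizing p with
  | nil => simp at h
  | cons b bs ih =>
    have hbs' : ∀ b ∈ bs, b.2 ∈ valid := fun b hb => hbs b (List.mem_cons_of_mem _ hb)
    have hcons : ∀ p, IsProtocol valid p → IsProtocol valid (queryBlock b.1 b.2.1 b.2.2 ++ p) := by
      rintro _ ⟨bs', h', rfl⟩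
      exact ⟨b :: bs', List.forall_mem_cons.2 ⟨hbs b List.mem_cons_self, h'⟩, by simp⟩
    rw [List.flatMap_cons] at h
    rcases List.append_eq_append_iff.1 h with ⟨c, h1, h2⟩ | ⟨c, h1, h2⟩
    · rcases c with _ | ⟨a, c⟩
      · simp only [List.append_nil] at h1
        rw [← h1]
        exact hcons _ (ih (p := []) hbs' (by simpa using h2))
      · obtain ⟨rfl, h2⟩ := List.cons.inj h2
        -- The only response letter of a block is its last letter.
        have hc : c = [] := by
          rcases List.eq_nil_or_concat c with rfl | ⟨c', a, rfl⟩
          · rfl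
          · have h3 : b.1.map PLetter.wr ++ [PLetter.query b.2.1] = p ++ .resp r :: c' :=
              (List.append_inj' (t₁ := [PLetter.resp b.2.2]) (t₂ := [a])
                (by simpa [queryBlock] using h1) rfl).1
            have : PLetter.resp r ∈ b.1.map PLetter.wr ++ [PLetter.query b.2.1] := by simp [h3]
            simp at this
        subst hc
        rw [← h1]
        exact ⟨[b], by simpa using hbs b List.mem_cons_self, by simp⟩
    · rw [h1, List.append_assoc]
      exact hcons _ (ih hbs' h2.symm)

end Protocol

/-! ## Runs of the automaton and of the transition system -/

namespace Listing

variable {W Q R : Type*} {n k : ℕ} {D : Listing W Q R n k} {P : Language (PLetter W Q R)}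

theorem wordStep_word (u : List W) (s : Fin n) (v : List (Endmarked (Fin k)))
    (z : List (PLetter W Q R)) : Relation.ReflTransGen (WordStep (D.Micro P))
      (.word u s v, u.map .wr ++ z) (.node s v, z) := by
  induction u with
  | nil => exact .single ⟨none, .done s v, rfl⟩
  | cons a u ih => exact .head ⟨some (.wr a), .write a u s v, rfl⟩ ih

/-- The protocol followed by the query tape grows by exactly the labels of the corresponding moves.
A query move needs its pair to be compatible with itself, and the current history witnesses this. -/
theorem wordStep_of_step (h : D.IsWellFormed) {c c' : ADSConfig W Q R (Fin n) (Fin k)}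
    (hstep : (D.automaton h).Step P c c') (hc : IsProtocol Set.univ c.prot) :
    IsProtocol Set.univ c'.prot ∧ ∃ z₀,
      c'.prot ++ c'.tape.map .wr = c.prot ++ c.tape.map .wr ++ z₀ ∧
      ∀ z, Relation.ReflTransGen (WordStep (D.Micro P)) (.node c.state c.rest, z₀ ++ z)
        (.node c'.state c'.rest, z) := by
  rcases hstep with ⟨t, ht, v, u, p⟩ | ⟨t, ht, v, u, p, hp⟩
  · exact ⟨hc, t.word.map .wr, by simp, fun z => .head ⟨none, .read t ht v, rfl⟩
      (wordStep_word _ _ _ _)⟩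
  · refine ⟨hc.append_queryBlock _ _ _, [.query t.q, .resp t.r], by simp [queryBlock], fun z => ?_⟩
    exact .head (b := (.mid t.src t.q v, .resp t.r :: z)) ⟨some (.query t.q), .query t ht v, rfl⟩
      (.single ⟨some (.resp t.r), .resp t ht ⟨p, u, hc, hp, hp⟩ v, rfl⟩)

theorem wordStep_of_run (h : D.IsWellFormed) {c c' : ADSConfig W Q R (Fin n) (Fin k)}
    (hrun : Relation.ReflTransGen ((D.automaton h).Step P) c c') (hc : IsProtocol Set.univ c.prot) :
    IsProtocol Set.univ c'.prot ∧ ∃ z₀,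
      c'.prot ++ c'.tape.map .wr = c.prot ++ c.tape.map .wr ++ z₀ ∧
      ∀ z, Relation.ReflTransGen (WordStep (D.Micro P)) (.node c.state c.rest, z₀ ++ z)
        (.node c'.state c'.rest, z) := by
  induction hrun with
  | refl => exact ⟨hc, [], by simp, fun z => .refl⟩
  | tail _ hstep ih =>
    obtain ⟨hc', z₁, h1, h2⟩ := ih
    obtain ⟨hc'', z₂, h3, h4⟩ := wordStep_of_step h hstep hc'
    exact ⟨hc'', z₁ ++ z₂, by rw [h3, h1, List.append_assoc], fun z => by
      rw [List.append_assoc]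
      exact (h2 _).trans (h4 z)⟩

/-- The configuration and the letters read that belong to a state of the transition system. -/
inductive Simulates {S A : Type*} :
    ADSConfig W Q R S A → MicroState W Q S A → List (PLetter W Q R) → Prop where
  | node (s : S) (v : List (Endmarked A)) (u : List W) (p : List (PLetter W Q R)) :
      Simulates ⟨s, v, u, p⟩ (.node s v) (p ++ u.map .wr)
  | word (s : S) (v : List (Endmarked A)) (u u' : List W) (p : List (PLetter W Q R)) :
      Simulates ⟨s, v, u ++ u', p⟩ (.word u' s v) (p ++ u.map .wr)
  | mid (s : S) (v : List (Endmarked A)) (u : List W) (p : List (PLetter W Q R)) (q : Q) :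
      Simulates ⟨s, v, u, p⟩ (.mid s q v) (p ++ u.map .wr ++ [.query q])

/-- The configuration changes only at reading moves, when the whole word is put on the tape at once,
and at response moves. A response move is legal because its history is a prefix, ending with a
response, of a word of `P`; such a prefix is a protocol and therefore lies in `P`. -/
theorem exists_simulates_of_micro {valid : Set (Q × R)} (hP : IsCorrectProtocolLanguage valid P)
    (h : D.IsWellFormed) {c : ADSConfig W Q R (Fin n) (Fin k)}
    {m m' : MicroState W Q (Fin n) (Fin k)} {z y : List (PLetter W Q R)}
    {l : Option (PLetter W Q R)} (hc : Simulates c m z) (hm : D.Micro P m l m')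
    (hz : z ++ (l.toList ++ y) ∈ P) : ∃ c',
      Relation.ReflTransGen ((D.automaton h).Step P) c c' ∧ Simulates c' m' (z ++ l.toList) := by
  rcases hm with ⟨t, ht, v⟩ | ⟨s, v⟩ | ⟨a, u, s, v⟩ | ⟨t, ht, v⟩ | ⟨t, ht, hcomp, v⟩
  · cases hc with
    | node _ _ u p =>
      exact ⟨_, .single (.write t ht v u p), by simpa using Simulates.word _ _ u t.word p⟩
  · cases hc with
    | word _ _ u _ p => exact ⟨_, .refl, by simpa using Simulates.node s v u p⟩
  · cases hc with
    | word _ _ u₀ _ p =>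
      exact ⟨_, .refl, by simpa using Simulates.word s v (u₀ ++ [a]) u p⟩
  · cases hc with
    | node _ _ u p => exact ⟨_, .refl, .mid _ v u p _⟩
  · cases hc with
    | mid _ _ u p _ =>
      have hz' : p ++ queryBlock u t.q t.r ++ y ∈ P := by simpa [queryBlock] using hz
      have hp : p ++ queryBlock u t.q t.r ∈ P := by
        refine hP.prefix_mem _ y hz' ?_
        have := (hP.isProtocol _ hz')
        have := IsProtocol.of_append_resp (p := p ++ (u.map .wr ++ [.query t.q])) (r := t.r) (s := y)
          (by simpa [queryBlock] using this)
        simpa [queryBlock] using this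
      exact ⟨_, .single (.query t ht v u p hp), by
        simpa [queryBlock] using Simulates.node t.tgt v [] (p ++ queryBlock u t.q t.r)⟩

theorem exists_simulates_of_wordStep {valid : Set (Q × R)}
    (hP : IsCorrectProtocolLanguage valid P) (h : D.IsWellFormed)
    {v v' : MicroState W Q (Fin n) (Fin k) × List (PLetter W Q R)}
    (hrun : Relation.ReflTransGen (WordStep (D.Micro P)) v v')
    {c : ADSConfig W Q R (Fin n) (Fin k)} {z : List (PLetter W Q R)} (hc : Simulates c v.1 z)
    (hz : z ++ v.2 ∈ P) : ∃ c' z', Relation.ReflTransGen ((D.automaton h).Step P) c c' ∧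
      Simulates c' v'.1 z' ∧ z' ++ v'.2 = z ++ v.2 := by
  induction hrun with
  | refl => exact ⟨c, z, .refl, hc, rfl⟩
  | tail _ hstep ih =>
    obtain ⟨c', z', h1, h2, h3⟩ := ih
    obtain ⟨l, h4, h5⟩ := hstep
    obtain ⟨c'', h6, h7⟩ := exists_simulates_of_micro hP h h2 h4 (by rwa [← h5, h3])
    exact ⟨c'', _, h1.trans h6, h7, by rw [List.append_assoc, ← h5, h3]⟩

/-- Responses need not be tested along the path: membership of the whole label word in `P` certifies
all of them together. -/
theorem mem_language_iff {valid : Set (Q × R)} (hP : IsCorrectProtocolLanguage valid P)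
    (h : D.IsWellFormed) {w : List (Fin k)} : w ∈ (D.automaton h).language P ↔
      ∃ z ∈ P, ∃ s ∈ D.final, Relation.ReflTransGen (WordStep (D.Micro P))
        (.node D.start (endmark w), z) (.node s [], []) := by
  constructor
  · rintro ⟨s, hs, p, hp, hrun⟩
    obtain ⟨-, z, h1, h2⟩ := wordStep_of_run h hrun ⟨[], by simp, rfl⟩
    simp only [List.map_nil, List.append_nil, List.nil_append] at h1
    subst h1
    have h3 := h2 []
    rw [List.append_nil] at h3
    exact ⟨p, hp, s, hs, h3⟩
  · rintro ⟨z, hz, s, hs, hrun⟩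
    obtain ⟨c, z', h1, h2, h3⟩ := exists_simulates_of_wordStep hP h hrun
      (Simulates.node D.start (endmark w) [] []) (by simpa using hz)
    simp only [List.append_nil, List.map_nil, List.nil_append] at h3
    subst h3
    cases h2 with
    | node _ _ u p =>
      -- A nonempty protocol ends with a response, so no letters can be left on the query tape.
      have hu : u = [] := by
        rcases List.eq_nil_or_concat u with rfl | ⟨u, a, rfl⟩
        · rfl
        · rcases (hP.isProtocol _ hz).eq_nil_or_concat with h4 | ⟨p', r, h4⟩
          · simp at h4
          · have := congrArg List.getLast? h4
            simp at this
      subst hu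
      exact ⟨s, hs, p, by simpa using hz, h1⟩

end Listing

/-! ## Moves between pairs of positions

A pair of positions represents a state of the transition system: the first position is that of the
code of a state of the automaton, of a letter in the word of a write transition, or of the query of
a query transition; the second one tells how much of the input has been read. -/

section PosMove

variable {W Q R : Type*} (x : List (DSym (PLetter W Q R)))

/-- The number encoded at `a` is also encoded between `p` and `q`. -/
def SameNum (a p q : ℕ) : Prop := ∃ s r, Seg x a (encNum s) r ∧ Seg x p (encNum s) q

/-- The reading component of a write rule between `p` and `q` moves the input position from `b`
to `b'`. -/
def ReadMove (p q b b' : ℕ) : Prop :=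
  (x[p]? = some .eps ∧ b = b') ∨ (x[p]? = some .left ∧ b = 0 ∧ ∃ n k, InputAt x n k b') ∨
  (x[p]? = some .right ∧ b ≠ 0 ∧ x[b]? = some .semicolon ∧ b + 1 = b') ∨
  (∃ i, Seg x p (encNum i) q ∧ b ≠ 0 ∧ Seg x b (encNum i) b')

/-- The moves between pairs of positions. -/
def PosMove (P : Language (PLetter W Q R)) (u : ℕ × ℕ) : Option (PLetter W Q R) → ℕ × ℕ → Prop
  | none, v => (∃ p p₁ p₂ p₃ q, IsWriteRule x p p₁ p₂ p₃ q ∧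
      SameNum x u.1 p p₁ ∧ p₂ = v.1 ∧ ReadMove x p₁ p₂ u.2 v.2) ∨
      (x[u.1]? = some .semicolon ∧ u.1 + 1 = v.1 ∧ u.2 = v.2)
  | some (.wr a), v => x[u.1]? = some (.letter (.wr a)) ∧ u.1 + 1 = v.1 ∧ u.2 = v.2
  | some (.query a), v => ∃ p p₁ p₂ p₃ q, IsQueryRule x p p₁ p₂ p₃ q ∧
      SameNum x u.1 p p₁ ∧ p₁ = v.1 ∧ x[p₁]? = some (.letter (.query a)) ∧ u.2 = v.2
  | some (.resp r), v => ∃ p p₁ p₂ p₃ q, IsQueryRule x p p₁ p₂ p₃ q ∧ p₁ = u.1 ∧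
      ∃ p' p₁' p₂' p₃' q', IsQueryRule x p' p₁' p₂' p₃' q' ∧ SameNum x p p' p₁' ∧ p₃' = v.1 ∧
        u.2 = v.2 ∧ ∃ a, Compatible P (a, r) (a, r) ∧ x[u.1]? = some (.letter (.query a)) ∧
          x[p₁']? = some (.letter (.query a)) ∧ x[p₂']? = some (.letter (.resp r))

variable {x}

/-- The first symbol tells the represented kinds of states apart: a numeral starts with a tick or a
comma, the rest of a word with a write letter or a semicolon, and a state between query and response
points at a query letter. -/
theorem getElem?_of_seg_encNum {s p q : ℕ} (h : Seg x p (encNum s) q) :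
    x[p]? = some .tick ∨ x[p]? = some .comma := by
  obtain ⟨r, h1, h2, h3, h4, -⟩ := seg_encNum.1 h
  rcases Nat.eq_zero_or_pos s with rfl | hs
  · obtain rfl : p = r := h2
    exact .inr h4
  · exact .inl (h3 p (by omega) le_rfl (by omega))

theorem SameNum.seg_iff {a p q s r : ℕ} (h : SameNum x a p q) (hs : Seg x a (encNum s) r) :
    Seg x p (encNum s) q := by
  obtain ⟨s', r', h1, h2⟩ := h
  obtain ⟨rfl, -⟩ := isPrefixCode_encNum.seg hs h1
  exact h2

theorem seg_word_cons {p q : ℕ} {a : W} {u : List W} {z : List (DSym (PLetter W Q R))} :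
    Seg x p (encList encLetter (a :: u) ++ z) q ↔
      x[p]? = some (.letter (.wr a)) ∧ Seg x (p + 1) (encList encLetter u ++ z) q := by
  rw [show encList (encLetter (Q := Q) (R := R)) (a :: u) ++ z =
    [.letter (.wr a)] ++ (encList encLetter u ++ z) by simp [encList, encLetter], seg_append]
  simp only [seg_singleton]
  constructor
  · rintro ⟨r, ⟨h1, rfl⟩, h2⟩
    exact ⟨h1, h2⟩
  · rintro ⟨h1, h2⟩
    exact ⟨_, ⟨h1, rfl⟩, h2⟩

theorem seg_word_nil {p q : ℕ} {z : List (DSym (PLetter W Q R))} :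
    Seg x p (encList encLetter ([] : List W) ++ z) q ↔
      x[p]? = some .semicolon ∧ Seg x (p + 1) z q := by
  rw [encList, List.flatMap_nil, List.nil_append, seg_append]
  simp only [seg_singleton]
  constructor
  · rintro ⟨r, ⟨h1, rfl⟩, h2⟩
    exact ⟨h1, h2⟩
  · rintro ⟨h1, h2⟩
    exact ⟨_, ⟨h1, rfl⟩, h2⟩

end PosMove

namespace Listing

variable {W Q R : Type*} {n k : ℕ} (D : Listing W Q R n k)

/-- The input position `b` belongs to the unread input `v`. -/
def InputRep (b : ℕ) (v : List (Endmarked (Fin k))) : Prop :=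
  (b = 0 ∧ v = endmark D.input) ∨
  (b ≠ 0 ∧ ∃ w, Seg D.code b (encList (encFin k) w) D.code.length ∧
    v = w.map .letter ++ [.right]) ∨ (b = D.code.length ∧ v = [])

/-- The pair `u` of positions represents a state of the transition system. -/
def PosRep (u : ℕ × ℕ) : MicroState W Q (Fin n) (Fin k) → Prop
  | .node s v => (∃ q, Seg D.code u.1 (encNum s) q) ∧ D.InputRep u.2 v
  | .word w s v => (∃ q, Seg D.code u.1 (encList encLetter w ++ encNum s) q) ∧ D.InputRep u.2 v
  | .mid s a v => (∃ p p₂ p₃ q, IsQueryRule D.code p u.1 p₂ p₃ q ∧ Seg D.code p (encNum s) u.1) ∧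
      D.code[u.1]? = some (.letter (.query a)) ∧ D.InputRep u.2 v

variable {D}

theorem InputRep.le {b : ℕ} {v : List (Endmarked (Fin k))} (h : D.InputRep b v) :
    b ≤ D.code.length := by
  rcases h with ⟨rfl, -⟩ | ⟨-, w, h, -⟩ | ⟨rfl, -⟩
  · exact Nat.zero_le _
  · exact h.le
  · exact le_rfl

theorem PosRep.le {u : ℕ × ℕ} {m : MicroState W Q (Fin n) (Fin k)} (h : D.PosRep u m) :
    u.1 ≤ D.code.length ∧ u.2 ≤ D.code.length := by
  rcases m with ⟨s, v⟩ | ⟨w, s, v⟩ | ⟨s, q, v⟩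
  · obtain ⟨⟨q, h1⟩, h2⟩ := h
    exact ⟨h1.le.trans h1.le_length, h2.le⟩
  · obtain ⟨⟨q, h1⟩, h2⟩ := h
    exact ⟨h1.le.trans h1.le_length, h2.le⟩
  · obtain ⟨⟨p, p₂, p₃, q, -, h1⟩, -, h2⟩ := h
    exact ⟨h1.le_length, h2.le⟩

theorem inputRep_length_iff {v : List (Endmarked (Fin k))} :
    D.InputRep D.code.length v ↔ v = [] := by
  have hpos : D.code.length ≠ 0 := by
    simp [code, encList]
  constructor
  · rintro (⟨h, -⟩ | ⟨-, w, h, -⟩ | ⟨-, h⟩)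
    · exact absurd h hpos
    · have := h.add_eq
      simp [encList] at this
    · exact h
  · exact fun h => .inr (.inr ⟨rfl, h⟩)

/-- Position `0` is thus free to stand for the input with its left endmarker still unread. -/
theorem inputAt_ne_zero {r : ℕ} (h : InputAt D.code n k r) : r ≠ 0 := by
  rintro rfl
  obtain ⟨r, -, l, h⟩ := h
  have := h.add_eq
  simp [encList] at this

theorem seg_read_iff {p q : ℕ} {a : Option (Endmarked (Fin k))}
    (h : Seg D.code p (encRead a) q) (a' : Option (Endmarked (Fin k))) :
    (∃ q', Seg D.code p (encRead a') q') ↔ a = a' := by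
  constructor
  · rintro ⟨q', h'⟩
    exact (isPrefixCode_encRead.seg h h').1
  · rintro rfl
    exact ⟨q, h⟩

/-- The semicolon closing the listing of the input serves as right endmarker, and as this listing
comes last, reading it leads to `|x|`. The condition `b ≠ 0` is needed because `x` itself begins
with a numeral, which is not an input letter. -/
theorem exists_inputRep_of_readMove {p q b b' : ℕ} {a : Option (Endmarked (Fin k))}
    (ha : Seg D.code p (encRead a) q) (hm : ReadMove D.code p q b b')
    {v : List (Endmarked (Fin k))} (hv : D.InputRep b v) :
    ∃ v', v = a.toList ++ v' ∧ D.InputRep b' v' := by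
  rcases hm with ⟨h1, rfl⟩ | ⟨h1, rfl, n', k', h2⟩ | ⟨h1, h2, h3, rfl⟩ | ⟨i, h1, h2, h3⟩
  · obtain rfl := (seg_read_iff ha none).1 ⟨_, seg_singleton.2 ⟨h1, rfl⟩⟩
    exact ⟨v, rfl, hv⟩
  · obtain rfl := (seg_read_iff ha (some .left)).1 ⟨_, seg_singleton.2 ⟨h1, rfl⟩⟩
    obtain ⟨r, h3, h4⟩ := D.exists_inputAt
    obtain ⟨rfl, rfl, rfl⟩ := h3.unique h2
    rcases hv with ⟨-, rfl⟩ | ⟨h5, -⟩ | ⟨h5, -⟩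
    · exact ⟨_, rfl, .inr (.inl ⟨inputAt_ne_zero h3, _, h4, rfl⟩)⟩
    · exact absurd rfl h5
    · simp [code, encList] at h5
  · obtain rfl := (seg_read_iff ha (some .right)).1 ⟨_, seg_singleton.2 ⟨h1, rfl⟩⟩
    rcases hv with ⟨h5, -⟩ | ⟨-, w, h5, rfl⟩ | ⟨rfl, -⟩
    · exact absurd h5 h2
    · rcases w with _ | ⟨i, w⟩
      · exact ⟨[], rfl, .inr (.inr ⟨(seg_singleton.1 h5).2, rfl⟩)⟩
      · rw [encList, List.flatMap_cons, List.append_assoc, seg_append] at h5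
        obtain ⟨r, h6, -⟩ := h5
        exact absurd h3 ((avoidsSemicolon_encFin k).seg h6)
    · simp at h3
  · rcases hv with ⟨h5, -⟩ | ⟨-, w, h5, rfl⟩ | ⟨rfl, -⟩
    · exact absurd h5 h2
    · rcases w with _ | ⟨j, w⟩
      · exact absurd (seg_singleton.1 h5).1 (avoidsSemicolon_encNum.seg h3)
      · rw [encList, List.flatMap_cons, List.append_assoc, seg_append] at h5
        obtain ⟨r, h6, h7⟩ := h5
        obtain ⟨rfl, rfl⟩ := isPrefixCode_encNum.seg h3 h6
        obtain rfl := (seg_read_iff ha (some (.letter j))).1 ⟨_, h1⟩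
        have := h3.le
        exact ⟨_, rfl, .inr (.inl ⟨by omega, w, h7, rfl⟩)⟩
    · have := getElem?_of_seg_encNum h3
      simp at this

theorem exists_readMove_of_inputRep {p q b : ℕ} {a : Option (Endmarked (Fin k))}
    (ha : Seg D.code p (encRead a) q) {v' : List (Endmarked (Fin k))}
    (hv : D.InputRep b (a.toList ++ v')) :
    ∃ b', ReadMove D.code p q b b' ∧ D.InputRep b' v' := by
  rcases a with _ | _ | _ | i
  · exact ⟨b, .inl ⟨(seg_singleton.1 ha).1, rfl⟩, hv⟩
  · rcases hv with ⟨rfl, h⟩ | ⟨h1, w, h2, h⟩ | ⟨h1, h⟩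
    · obtain ⟨r, h3, h4⟩ := D.exists_inputAt
      have h : v' = D.input.map .letter ++ [.right] := (List.cons.inj h).2
      subst h
      exact ⟨r, .inr (.inl ⟨(seg_singleton.1 ha).1, rfl, n, k, h3⟩),
        .inr (.inl ⟨inputAt_ne_zero h3, _, h4, rfl⟩)⟩
    · rcases w with _ | ⟨i, w⟩ <;> simp at h
    · simp at h
  · rcases hv with ⟨rfl, h⟩ | ⟨h1, w, h2, h⟩ | ⟨h1, h⟩
    · simp [endmark] at h
    · rcases w with _ | ⟨i, w⟩
      · obtain rfl : v' = [] := by simpa using h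
        obtain ⟨h3, h4⟩ := seg_singleton.1 h2
        exact ⟨D.code.length, .inr (.inr (.inl ⟨(seg_singleton.1 ha).1, h1, h3, h4⟩)),
          .inr (.inr ⟨rfl, rfl⟩)⟩
      · simp at h
    · simp at h
  · rcases hv with ⟨rfl, h⟩ | ⟨h1, w, h2, h⟩ | ⟨h1, h⟩
    · simp [endmark] at h
    · rcases w with _ | ⟨j, w⟩
      · simp at h
      · simp only [Option.toList_some, List.map_cons, List.cons_append,
          List.cons.injEq, Endmarked.letter.injEq] at h
        obtain ⟨rfl, rfl⟩ := h
        rw [encList, List.flatMap_cons, List.append_assoc, seg_append] at h2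
        obtain ⟨r, h6, h7⟩ := h2
        have := h6.le
        exact ⟨r, .inr (.inr (.inr ⟨i, ha, h1, h6⟩)), .inr (.inl ⟨by omega, w, h7, rfl⟩)⟩
    · simp at h

variable {P : Language (PLetter W Q R)}

/-- The symbol at the first position decides which kind of state is represented, and this excludes
all but the matching moves. -/
theorem exists_micro_of_posMove {u v : ℕ × ℕ} {l : Option (PLetter W Q R)}
    {m : MicroState W Q (Fin n) (Fin k)} (hm : D.PosRep u m) (h : PosMove D.code P u l v) :
    ∃ m', D.Micro P m l m' ∧ D.PosRep v m' := by
  obtain ⟨a, b⟩ := u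
  obtain ⟨a', b'⟩ := v
  rcases m with ⟨s, v⟩ | ⟨w, s, v⟩ | ⟨s, q, v⟩
  · obtain ⟨⟨q₀, h1⟩, h2⟩ := hm
    have hsym := getElem?_of_seg_encNum h1
    dsimp only at h1 h2 hsym
    rcases l with _ | c | c | c
    · rcases h with ⟨p, p₁, p₂, p₃, q, g1, g2, rfl, g4⟩ | ⟨g1, -⟩
      · obtain ⟨t, ht, k1, k2, k3, k4⟩ := D.exists_of_isWriteRule g1
        obtain ⟨h3, -⟩ := isPrefixCode_encNum_fin.seg (g2.seg_iff h1) k1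
        obtain ⟨v', rfl, h4⟩ := exists_inputRep_of_readMove k2 g4 h2
        subst h3
        exact ⟨_, .read t ht v', ⟨q, seg_append.2 ⟨_, k3, k4⟩⟩, h4⟩
      · simp [g1] at hsym
    · simp [h.1] at hsym
    · obtain ⟨p, p₁, p₂, p₃, q, g1, g2, rfl, g4, rfl⟩ := h
      obtain ⟨t, ht, k1, k2, k3, k4⟩ := D.exists_of_isQueryRule g1
      obtain ⟨rfl, -⟩ := isPrefixCode_encNum_fin.seg (g2.seg_iff h1) k1
      have hc : t.q = c := by simpa [g4] using (seg_singleton.1 k2).1.symm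
      subst hc
      exact ⟨_, .query t ht v, ⟨p, p₂, p₃, q, g1, k1⟩, g4, h2⟩
    · obtain ⟨p, p₁, p₂, p₃, q, g1, rfl, p', p₁', p₂', p₃', q', g3, g4, g5, g6, c', g7, g8, -⟩ := h
      simp [g8] at hsym
  · obtain ⟨⟨q₀, h1⟩, h2⟩ := hm
    dsimp only at h1 h2
    have hsym : D.code[a]? = some .semicolon ∨ ∃ c, D.code[a]? = some (.letter (.wr c)) := by
      rcases w with _ | ⟨c, w⟩
      · exact .inl (seg_word_nil.1 h1).1
      · exact .inr ⟨c, (seg_word_cons.1 h1).1⟩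
    rcases l with _ | c | c | c
    · rcases h with ⟨p, p₁, p₂, p₃, q, g1, ⟨s', r', g2, -⟩, -⟩ | ⟨g1, rfl, rfl⟩
      · have := getElem?_of_seg_encNum g2
        dsimp only at this
        rcases hsym with h3 | ⟨c, h3⟩ <;> simp [h3] at this
      · rcases w with _ | ⟨c, w⟩
        · exact ⟨_, .done s v, ⟨q₀, (seg_word_nil.1 h1).2⟩, h2⟩
        · dsimp only at g1
          simp [(seg_word_cons.1 h1).1] at g1
    · obtain ⟨g1, rfl, rfl⟩ := h
      dsimp only at g1
      rcases w with _ | ⟨c', w⟩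
      · simp [(seg_word_nil.1 h1).1] at g1
      · obtain rfl : c' = c := by simpa [(seg_word_cons.1 h1).1] using g1
        exact ⟨_, .write c' w s v, ⟨q₀, (seg_word_cons.1 h1).2⟩, h2⟩
    · obtain ⟨p, p₁, p₂, p₃, q, g1, ⟨s', r', g2, -⟩, -⟩ := h
      have := getElem?_of_seg_encNum g2
      dsimp only at this
      rcases hsym with h3 | ⟨c, h3⟩ <;> simp [h3] at this
    · obtain ⟨p, p₁, p₂, p₃, q, g1, rfl, p', p₁', p₂', p₃', q', g3, g4, g5, g6, c', g7, g8, -⟩ := h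
      dsimp only at g8
      simp [g8] at hsym
  · obtain ⟨⟨p₀, p₂₀, p₃₀, q₀, h0, h1⟩, hsym, h2⟩ := hm
    dsimp only at h0 h1 h2 hsym
    rcases l with _ | c | c | c
    · rcases h with ⟨p, p₁, p₂, p₃, q, g1, ⟨s', r', g2, -⟩, -⟩ | ⟨g1, rfl, rfl⟩
      · have := getElem?_of_seg_encNum g2
        simp [hsym] at this
      · simp [hsym] at g1
    · have := h.1
      simp [hsym] at this
    · obtain ⟨p, p₁, p₂, p₃, q, g1, ⟨s', r', g2, -⟩, -⟩ := h
      have := getElem?_of_seg_encNum g2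
      simp [hsym] at this
    · obtain ⟨p, p₁, p₂, p₃, q', g1, rfl, p', p₁', p₂', p₃', q'', g3, g4, rfl, rfl, c', g7, g8, g9,
        g10⟩ := h
      dsimp only at g1 g8
      -- The rule containing the query is determined by the position of the query, so its source is
      -- the represented state `s`.
      obtain rfl := D.start_eq_of_isQueryRule h0 g1
      obtain ⟨t, ht, k1, k2, k3, k4⟩ := D.exists_of_isQueryRule g3
      obtain ⟨rfl, -⟩ := isPrefixCode_encNum_fin.seg (g4.seg_iff h1) k1
      obtain rfl : q = c' := by simpa [hsym] using g8
      have hq : t.q = q := by simpa [g9] using (seg_singleton.1 k2).1.symm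
      have hr : t.r = c := by simpa [g10] using (seg_singleton.1 k3).1.symm
      subst hq hr
      exact ⟨_, .resp t ht g7 v, ⟨q'', k4⟩, h2⟩

theorem exists_posMove_of_micro {u : ℕ × ℕ} {l : Option (PLetter W Q R)}
    {m m' : MicroState W Q (Fin n) (Fin k)} (hm : D.PosRep u m) (h : D.Micro P m l m') :
    ∃ v, PosMove D.code P u l v ∧ D.PosRep v m' := by
  obtain ⟨a, b⟩ := u
  rcases h with ⟨t, ht, v⟩ | ⟨s, v⟩ | ⟨c, w, s, v⟩ | ⟨t, ht, v⟩ | ⟨t, ht, hc, v⟩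
  · obtain ⟨⟨q₀, h1⟩, h2⟩ := hm
    obtain ⟨p, p₁, p₂, p₃, q, g1, g2, g3, g4, g5⟩ := D.exists_isWriteRule ht
    obtain ⟨b', h3, h4⟩ := exists_readMove_of_inputRep g3 h2
    exact ⟨(p₂, b'), .inl ⟨p, p₁, p₂, p₃, q, g1, ⟨_, _, h1, g2⟩, rfl, h3⟩,
      ⟨q, seg_append.2 ⟨_, g4, g5⟩⟩, h4⟩
  · obtain ⟨⟨q₀, h1⟩, h2⟩ := hm
    obtain ⟨h3, h4⟩ := seg_word_nil.1 h1
    exact ⟨(a + 1, b), .inr ⟨h3, rfl, rfl⟩, ⟨q₀, h4⟩, h2⟩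
  · obtain ⟨⟨q₀, h1⟩, h2⟩ := hm
    obtain ⟨h3, h4⟩ := seg_word_cons.1 h1
    exact ⟨(a + 1, b), ⟨h3, rfl, rfl⟩, ⟨q₀, h4⟩, h2⟩
  · obtain ⟨⟨q₀, h1⟩, h2⟩ := hm
    obtain ⟨p, p₁, p₂, p₃, q, g1, g2, g3, g4, g5⟩ := D.exists_isQueryRule ht
    have g6 := (seg_singleton.1 g3).1
    exact ⟨(p₁, b), ⟨p, p₁, p₂, p₃, q, g1, ⟨_, _, h1, g2⟩, rfl, g6, rfl⟩,
      ⟨p, p₂, p₃, q, g1, g2⟩, g6, h2⟩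
  · obtain ⟨⟨p₀, p₂₀, p₃₀, q₀, h0, h1⟩, hsym, h2⟩ := hm
    obtain ⟨p, p₁, p₂, p₃, q, g1, g2, g3, g4, g5⟩ := D.exists_isQueryRule ht
    exact ⟨(p₃, b), ⟨p₀, a, p₂₀, p₃₀, q₀, h0, rfl, p, p₁, p₂, p₃, q, g1, ⟨_, _, h1, g2⟩, rfl, rfl,
      t.q, hc, hsym, (seg_singleton.1 g3).1, (seg_singleton.1 g4).1⟩, ⟨q, g5⟩, h2⟩

theorem posRep_start {r : ℕ} (h : StartAt D.code r) :
    D.PosRep (r, 0) (.node D.start (endmark D.input)) := by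
  obtain ⟨r', q, g1, g2⟩ := D.exists_startAt
  obtain ⟨-, -, rfl⟩ := g1.unique (D.startAt_iff.1 h)
  exact ⟨⟨q, g2⟩, .inl ⟨rfl, rfl⟩⟩

end Listing

/-! ## The deterministic finite automaton on pairs of positions -/

/-- `v` is the lexicographically first pair of numbers up to `N` with the property `φ`. -/
def IsFirst (N : ℕ) (φ : ℕ × ℕ → Prop) (v : ℕ × ℕ) : Prop :=
  v.1 ≤ N ∧ v.2 ≤ N ∧ φ v ∧ ∀ i ≤ N, ∀ j ≤ N, φ (i, j) → v.1 < i ∨ (v.1 = i ∧ v.2 ≤ j)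

theorem IsFirst.unique {N : ℕ} {φ : ℕ × ℕ → Prop} {v v' : ℕ × ℕ} (h : IsFirst N φ v)
    (h' : IsFirst N φ v') : v = v' := by
  obtain ⟨h1, h2, h3, h4⟩ := h
  obtain ⟨h1', h2', h3', h4'⟩ := h'
  have := h4 _ h1' _ h2' h3'
  have := h4' _ h1 _ h2 h3
  exact Prod.ext (by omega) (by omega)

open Classical in
theorem exists_isFirst {N : ℕ} {φ : ℕ × ℕ → Prop} (h : ∃ i ≤ N, ∃ j ≤ N, φ (i, j)) :
    ∃ v, IsFirst N φ v := by
  obtain ⟨h1, h2⟩ := Nat.find_spec h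
  obtain ⟨h3, h4⟩ := Nat.find_spec h2
  refine ⟨(Nat.find h, Nat.find h2), h1, h3, h4, fun i hi j hj hij => ?_⟩
  have h5 : Nat.find h ≤ i := Nat.find_min' h ⟨hi, j, hj, hij⟩
  rcases h5.lt_or_eq with h5 | h5
  · exact .inl h5
  · exact .inr ⟨h5, Nat.find_min' h2 ⟨hj, by rwa [h5]⟩⟩

section Dfa

variable {W Q R : Type*} (x : List (DSym (PLetter W Q R))) (P : Language (PLetter W Q R))

/-- The first move without a label. -/
def FirstMove (u v : ℕ × ℕ) : Prop := IsFirst x.length (PosMove x P u none) v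

/-- Reading a letter after some moves without a label. -/
def PosReach (c : PLetter W Q R) (u v : ℕ × ℕ) : Prop :=
  ∃ v₁, Relation.ReflTransGen (FirstMove x P) u v₁ ∧ PosMove x P v₁ (some c) v

/-- The transitions of the DFA. -/
def DfaStep (c : PLetter W Q R) (u v : ℕ × ℕ) : Prop :=
  IsFirst x.length (PosReach x P c u) v ∨
    (¬ ∃ i ≤ x.length, ∃ j ≤ x.length, PosReach x P c u (i, j)) ∧ v.1 = x.length ∧ v.2 = x.length

/-- The accepting states of the DFA. -/
def DfaAccept (u : ℕ × ℕ) : Prop :=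
  ∃ v, Relation.ReflTransGen (FirstMove x P) u v ∧ (∃ q, FinalStateFrom x v.1 q) ∧ v.2 = x.length

theorem DfaStep.unique {c : PLetter W Q R} {u v v' : ℕ × ℕ} (h : DfaStep x P c u v)
    (h' : DfaStep x P c u v') : v = v' := by
  rcases h with h | ⟨h1, h2, h3⟩ <;> rcases h' with h' | ⟨h1', h2', h3'⟩
  · exact h.unique h'
  · exact absurd ⟨_, h.1, _, h.2.1, h.2.2.1⟩ h1'
  · exact absurd ⟨_, h'.1, _, h'.2.1, h'.2.2.1⟩ h1
  · exact Prod.ext (h2.trans h2'.symm) (h3.trans h3'.symm)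

theorem exists_dfaStep (c : PLetter W Q R) (u : ℕ × ℕ) :
    ∃ v : Fin (x.length + 1) × Fin (x.length + 1), DfaStep x P c u (v.1, v.2) := by
  by_cases h : ∃ i ≤ x.length, ∃ j ≤ x.length, PosReach x P c u (i, j)
  · obtain ⟨v, hv⟩ := exists_isFirst h
    exact ⟨(⟨v.1, Nat.lt_succ_of_le hv.1⟩, ⟨v.2, Nat.lt_succ_of_le hv.2.1⟩), .inl hv⟩
  · exact ⟨(Fin.last _, Fin.last _), .inr ⟨h, rfl, rfl⟩⟩

/-- The DFA on pairs of positions in `x`. -/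
noncomputable def positionDFA (start : Fin (x.length + 1)) :
    DFA (PLetter W Q R) (Fin (x.length + 1) × Fin (x.length + 1)) where
  step u c := (exists_dfaStep x P c (u.1, u.2)).choose
  start := (start, 0)
  accept := {u | DfaAccept x P (u.1, u.2)}

variable {x P}

theorem positionDFA_step_eq_iff {start : Fin (x.length + 1)} {c : PLetter W Q R}
    {u v : Fin (x.length + 1) × Fin (x.length + 1)} :
    (positionDFA x P start).step u c = v ↔ DfaStep x P c (u.1, u.2) (v.1, v.2) := by
  constructor
  · rintro rfl
    exact (exists_dfaStep x P c (u.1, u.2)).choose_spec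
  · intro h
    have := DfaStep.unique x P (exists_dfaStep x P c (u.1, u.2)).choose_spec h
    simp only [Prod.mk.injEq] at this
    exact Prod.ext (Fin.ext this.1) (Fin.ext this.2)

/-- Every move inspects the symbol at the first position. Hence nothing leaves a pair with first
component `|x|`, and `(|x|, |x|)` can serve as the sink. -/
theorem PosMove.getElem?_ne_none {u v : ℕ × ℕ} {l : Option (PLetter W Q R)}
    (h : PosMove x P u l v) : x[u.1]? ≠ none := by
  intro hn
  rcases l with _ | c | c | c
  · rcases h with ⟨_, _, _, _, _, -, ⟨s, r, h, -⟩, -⟩ | ⟨h, -⟩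
    · simpa [hn] using getElem?_of_seg_encNum h
    · simp [hn] at h
  · simpa [hn] using h.1
  · obtain ⟨_, _, _, _, _, -, ⟨s, r, h, -⟩, -⟩ := h
    simpa [hn] using getElem?_of_seg_encNum h
  · obtain ⟨_, _, _, _, _, -, -, _, _, _, _, _, -, -, -, -, _, -, h, -⟩ := h
    simp [hn] at h

theorem eq_of_reach_dead {u v : ℕ × ℕ} (hu : u.1 = x.length)
    (h : Relation.ReflTransGen (FirstMove x P) u v) : u = v := by
  rcases h.cases_head with h | ⟨v', h, -⟩
  · exact h
  · exact absurd (by simp [hu]) h.2.2.1.getElem?_ne_none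

theorem not_posReach_dead {c : PLetter W Q R} {u v : ℕ × ℕ} (hu : u.1 = x.length) :
    ¬ PosReach x P c u v := by
  rintro ⟨v₁, h1, h2⟩
  obtain rfl := eq_of_reach_dead hu h1
  exact absurd (by simp [hu]) h2.getElem?_ne_none

theorem not_dfaAccept_dead {u : ℕ × ℕ} (hu : u.1 = x.length) : ¬ DfaAccept x P u := by
  rintro ⟨v, h1, ⟨q, s, -, h2⟩, -⟩
  obtain rfl := eq_of_reach_dead hu h1
  simpa [hu] using getElem?_of_seg_encNum h2

end Dfa

/-! ### The DFA on pairs of positions follows the transition system -/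

namespace Listing

variable {W Q R : Type*} {n k : ℕ} {D : Listing W Q R n k} {P : Language (PLetter W Q R)}

theorem exists_epsStep_of_firstMove {u v : ℕ × ℕ} {m : MicroState W Q (Fin n) (Fin k)}
    (hm : D.PosRep u m) (h : Relation.ReflTransGen (FirstMove D.code P) u v) :
    ∃ m', Relation.ReflTransGen (EpsStep (D.Micro P)) m m' ∧ D.PosRep v m' := by
  induction h with
  | refl => exact ⟨m, .refl, hm⟩
  | tail _ hstep ih =>
    obtain ⟨m', h1, h2⟩ := ih
    obtain ⟨m'', h3, h4⟩ := exists_micro_of_posMove h2 hstep.2.2.1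
    exact ⟨m'', h1.tail h3, h4⟩

/-- The position found for the target need not be the first one. But the first one represents some
unlabelled successor too, and by determinism this is the same state. -/
theorem exists_firstMove_of_epsStep (hdet : IsDeterministicLTS (D.Micro P)) {u : ℕ × ℕ}
    {m m' : MicroState W Q (Fin n) (Fin k)} (hm : D.PosRep u m)
    (h : Relation.ReflTransGen (EpsStep (D.Micro P)) m m') :
    ∃ v, Relation.ReflTransGen (FirstMove D.code P) u v ∧ D.PosRep v m' := by
  induction h with
  | refl => exact ⟨u, .refl, hm⟩
  | tail _ hstep ih =>
    obtain ⟨v, h1, h2⟩ := ih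
    obtain ⟨v', h3, h4⟩ := exists_posMove_of_micro h2 hstep
    obtain ⟨v'', h5⟩ := exists_isFirst (N := D.code.length) (φ := PosMove D.code P v none)
      ⟨v'.1, h4.le.1, v'.2, h4.le.2, h3⟩
    obtain ⟨m'', h6, h7⟩ := exists_micro_of_posMove h2 h5.2.2.1
    obtain rfl := hdet.unique _ _ _ _ hstep h6
    exact ⟨v'', h1.tail h5, h7⟩

theorem exists_letterStep_of_posReach {c : PLetter W Q R} {u v : ℕ × ℕ}
    {m : MicroState W Q (Fin n) (Fin k)} (hm : D.PosRep u m) (h : PosReach D.code P c u v) :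
    ∃ m', LetterStep (D.Micro P) c m m' ∧ D.PosRep v m' := by
  obtain ⟨v₁, h1, h2⟩ := h
  obtain ⟨m₁, h3, h4⟩ := exists_epsStep_of_firstMove hm h1
  obtain ⟨m', h5, h6⟩ := exists_micro_of_posMove h4 h2
  exact ⟨m', ⟨m₁, h3, h5⟩, h6⟩

theorem exists_posReach_of_letterStep (hdet : IsDeterministicLTS (D.Micro P)) {u : ℕ × ℕ}
    {c : PLetter W Q R} {m m' : MicroState W Q (Fin n) (Fin k)} (hm : D.PosRep u m)
    (h : LetterStep (D.Micro P) c m m') : ∃ v, PosReach D.code P c u v ∧ D.PosRep v m' := by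
  obtain ⟨m₁, h1, h2⟩ := h
  obtain ⟨v₁, h3, h4⟩ := exists_firstMove_of_epsStep hdet hm h1
  obtain ⟨v, h5, h6⟩ := exists_posMove_of_micro h4 h2
  exact ⟨v, ⟨v₁, h3, h5⟩, h6⟩

theorem finalStateFrom_and_iff {u : ℕ × ℕ} {m : MicroState W Q (Fin n) (Fin k)}
    (hm : D.PosRep u m) :
    ((∃ q, FinalStateFrom D.code u.1 q) ∧ u.2 = D.code.length) ↔ ∃ s ∈ D.final, m = .node s [] := by
  constructor
  · rintro ⟨⟨q, hq⟩, hu⟩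
    have hsym := hq
    obtain ⟨s', -, hsym⟩ := hsym
    have hsym := getElem?_of_seg_encNum hsym
    rcases m with ⟨s, v⟩ | ⟨w, s, v⟩ | ⟨s, a, v⟩
    · obtain ⟨⟨q', h1⟩, h2⟩ := hm
      obtain ⟨s', h3, h4⟩ := hq
      obtain ⟨rfl, rfl⟩ := isPrefixCode_encNum.seg h1 h4
      rw [hu, inputRep_length_iff] at h2
      exact ⟨s, (D.finalStateFrom_iff h1).1 ⟨s, h3, h4⟩, by rw [h2]⟩
    · obtain ⟨⟨q', h1⟩, -⟩ := hm
      rcases w with _ | ⟨c, w⟩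
      · simp [(seg_word_nil.1 h1).1] at hsym
      · simp [(seg_word_cons.1 h1).1] at hsym
    · simp [hm.2.1] at hsym
  · rintro ⟨s, hs, rfl⟩
    obtain ⟨⟨q', h1⟩, h2⟩ := hm
    refine ⟨⟨q', (D.finalStateFrom_iff h1).2 hs⟩, ?_⟩
    rcases h2 with ⟨-, h2⟩ | ⟨-, w, -, h2⟩ | ⟨h2, -⟩
    · simp [endmark] at h2
    · simp at h2
    · exact h2

/-- As long as a path exists, the DFA is in a pair representing the state reached; after that it
stays in the sink. This is the situation of `mem_acceptsFrom_iff`, and `mem_language_iff` translates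
paths with labels in `P` back into runs. -/
theorem mem_language_iff_accepts {valid : Set (Q × R)} (hP : IsCorrectProtocolLanguage valid P)
    (h : D.IsWellFormed) (hdet : D.IsDeterministic P) {r : Fin (D.code.length + 1)}
    (hr : StartAt D.code r) : D.input ∈ (D.automaton h).language P ↔
      ∃ z ∈ (positionDFA D.code P r).accepts, z ∈ P := by
  have hLTS := isDeterministicLTS_micro h hdet
  rw [mem_language_iff hP h]
  have key := mem_acceptsFrom_iff (mm := D.Micro P) (positionDFA D.code P r)
    (fun u m => D.PosRep (u.1, u.2) m)
    (fun u => (u.1 : ℕ) = D.code.length ∧ (u.2 : ℕ) = D.code.length)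
    (fun m => ∃ s ∈ D.final, m = .node s []) ?_ ?_ ?_ ?_ ?_ hLTS (r, 0)
    (.node D.start (endmark D.input)) (posRep_start hr)
  · constructor
    · rintro ⟨z, hz, s, hs, hrun⟩
      exact ⟨z, (key z).2 ⟨_, hrun, s, hs, rfl⟩, hz⟩
    · rintro ⟨z, hz, hzP⟩
      obtain ⟨_, hrun, s, hs, rfl⟩ := (key z).1 hz
      exact ⟨z, hzP, s, hs, hrun⟩
  · intro u m c m' hm hstep
    rcases positionDFA_step_eq_iff.1 (rfl : (positionDFA D.code P r).step u c = _) with h1 | ⟨h1, -⟩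
    · obtain ⟨m'', h2, h3⟩ := exists_letterStep_of_posReach hm h1.2.2.1
      obtain rfl := hLTS.letterStep_unique hstep h2
      exact h3
    · obtain ⟨v, h2, h3⟩ := exists_posReach_of_letterStep hLTS hm hstep
      exact absurd ⟨v.1, h3.le.1, v.2, h3.le.2, h2⟩ h1
  · intro u m c hm hstep
    rcases positionDFA_step_eq_iff.1 (rfl : (positionDFA D.code P r).step u c = _) with h1 | ⟨-, h1⟩
    · obtain ⟨m'', h2, h3⟩ := exists_letterStep_of_posReach hm h1.2.2.1
      exact absurd ⟨m'', h2⟩ hstep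
    · exact h1
  · intro u c hu
    rcases positionDFA_step_eq_iff.1 (rfl : (positionDFA D.code P r).step u c = _) with h1 | ⟨-, h1⟩
    · exact absurd h1.2.2.1 (not_posReach_dead hu.1)
    · exact h1
  · exact fun u hu => not_dfaAccept_dead hu.1
  · intro u m hm
    constructor
    · rintro ⟨v, h1, h2⟩
      obtain ⟨m', h3, h4⟩ := exists_epsStep_of_firstMove hm h1
      exact ⟨m', h3, (finalStateFrom_and_iff h4).1 h2⟩
    · rintro ⟨m', h1, h2⟩
      obtain ⟨v, h3, h4⟩ := exists_firstMove_of_epsStep hLTS hm h1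
      exact ⟨v, h3, (finalStateFrom_and_iff h4).2 h2⟩

end Listing

/-! ## Deciding the transitions of the DFA -/

namespace CounterProg

section Moves

variable {W Q R : Type*} {m : ℕ}

section Exists

variable {φ : List (DSym (PLetter W Q R)) → (Fin m → ℕ) → ℕ → ℕ → ℕ → ℕ → ℕ → Prop}

theorem Def.exWriteRule [Finite W] (h : Def (m + 5) fun x e =>
      φ x (Fin.init (Fin.init (Fin.init (Fin.init (Fin.init e)))))
        (Fin.init (Fin.init (Fin.init (Fin.init e))) (Fin.last m))
        (Fin.init (Fin.init (Fin.init e)) (Fin.last _)) (Fin.init (Fin.init e) (Fin.last _))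
        (Fin.init e (Fin.last _)) (e (Fin.last _))) :
    Def m fun x e => ∃ p p₁ p₂ p₃ q, IsWriteRule x p p₁ p₂ p₃ q ∧ φ x e p p₁ p₂ p₃ q :=
  (Def.allWriteRule (φ := fun x e p p₁ p₂ p₃ q => ¬ φ x e p p₁ p₂ p₃ q) h.not).not.congr
    fun x e _ => by push Not; rfl

theorem Def.exQueryRule [Finite W] [Finite Q] [Finite R] (h : Def (m + 5) fun x e =>
      φ x (Fin.init (Fin.init (Fin.init (Fin.init (Fin.init e)))))
        (Fin.init (Fin.init (Fin.init (Fin.init e))) (Fin.last m))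
        (Fin.init (Fin.init (Fin.init e)) (Fin.last _)) (Fin.init (Fin.init e) (Fin.last _))
        (Fin.init e (Fin.last _)) (e (Fin.last _))) :
    Def m fun x e => ∃ p p₁ p₂ p₃ q, IsQueryRule x p p₁ p₂ p₃ q ∧ φ x e p p₁ p₂ p₃ q :=
  (Def.allQueryRule (φ := fun x e p p₁ p₂ p₃ q => ¬ φ x e p p₁ p₂ p₃ q) h.not).not.congr
    fun x e _ => by push Not; rfl

end Exists

variable {a b c d : List (DSym (PLetter W Q R)) → (Fin m → ℕ) → ℕ}

theorem Def.sameNum (ha : IsVar a) (hb : IsVar b) (hc : IsVar c) :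
    Def m fun x e => SameNum x (a x e) (b x e) (c x e) := by
  refine .app3 (R := fun x i p q => SameNum x i p q) ?_ ha hb hc
  refine Def.congr (φ := fun x e => ∃ s ≤ x.length, ∃ r ≤ x.length, Seg x (e 0) (encNum s) r ∧
    Seg x (e 1) (encNum s) (e 2)) ?_ fun x e _ => ?_
  · repeat' first
      | exact ⟨_, fun _ _ => rfl⟩
      | apply Def.ex | apply Def.segNum | apply Def.and
  · exact ⟨fun ⟨s, r, h, h'⟩ => ⟨s, num_le_of_seg h, r, h.le_length, h, h'⟩,
      fun ⟨s, _, r, _, h⟩ => ⟨s, r, h⟩⟩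

theorem Def.isFirst {α : Type*} {S : List α → ℕ → ℕ → ℕ → ℕ → Prop}
    (h : Def 4 fun x e => S x (e 0) (e 1) (e 2) (e 3)) :
    Def 4 fun x e => IsFirst x.length (fun v => S x (e 0) (e 1) v.1 v.2) (e 2, e 3) := by
  refine Def.congr (φ := fun x e => S x (e 0) (e 1) (e 2) (e 3) ∧ ∀ i ≤ x.length, ∀ j ≤ x.length,
    S x (e 0) (e 1) i j → e 2 < i ∨ (e 2 = i ∧ e 3 ≤ j)) ?_ fun x e he => ?_
  · refine .and h (.all (.all (.imp (.app4 h ⟨_, fun _ _ => rfl⟩ ⟨_, fun _ _ => rfl⟩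
      ⟨_, fun _ _ => rfl⟩ ⟨_, fun _ _ => rfl⟩) (.or (.lt ⟨_, fun _ _ => rfl⟩ ⟨_, fun _ _ => rfl⟩)
      (.and (.eq ⟨_, fun _ _ => rfl⟩ ⟨_, fun _ _ => rfl⟩)
        (.le ⟨_, fun _ _ => rfl⟩ ⟨_, fun _ _ => rfl⟩))))))
  · exact ⟨fun h => h.2.2, fun h => ⟨he 2, he 3, h⟩⟩

theorem reachFirstMove_le {x : List (DSym (PLetter W Q R))} {P : Language (PLetter W Q R)}
    {u v : ℕ × ℕ} (h : Relation.ReflTransGen (FirstMove x P) u v) (h1 : u.1 ≤ x.length)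
    (h2 : u.2 ≤ x.length) : v.1 ≤ x.length ∧ v.2 ≤ x.length := by
  rcases h.cases_tail with rfl | ⟨w, -, h⟩
  · exact ⟨h1, h2⟩
  · exact ⟨h.1, h.2.1⟩

variable [Finite W] [Finite Q] [Finite R]

theorem Def.readMove (ha : IsVar a) (hb : IsVar b) (hc : IsVar c) (hd : IsVar d) :
    Def m fun x e => ReadMove x (a x e) (b x e) (c x e) (d x e) := by
  refine .app4 (R := fun x p q i i' => ReadMove x p q i i') ?_ ha hb hc hd
  refine Def.congr (φ := fun x e => (x[e 0]? = some .eps ∧ e 2 = e 3) ∨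
    ((x[e 0]? = some .left ∧ e 2 = 0 ∧ ∃ n ≤ x.length, ∃ k ≤ x.length, InputAt x n k (e 3)) ∨
    ((x[e 0]? = some .right ∧ ¬ e 2 = 0 ∧ x[e 2]? = some .semicolon ∧ e 2 + 1 = e 3) ∨
    (∃ i ≤ x.length, Seg x (e 0) (encNum i) (e 1) ∧ ¬ e 2 = 0 ∧ Seg x (e 2) (encNum i) (e 3)))))
    ?_ fun x e _ => ?_
  · repeat' first
      | exact ⟨_, fun _ _ => rfl⟩
      | apply Def.ex | apply Def.eqZero | apply Def.succ | apply Def.eq | apply Def.sym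
      | apply Def.inputAt | apply Def.segNum | apply Def.and | apply Def.or | apply Def.not
  · refine or_congr Iff.rfl (or_congr (and_congr Iff.rfl (and_congr Iff.rfl ?_))
      (or_congr Iff.rfl ?_))
    · exact ⟨fun ⟨n, k, h⟩ => ⟨n, h.le.1, k, h.le.2.1, h⟩, fun ⟨n, _, k, _, h⟩ => ⟨n, k, h⟩⟩
    · exact ⟨fun ⟨i, h, h'⟩ => ⟨i, num_le_of_seg h, h, h'⟩, fun ⟨i, _, h⟩ => ⟨i, h⟩⟩

theorem Def.posMove (P : Language (PLetter W Q R)) (l : Option (PLetter W Q R)) :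
    Def 4 fun x e => PosMove x P (e 0, e 1) l (e 2, e 3) := by
  rcases l with _ | c | c | c
  · refine .or (.exWriteRule ?_) ?_ <;> repeat' first
      | exact ⟨_, fun _ _ => rfl⟩
      | apply Def.succ | apply Def.eq | apply Def.sym
      | apply Def.sameNum | apply Def.readMove | apply Def.and
  · refine .and (.sym _ ⟨0, fun _ _ => rfl⟩) (.and (.succ ⟨0, fun _ _ => rfl⟩ ⟨2, fun _ _ => rfl⟩)
      (.eq ⟨1, fun _ _ => rfl⟩ ⟨3, fun _ _ => rfl⟩))
  · refine .exQueryRule ?_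
    repeat' first
      | exact ⟨_, fun _ _ => rfl⟩
      | apply Def.eq | apply Def.sym
      | apply Def.sameNum | apply Def.and
  · refine .exQueryRule (.and ?_ (.exQueryRule (.and ?_ (.and ?_ (.and ?_ (.existsFinite fun a =>
      .and (.const _) ?_))))))
    all_goals
      repeat' first
      | exact ⟨_, fun _ _ => rfl⟩
      | apply Def.eq | apply Def.sym
      | apply Def.sameNum | apply Def.and

theorem Def.firstMove (P : Language (PLetter W Q R)) :
    Def 4 fun x e => FirstMove x P (e 0, e 1) (e 2, e 3) :=
  Def.isFirst (S := fun x i j i' j' => PosMove x P (i, j) none (i', j')) (.posMove P none)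

theorem Def.reachFirstMove (P : Language (PLetter W Q R)) (ha : IsVar a) (hb : IsVar b)
    (hc : IsVar c) (hd : IsVar d) : Def m fun x e =>
      Relation.ReflTransGen (FirstMove x P) (a x e, b x e) (c x e, d x e) :=
  .reach (E := fun x _ _ => FirstMove x P) (fun _ _ _ _ _ _ h h' => h.unique h')
    (fun _ _ _ _ _ h => ⟨h.1, h.2.1⟩)
    (.app4 (R := fun x i j i' j' => FirstMove x P (i, j) (i', j')) (.firstMove P)
      ⟨2, fun _ _ => rfl⟩ ⟨3, fun _ _ => rfl⟩ ⟨4, fun _ _ => rfl⟩ ⟨5, fun _ _ => rfl⟩)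
    ha hb ha hb hc hd

theorem Def.posReach (P : Language (PLetter W Q R)) (l : PLetter W Q R) :
    Def 4 fun x e => PosReach x P l (e 0, e 1) (e 2, e 3) := by
  refine Def.congr (φ := fun x e => ∃ i ≤ x.length, ∃ j ≤ x.length,
    Relation.ReflTransGen (FirstMove x P) (e 0, e 1) (i, j) ∧
      PosMove x P (i, j) (some l) (e 2, e 3)) ?_ fun x e he => ?_
  · exact .ex (.ex (.and (.reachFirstMove P ⟨_, fun _ _ => rfl⟩ ⟨_, fun _ _ => rfl⟩
      ⟨_, fun _ _ => rfl⟩ ⟨_, fun _ _ => rfl⟩)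
      (.app4 (R := fun x i j i' j' => PosMove x P (i, j) (some l) (i', j')) (.posMove P _)
        ⟨_, fun _ _ => rfl⟩ ⟨_, fun _ _ => rfl⟩ ⟨_, fun _ _ => rfl⟩ ⟨_, fun _ _ => rfl⟩)))
  · constructor
    · rintro ⟨v, h1, h2⟩
      have := reachFirstMove_le h1 (he 0) (he 1)
      exact ⟨v.1, this.1, v.2, this.2, h1, h2⟩
    · rintro ⟨i, -, j, -, h⟩
      exact ⟨(i, j), h⟩

theorem Def.dfaStep (P : Language (PLetter W Q R)) (l : PLetter W Q R) :
    Def 4 fun x e => DfaStep x P l (e 0, e 1) (e 2, e 3) :=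
  .or (.isFirst (S := fun x i j i' j' => PosReach x P l (i, j) (i', j')) (.posReach P l))
    (.and (.not (.ex (.ex (.app4 (R := fun x i j i' j' => PosReach x P l (i, j) (i', j'))
      (.posReach P l) ⟨_, fun _ _ => rfl⟩ ⟨_, fun _ _ => rfl⟩ ⟨_, fun _ _ => rfl⟩
        ⟨_, fun _ _ => rfl⟩))))
      (.and (.eqLength ⟨2, fun _ _ => rfl⟩) (.eqLength ⟨3, fun _ _ => rfl⟩)))

theorem Def.dfaAccept (P : Language (PLetter W Q R)) :
    Def 2 fun x e => DfaAccept x P (e 0, e 1) := by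
  refine Def.congr (φ := fun x e => ∃ i ≤ x.length, ∃ j ≤ x.length,
    Relation.ReflTransGen (FirstMove x P) (e 0, e 1) (i, j) ∧
      (∃ q ≤ x.length, FinalStateFrom x i q) ∧ j = x.length) ?_ fun x e he => ?_
  · repeat' first
      | exact ⟨_, fun _ _ => rfl⟩
      | apply Def.ex | apply Def.reachFirstMove | apply Def.finalStateFrom | apply Def.eqLength
      | apply Def.and
  · constructor
    · rintro ⟨v, h1, ⟨q, h2⟩, h3⟩
      have := reachFirstMove_le h1 (he 0) (he 1)
      obtain ⟨s, -, h4⟩ := id h2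
      exact ⟨v.1, this.1, v.2, this.2, h1, ⟨q, h4.le_length, h2⟩, h3⟩
    · rintro ⟨i, -, j, -, h1, ⟨q, -, h2⟩, h3⟩
      exact ⟨(i, j), h1, ⟨q, h2⟩, h3⟩

end Moves

end CounterProg

/-! ## The reduction -/

section Unique

variable {Γ : Type*}

/-- The code of a transition of a DFA. -/
def encTransition {n : ℕ} (t : Fin n × Γ × Fin n) : List (DSym Γ) :=
  encNum t.1 ++ [DSym.letter t.2.1] ++ encNum t.2.2

theorem isPrefixCode_encTransition {n : ℕ} : IsPrefixCode (encTransition (Γ := Γ) (n := n)) := by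
  rintro ⟨s, a, t⟩ ⟨s', a', t'⟩ u u' h
  simp only [encTransition, List.append_assoc] at h
  obtain ⟨h1, h'⟩ := isPrefixCode_encNum_fin _ _ _ _ h
  simp only [List.singleton_append, List.cons.injEq, DSym.letter.injEq] at h'
  obtain ⟨h2, h''⟩ := h'
  obtain ⟨h3, h4⟩ := isPrefixCode_encNum_fin _ _ _ _ h''
  simp only [h1, h2, h3, h4, and_true]

theorem avoidsSemicolon_encTransition {n : ℕ} :
    AvoidsSemicolon (encTransition (Γ := Γ) (n := n)) := by
  intro t u u'
  simp only [encTransition, List.append_assoc]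
  exact avoidsSemicolon_encNum _ _ _

/-- Unique readability: equal words have equal components, and the list of transitions determines
the step function. So realizability may be tested on any DFA having the given description. -/
theorem DFA.IsDescription.accepts_eq {n n' : ℕ} {B : DFA Γ (Fin n)} {B' : DFA Γ (Fin n')}
    {x : List (DSym Γ)} (h : B.IsDescription x) (h' : B'.IsDescription x) :
    B.accepts = B'.accepts := by
  obtain ⟨lf, lt, h1, h2, rfl⟩ := h
  obtain ⟨lf', lt', h1', h2', h⟩ := h'
  change encNum n ++ encNum B.start ++ encList (encFin n) lf ++ encList encTransition lt =
    encNum n' ++ encNum B'.start ++ encList (encFin n') lf' ++ encList encTransition lt' at h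
  simp only [List.append_assoc] at h
  obtain ⟨rfl, g1⟩ := isPrefixCode_encNum _ _ _ _ h
  obtain ⟨h3, g2⟩ := isPrefixCode_encNum_fin _ _ _ _ g1
  obtain ⟨rfl, g3⟩ := (isPrefixCode_encList_encFin n) _ _ _ _ g2
  rw [← List.append_nil (encList _ lt), ← List.append_nil (encList _ lt')] at g3
  obtain ⟨rfl, -⟩ := (isPrefixCode_encTransition.encList avoidsSemicolon_encTransition) _ _ _ _ g3
  have : B = B' := by
    rcases B with ⟨step, start, accept⟩
    rcases B' with ⟨step', start', accept'⟩
    simp only [DFA.mk.injEq]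
    refine ⟨funext fun s => funext fun a => ?_, h3, Set.ext fun s => (h1 s).symm.trans (h1' s)⟩
    exact ((h2' s a (step s a)).1 ((h2 s a (step s a)).2 rfl)).symm
  rw [this]

theorem mem_regularRealizability_iff {n : ℕ} {B : DFA Γ (Fin n)} {x : List (DSym Γ)}
    (h : B.IsDescription x) (F : Language Γ) :
    x ∈ regularRealizability F ↔ ∃ p ∈ B.accepts, p ∈ F := by
  constructor
  · rintro ⟨n', B', h', p, hp, hF⟩
    exact ⟨p, h'.accepts_eq h ▸ hp, hF⟩
  · exact fun hp => ⟨n, B, h, hp⟩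

/-- The empty word is the image of all words that are not deterministic instances. -/
theorem nil_notMem_regularRealizability (F : Language Γ) : [] ∉ regularRealizability F := by
  rintro ⟨n, B, ⟨lf, lt, -, -, h⟩, -⟩
  simp [encNum] at h

end Unique

theorem flatMap_finRange {β : Type*} (n : ℕ) (g : ℕ → List β) :
    ((List.finRange n).flatMap fun i : Fin n => g i) = (List.range n).flatMap g := by
  rw [← List.map_coe_finRange_eq_range]
  exact (List.flatMap_map _ _ _).symm

theorem flatMap_range_const {β : Type*} (n : ℕ) (l : List β) :
    ((List.range n).flatMap fun _ => l) = (List.replicate n l).flatten := by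
  simp [List.flatMap_def]

theorem flatMap_range_ite {β : Type*} {n a : ℕ} (h : a ≤ n) (l : List β) {p : ℕ → Prop}
    {_ : DecidablePred p} (hp : ∀ i, p i ↔ i < a) :
    ((List.range n).flatMap fun i => if p i then l else []) = (List.replicate a l).flatten := by
  obtain ⟨d, rfl⟩ := Nat.exists_eq_add_of_le h
  induction d with
  | zero =>
    rw [Nat.add_zero, ← flatMap_range_const]
    exact List.flatMap_congr fun i hi => if_pos ((hp i).2 (List.mem_range.1 hi))
  | succ d ih =>
    rw [← Nat.add_assoc, List.range_succ, List.flatMap_append, ih (by omega)]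
    simp [hp]

theorem flatMap_range_unique {β : Type*} {n r : ℕ} (hr : r < n) (g : ℕ → List β) {p : ℕ → Prop}
    {_ : DecidablePred p} (hp : ∀ i, p i ↔ i = r) :
    ((List.range n).flatMap fun i => if p i then g i else []) = g r := by
  obtain ⟨d, rfl⟩ := Nat.exists_eq_add_of_lt hr
  induction d with
  | zero =>
    rw [Nat.add_zero, List.range_succ, List.flatMap_append, List.flatMap_eq_nil_iff.2 fun i hi =>
      if_neg fun h => (List.mem_range.1 hi).ne ((hp i).1 h)]
    simp [hp]
  | succ d ih =>
    rw [← Nat.add_assoc r d 1, List.range_succ, List.flatMap_append, ih (by omega)]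
    have : r + d + 1 ≠ r := by omega
    simp [hp, this]

/-! ### Printing the numbers of pairs in unary -/

namespace CounterProg

section Numerals

variable {Γ : Type*} {m : ℕ} {a b : List (DSym Γ) → (Fin m → ℕ) → ℕ}

-- The loop runs over all `i ≤ |x|` and prints one copy for each `i` below the value of `a`.
open Classical in
theorem Out.repeat {g : List (DSym Γ) → List (DSym Γ)} (ha : IsVar a)
    (hg : ∀ m, Out m fun x _ => g x) :
    Out m fun x e => (List.replicate (a x e) (g x)).flatten := by
  refine Out.vars (k := 1) (g := fun x e => (List.replicate (e 0) (g x)).flatten) ?_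
    (a := fun _ => a) fun _ => ha
  refine Out.congr (Out.flatMapRange (g := fun x e i => @_root_.ite _ (i < e 0)
    (Classical.propDecidable _) (g x) [])
    (.ite (.lt ⟨1, fun _ _ => rfl⟩ ⟨0, fun _ _ => rfl⟩) (hg _) .nil)) fun x e he => ?_
  exact (flatMap_range_ite (p := fun i => i < e 0) (Nat.le_succ_of_le (he 0)) _ fun _ => Iff.rfl).symm

theorem Out.repeatRange (l : List (DSym Γ)) (h : ∀ m, Out m fun (_ : List (DSym Γ)) _ => l) :
    Out m fun x _ => (List.replicate (x.length + 1) l).flatten :=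
  (Out.flatMapRange (g := fun _ _ _ => l) (h _)).congr fun _ _ _ => (flatMap_range_const _ _).symm

/-- The code of the number of a pair. -/
theorem Out.encPair (ha : IsVar a) (hb : IsVar b) :
    Out m fun x e => encNum (b x e + (x.length + 1) * a x e) := by
  refine Out.congr (((Out.repeat hb fun _ => .emit DSym.tick).append (Out.repeat ha fun m =>
    Out.repeatRange [DSym.tick] fun _ => .emit _)).append (.emit DSym.comma)) fun x e _ => ?_
  rw [List.flatten_replicate_singleton, List.flatten_replicate_singleton,
    List.flatten_replicate_replicate, encNum, List.replicate_add, mul_comm]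

/-- The product may exceed every value a counter can hold, so its ticks are printed by two nested
loops, and the number itself is never stored. -/
theorem Out.encMul (ha : IsVar a) : Out m fun x e => encNum ((x.length + 1) * a x e) := by
  refine Out.congr ((Out.repeat ha fun m =>
    Out.repeatRange [DSym.tick] fun _ => .emit _).append (.emit DSym.comma)) fun x e _ => ?_
  simp only [encNum, List.flatten_replicate_replicate, List.flatten_replicate_singleton, mul_comm]

theorem Out.encSquare : Out m fun (x : List (DSym Γ)) _ =>
    encNum ((x.length + 1) * (x.length + 1)) := by
  refine Out.congr ((Out.flatMapRange (g := fun x _ _ =>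
    (List.replicate (x.length + 1) [DSym.tick]).flatten)
      (Out.repeatRange [DSym.tick] fun _ => .emit _)).append (.emit DSym.comma)) fun x e _ => ?_
  simp only [flatMap_range_const, List.flatten_replicate_replicate,
    List.flatten_replicate_singleton, encNum]

end Numerals

end CounterProg

section Reduction

variable {W Q R : Type*} (letters : List (PLetter W Q R)) (P : Language (PLetter W Q R))
  (x : List (DSym (PLetter W Q R)))

open Classical in
/-- The code of the initial state of the DFA on pairs of positions. -/
noncomputable def startCode : List (DSym (PLetter W Q R)) :=
  (List.range (x.length + 1)).flatMap fun r =>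
    if StartAt x r then encNum ((x.length + 1) * r) else []

open Classical in
/-- The code of the state `(i, j)` of the DFA on pairs of positions, if it is accepting. -/
noncomputable def acceptCode (i j : ℕ) : List (DSym (PLetter W Q R)) :=
  if DfaAccept x P (i, j) then encNum (j + (x.length + 1) * i) else []

open Classical in
/-- The code of a transition of the DFA on pairs of positions. -/
noncomputable def stepCode (c : PLetter W Q R) (i j i' j' : ℕ) : List (DSym (PLetter W Q R)) :=
  if DfaStep x P c (i, j) (i', j') then encNum (j + (x.length + 1) * i) ++ [.letter c] ++
    encNum (j' + (x.length + 1) * i') else []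

/-- The code of the DFA on pairs of positions. -/
noncomputable def positionCode : List (DSym (PLetter W Q R)) :=
  encNum ((x.length + 1) * (x.length + 1)) ++ startCode x ++
  (((List.range (x.length + 1)).flatMap fun i => (List.range (x.length + 1)).flatMap fun j =>
    acceptCode P x i j) ++ [.semicolon]) ++
  (((List.range (x.length + 1)).flatMap fun i => (List.range (x.length + 1)).flatMap fun j =>
    letters.flatMap fun c =>
    (List.range (x.length + 1)).flatMap fun i' => (List.range (x.length + 1)).flatMap fun j' =>
    stepCode P x c i j i' j') ++ [.semicolon])

/-- The word describes a deterministic automaton and its input. -/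
def IsDeterministicInstance : Prop := HasWellFormedListing x ∧ HasDeterministicListing x P

open Classical in
/-- The reduction of the membership problem. -/
noncomputable def reduction : List (DSym (PLetter W Q R)) :=
  if IsDeterministicInstance P x then positionCode letters P x else []

open CounterProg

theorem out_startCode : Out 0 fun (x : List (DSym (PLetter W Q R))) _ => startCode x :=
  .flatMapRange (.ite (.startAt ⟨_, fun _ _ => rfl⟩) (.encMul ⟨_, fun _ _ => rfl⟩) .nil)

variable [Finite W] [Finite Q] [Finite R]

theorem out_acceptCode : Out 2 fun x e => acceptCode P x (e 0) (e 1) :=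
  .ite (.dfaAccept P) (.encPair ⟨0, fun _ _ => rfl⟩ ⟨1, fun _ _ => rfl⟩) .nil

theorem out_stepCode (c : PLetter W Q R) :
    Out 4 fun x e => stepCode P x c (e 0) (e 1) (e 2) (e 3) :=
  .ite (.dfaStep P c) (.append (.append (.encPair ⟨0, fun _ _ => rfl⟩ ⟨1, fun _ _ => rfl⟩)
    (.emit _)) (.encPair ⟨2, fun _ _ => rfl⟩ ⟨3, fun _ _ => rfl⟩)) .nil

theorem out_positionCode : Out 0 fun x _ => positionCode letters P x := by
  refine .append (.append (.append .encSquare out_startCode) (.append (.flatMapRange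
    (.flatMapRange ?_)) (.emit _))) (.append (.flatMapRange (.flatMapRange (.flatMapList (fun c =>
      .flatMapRange (.flatMapRange ?_)) letters))) (.emit _))
  · exact out_acceptCode P
  · exact out_stepCode P c

theorem logSpaceComputable_reduction : LogSpaceComputable (reduction letters P) :=
  Out.logSpaceComputable (.ite (.and .hasWellFormedListing (.hasDeterministicListing P))
    (out_positionCode letters P) .nil)

end Reduction

/-! ### Correctness of the reduction -/

section Correctness

variable {W Q R : Type*} {letters : List (PLetter W Q R)} {P : Language (PLetter W Q R)}
  {x : List (DSym (PLetter W Q R))}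

/-- `finProdFinEquiv` numbers the pair `(i, j)` by `j + (|x| + 1) * i`, which is the number printed
by the loops. By `hu` exactly one iteration of the loop in `startCode` prints anything, namely the
number of `(r, 0)`. -/
theorem isDescription_positionCode (hl : ∀ c, c ∈ letters) {r : Fin (x.length + 1)}
    (hr : StartAt x r) (hu : ∀ r', StartAt x r' → r' = r) :
    ((positionDFA x P r).reindex finProdFinEquiv).IsDescription (positionCode letters P x) := by
  classical
  refine ⟨(List.finRange (x.length + 1)).flatMap fun i : Fin (x.length + 1) => (List.finRange (x.length + 1)).flatMap fun j : Fin (x.length + 1) =>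
      if DfaAccept x P (i, j) then [finProdFinEquiv (i, j)] else [],
    (List.finRange (x.length + 1)).flatMap fun i : Fin (x.length + 1) => (List.finRange (x.length + 1)).flatMap fun j : Fin (x.length + 1) => letters.flatMap fun c =>
      (List.finRange (x.length + 1)).flatMap fun i' : Fin (x.length + 1) => (List.finRange (x.length + 1)).flatMap fun j' : Fin (x.length + 1) =>
      if DfaStep x P c (i, j) (i', j') then
        [(finProdFinEquiv (i, j), c, finProdFinEquiv (i', j'))] else [], fun s => ?_,
    fun s c s' => ?_, ?_⟩
  · obtain ⟨⟨i, j⟩, rfl⟩ := finProdFinEquiv.surjective s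
    simp only [List.mem_flatMap, List.mem_finRange, true_and, DFA.reindex, Equiv.coe_fn_mk,
      Set.mem_preimage, Equiv.symm_apply_apply]
    constructor
    · rintro ⟨i', j', h⟩
      split_ifs at h with h'
      · obtain ⟨rfl, rfl⟩ : i = i' ∧ j = j' := by simpa using h
        exact h'
      · simp at h
    · intro h
      exact ⟨i, j, by rw [if_pos (show DfaAccept x P (i, j) from h)]; simp⟩
  · obtain ⟨⟨i, j⟩, rfl⟩ := finProdFinEquiv.surjective s
    obtain ⟨⟨i', j'⟩, rfl⟩ := finProdFinEquiv.surjective s'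
    simp only [List.mem_flatMap, List.mem_finRange, true_and, DFA.reindex, Equiv.coe_fn_mk,
      Equiv.symm_apply_apply, EmbeddingLike.apply_eq_iff_eq, positionDFA_step_eq_iff]
    constructor
    · rintro ⟨i₁, j₁, c₁, -, i₂, j₂, h⟩
      split_ifs at h with h'
      · simp only [List.mem_singleton, Prod.mk.injEq, EmbeddingLike.apply_eq_iff_eq] at h
        obtain ⟨⟨rfl, rfl⟩, rfl, rfl, rfl⟩ := h
        exact h'
      · simp at h
    · intro h
      exact ⟨i, j, c, hl c, i', j', by rw [if_pos h]; simp⟩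
  · have hstart : startCode x = encNum ((positionDFA x P r).reindex finProdFinEquiv).start := by
      rw [startCode, flatMap_range_unique r.2 (fun r => encNum ((x.length + 1) * r))
        fun i => ⟨hu i, fun h => h ▸ hr⟩]
      simp [DFA.reindex, positionDFA]
    have haccept : ∀ i j : Fin (x.length + 1), (if DfaAccept x P (i, j) then
        [finProdFinEquiv (i, j)] else []).flatMap
        (fun s : Fin ((x.length + 1) * (x.length + 1)) => encNum s) =
        acceptCode P x i j := fun i j => by
      unfold acceptCode
      split_ifs <;> simp
    have hstep : ∀ c (i j i' j' : Fin (x.length + 1)), (if DfaStep x P c (i, j) (i', j') then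
        [(finProdFinEquiv (i, j), c, finProdFinEquiv (i', j'))] else []).flatMap
        (fun t => encNum (t.1 : ℕ) ++ [DSym.letter t.2.1] ++ encNum (t.2.2 : ℕ)) =
        stepCode P x c i j i' j' := fun c i j i' j' => by
      unfold stepCode
      split_ifs <;> simp
    rw [positionCode, hstart]
    simp only [encList, List.flatMap_assoc, haccept, hstep, ← flatMap_finRange]

theorem positionCode_mem_regularRealizability_iff {valid : Set (Q × R)}
    (hP : IsCorrectProtocolLanguage valid P) (hl : ∀ c, c ∈ letters) {n k : ℕ}
    {D : Listing W Q R n k} (h : D.IsWellFormed) (hdet : D.IsDeterministic P) :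
    positionCode letters P D.code ∈ regularRealizability P ↔
      D.input ∈ (D.automaton h).language P := by
  obtain ⟨r, q, g1, g2⟩ := D.exists_startAt
  obtain ⟨r, rfl⟩ : ∃ r' : Fin (D.code.length + 1), (r' : ℕ) = r :=
    ⟨⟨r, Nat.lt_succ_of_le g1.le.2.2⟩, rfl⟩
  have hr := D.startAt_iff.2 g1
  rw [mem_regularRealizability_iff (isDescription_positionCode (P := P) hl hr
    fun r' hr' => ((D.startAt_iff.1 hr').unique g1).2.2), DFA.accepts_reindex,
    ← Listing.mem_language_iff_accepts hP h hdet hr]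

/-- Well-formedness and determinism are part of membership on the left. A word failing either of
them is sent to the empty word, which describes no DFA. -/
theorem mem_membershipProblem1D_iff_reduction {valid : Set (Q × R)}
    (hP : IsCorrectProtocolLanguage valid P) (hl : ∀ c, c ∈ letters) :
    x ∈ membershipProblem1D P ↔ reduction letters P x ∈ regularRealizability P := by
  unfold reduction
  constructor
  · intro hx
    obtain ⟨n, k, D, hwf, rfl, hdet, hw⟩ := Listing.mem_membershipProblem1D_iff.1 hx
    rw [Listing.automaton_isDeterministic_iff] at hdet
    rw [if_pos ⟨D.hasWellFormedListing_iff.2 hwf, (D.hasDeterministicListing_iff P).2 hdet⟩]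
    exact (positionCode_mem_regularRealizability_iff hP hl hwf hdet).2 hw
  · split_ifs with h
    · obtain ⟨n, k, D, rfl, hwf⟩ := hasWellFormedListing_iff_exists.1 h.1
      have hdet := (D.hasDeterministicListing_iff P).1 h.2
      exact fun hx => Listing.mem_membershipProblem1D_iff.2 ⟨n, k, D, hwf, rfl,
        (Listing.automaton_isDeterministic_iff hwf P).2 hdet,
        (positionCode_mem_regularRealizability_iff hP hl hwf hdet).1 hx⟩
    · exact fun hx => absurd hx (nil_notMem_regularRealizability P)

end Correctness

theorem mainTheorem7 {W Q R : Type*} [Finite W] [Finite Q] [Finite R] [Nonempty Q] [Nonempty R]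
    (valid : Set (Q × R)) (PROT : Language (PLetter W Q R))
    (hPROT : IsCorrectProtocolLanguage valid PROT) :
    LogSpaceReducible (membershipProblem1D PROT) (regularRealizability PROT) := by
  -- A fixed enumeration of the protocol alphabet, over which the program prints the transitions of
  -- each state.
  obtain ⟨letters, -, hl⟩ := Finite.exists_univ_list (PLetter W Q R)
  exact ⟨reduction letters PROT, logSpaceComputable_reduction letters PROT,
    fun x => mem_membershipProblem1D_iff_reduction hPROT hl⟩
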